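/- Consider a planar map $D$, that is, a finite connected graph properly embedded in the plane, and suppose that $D$ is a dissection of the hexagon by quadrangular faces: its outer face is bounded by a simple cycle of length $6$ and all its other faces have degree $4$. Suppose that $D$ is irreducible: it has at least $4$ faces, counting the outer one, and every $4$-cycle of $D$ is the boundary of a face. A vertex or an edge is called outer if it is incident to the outer face, and inner otherwise; each edge consists of two half-edges, one at each of its ends. A tri-orientation of $D$ is an orientation of each half-edge of each inner edge, either outward (out of the vertex to which it is attached) or inward (toward that vertex), such that every outer vertex has no outward half-edge, every inner vertex has exactly $3$ outward half-edges, and the two halves of an inner edge are never both inward. An inner edge is bi-oriented if both its halves are outward, and simply oriented if one half is outward and the other is inward; in the second case it is directed from the vertex of its outward half to the vertex of its inward half. A clockwise circuit is a simple cycle $\mathcal{C}$ of inner edges each of which is either bi-oriented or simply oriented with the interior of $\mathcal{C}$ on its right. Theorem. Every irreducible dissection $D$ of the hexagon by quadrangular faces has exactly one tri-orientation without clockwise circuit. -/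

import Mathlib

/-- A planar map (a connected graph properly embedded in the plane, up to deformation), given
by its rotation system. The elements of `H` are the half-edges. Each half-edge is attached to a
vertex, its origin, and is also regarded as its edge directed away from that origin.
`rot` sends a half-edge to the next one in counterclockwise order around its origin, `opp` sends
it to the other half of its edge. Vertices, edges and faces are the orbits of `rot`, `opp` and
`rot * opp`. The last permutation follows the boundary of a face keeping the face on the right,
so that the face attached to a half-edge is the one on its right. Planarity is Euler's relation
for a connected map, and `outer` is the unbounded face. -/
structure PlanarMap (H : Type*) where
  finite : Finite H
  rot : Equiv.Perm H
  opp : Equiv.Perm H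
  opp_opp : ∀ h, opp (opp h) = h
  opp_ne : ∀ h, opp h ≠ h
  connected : ∀ h k, Relation.ReflTransGen (fun a b => b = rot a ∨ b = opp a) h k
  euler : (Nat.card (Quotient (Equiv.Perm.SameCycle.setoid rot)) : ℤ)
      - Nat.card (Quotient (Equiv.Perm.SameCycle.setoid opp))
      + Nat.card (Quotient (Equiv.Perm.SameCycle.setoid (rot * opp))) = 2
  outer : Quotient (Equiv.Perm.SameCycle.setoid (rot * opp))

namespace PlanarMap

variable {H : Type*} (M : PlanarMap H)

/-- Vertices of the map. -/
abbrev Vertex : Type _ := Quotient (Equiv.Perm.SameCycle.setoid M.rot)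

/-- Faces of the map, including the outer one. -/
abbrev Face : Type _ := Quotient (Equiv.Perm.SameCycle.setoid (M.rot * M.opp))

/-- The vertex to which a half-edge is attached. -/
def origin (h : H) : M.Vertex := Quotient.mk _ h

/-- The face on the right of a half-edge. -/
def face (h : H) : M.Face := Quotient.mk _ h

/-- The degree of a face: the number of edge sides on its boundary. -/
noncomputable def faceDegree (f : M.Face) : ℕ := Nat.card {h : H // M.face h = f}

/-- A vertex is outer if it is incident to the outer face. -/
def IsOuterVertex (v : M.Vertex) : Prop := ∃ h, M.origin h = v ∧ M.face h = M.outer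

/-- A half-edge is inner if its edge is not incident to the outer face. -/
def IsInner (h : H) : Prop := M.face h ≠ M.outer ∧ M.face (M.opp h) ≠ M.outer

theorem IsInner.opp {M : PlanarMap H} {h : H} (hh : M.IsInner h) : M.IsInner (M.opp h) :=
  ⟨hh.2, by rw [M.opp_opp]; exact hh.1⟩

/-- The inner half-edges. -/
abbrev InnerHalfEdge : Type _ := {h : H // M.IsInner h}

/-- The other half of an inner edge. -/
def innerOpp (h : M.InnerHalfEdge) : M.InnerHalfEdge := ⟨M.opp h.1, h.2.opp⟩

/-- A simple cycle of length `n`, traversed along `c 0, c 1, …, c (n - 1)` (indices modulo `n`):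
consecutive edges, pairwise distinct vertices, pairwise distinct edges. -/
structure IsSimpleCycle {n : ℕ} [NeZero n] (c : Fin n → H) : Prop where
  chain : ∀ i, M.origin (M.opp (c i)) = M.origin (c (i + 1))
  vertices_distinct : Function.Injective fun i => M.origin (c i)
  edges_distinct : ∀ i j, c j ≠ M.opp (c i)

/-- The cycle `c` delimits a face: it is the boundary of some face, traversed in one of the two
directions. -/
def DelimitsFace {n : ℕ} (c : Fin n → H) : Prop :=
  ∃ f : M.Face, (∀ h, M.face h = f ↔ h ∈ Set.range c) ∨
    (∀ h, M.face h = f ↔ M.opp h ∈ Set.range c)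

/-- Two faces are adjacent across an edge that does not belong to `c`. -/
def AdjacentOff {n : ℕ} (c : Fin n → H) (f g : M.Face) : Prop :=
  ∃ h, h ∉ Set.range c ∧ M.opp h ∉ Set.range c ∧ M.face h = f ∧ M.face (M.opp h) = g

/-- A face lies in the interior of the cycle `c` if it cannot be reached from the outer face
without crossing `c`. -/
def InInterior {n : ℕ} (c : Fin n → H) (f : M.Face) : Prop :=
  ¬ Relation.ReflTransGen (M.AdjacentOff c) M.outer f

/-- A dissection of the hexagon by quadrangular faces: the outer face is bounded by a hexagon
(degree 6, with six distinct vertices), and all other faces have degree 4. -/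
structure IsHexagonDissection : Prop where
  outer_degree : M.faceDegree M.outer = 6
  outer_simple : ∀ h k, M.face h = M.outer → M.face k = M.outer → M.origin h = M.origin k → h = k
  inner_degree : ∀ f, f ≠ M.outer → M.faceDegree f = 4

/-- Irreducible: at least 4 faces (counting the outer one), and no separating 4-cycle, that is,
every 4-cycle delimits a face. -/
structure IsIrreducible : Prop where
  four_le_faces : 4 ≤ Nat.card M.Face
  no_separating : ∀ c : Fin 4 → H, M.IsSimpleCycle c → M.DelimitsFace c

/-- The orientation of a half-edge: toward its origin, or out of its origin. -/
inductive Direction : Type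
  | inward
  | outward

/-- An orientation of the inner half-edges. -/
abbrev InnerOrientation : Type _ := M.InnerHalfEdge → Direction

variable {M}

namespace InnerOrientation

/-- The number of half-edges at `v` that are oriented outward. -/
noncomputable def outdegree (X : M.InnerOrientation) (v : M.Vertex) : ℕ :=
  Nat.card {h : M.InnerHalfEdge // M.origin h.1 = v ∧ X h = Direction.outward}

/-- Outer vertices have outdegree 0, inner vertices have outdegree 3, and the two halves of an
inner edge are not both inward. -/
structure IsTriOrientation (X : M.InnerOrientation) : Prop where
  outer_vertex : ∀ v, M.IsOuterVertex v → outdegree X v = 0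
  inner_vertex : ∀ v, ¬ M.IsOuterVertex v → outdegree X v = 3
  not_both_inward : ∀ h, ¬ (X h = Direction.inward ∧ X (M.innerOpp h) = Direction.inward)

/-- Both halves of the edge are oriented outward. -/
def BiOriented (X : M.InnerOrientation) (h : M.InnerHalfEdge) : Prop :=
  X h = Direction.outward ∧ X (M.innerOpp h) = Direction.outward

/-- The edge is simply oriented, in the direction from the origin of `h` to its other end. -/
def SimplyOriented (X : M.InnerOrientation) (h : M.InnerHalfEdge) : Prop :=
  X h = Direction.outward ∧ X (M.innerOpp h) = Direction.inward

/-- A clockwise circuit: a simple cycle, traversed with its interior on the right, whose edges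
are inner edges that are bi-oriented or simply oriented in the direction of traversal. -/
structure IsClockwiseCircuit (X : M.InnerOrientation) {n : ℕ} [NeZero n] (c : Fin n → H) :
    Prop where
  simple : M.IsSimpleCycle c
  interior_right : ∀ i, M.InInterior c (M.face (c i))
  oriented : ∀ i, ∃ hi : M.IsInner (c i), BiOriented X ⟨c i, hi⟩ ∨ SimplyOriented X ⟨c i, hi⟩

/-- The orientation has no clockwise circuit. -/
def NoClockwiseCircuit (X : M.InnerOrientation) : Prop :=
  ∀ (n : ℕ) [NeZero n] (c : Fin n → H), ¬ IsClockwiseCircuit X c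

end InnerOrientation

end PlanarMap

/-!
An orientation is encoded by its set `S` of outward half-edges. In a tri-orientation without
clockwise circuit, the boundary of an inner face is not a clockwise circuit, so some inner half-edge
with this face on its right is inward. By Euler's relation there are as many inward half-edges as
inner faces, hence exactly one for each inner face. Call `S` *balanced* if it has this property and
the prescribed outdegrees.

Balanced sets exist by Hall's theorem, applied to the choice of one inward half-edge for each inner
face. The inequality to be checked is that a set `W` of inner vertices has at least
`3 * #W + #(facesInside W)` half-edges. It comes from irreducibility, by which a cut of at most four
edges encloses at most one face, and from a dimension count for the pairs of functions on vertices
and faces whose differences along and across each edge are opposite.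

For two balanced sets, the difference of the indicator functions sums to zero around every vertex
and along every face. By Euler's relation it is therefore the variation, as one turns around the
vertices, of a function on edges, their *potential*. The edges where a potential is positive and
maximal form a *clockwise edge set*, and pushing a balanced set along a clockwise edge set gives a
balanced set of larger potential. Hence some extremal balanced set has no clockwise edge set, and of
two distinct balanced sets at least one has a clockwise edge set.

A clockwise edge set yields a clockwise circuit, on the boundary of the set of the faces incident to
it. Conversely, take a set of faces without holes whose boundary is directed clockwise, minimal as
such. If an outward half-edge entered it from a vertex of its boundary, the directed paths that
continue this half-edge could never return to the boundary, and by sparsity the vertices on them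
would span enough bi-oriented edges to carry a circulation, whose winding number contradicts
minimality. So the edges inside this set of faces form a clockwise edge set.
-/

section LinearAlgebra

variable {K X Y Z : Type*} [Field K] [AddCommGroup X] [Module K X] [AddCommGroup Y] [Module K Y]
  [AddCommGroup Z] [Module K Z]

theorem finrank_ker_le_one_of_functional (A : X →ₗ[K] Y) (l : X →ₗ[K] K)
    (hl : ∀ x, A x = 0 → l x = 0 → x = 0) : Module.finrank K (LinearMap.ker A) ≤ 1 := by
  have hinj : Function.Injective (l.comp (LinearMap.ker A).subtype) := by
    rw [← LinearMap.ker_eq_bot, LinearMap.ker_eq_bot']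
    rintro ⟨x, hx⟩ h
    exact Subtype.ext (hl x hx h)
  simpa using LinearMap.finrank_le_finrank_of_injective hinj

theorem finrank_le_finrank_range_add_one_of_vector [FiniteDimensional K Z] (B : Y →ₗ[K] Z) (w : Z)
    (hw : ∀ m : Z →ₗ[K] K, (∀ y, m (B y) = 0) → m w = 0 → m = 0) :
    Module.finrank K Z ≤ Module.finrank K (LinearMap.range B) + 1 := by
  have htop : LinearMap.range B ⊔ Submodule.span K {w} = ⊤ := by
    by_contra hne
    obtain ⟨m, hm, hle⟩ := Submodule.exists_le_ker_of_lt_top _ (lt_top_iff_ne_top.mpr hne)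
    exact hm (hw m (fun y => hle (Submodule.mem_sup_left ⟨y, rfl⟩))
      (hle (Submodule.mem_sup_right (Submodule.mem_span_singleton_self w))))
  have hsum := Submodule.finrank_add_le_finrank_add_finrank (LinearMap.range B)
    (Submodule.span K {w})
  rw [htop, finrank_top] at hsum
  have hspan := finrank_span_le_card (R := K) ({w} : Set Z)
  simp only [Set.toFinset_singleton, Finset.card_singleton] at hspan
  omega

theorem exact_of_finrank_le [FiniteDimensional K X] [FiniteDimensional K Y]
    {A : X →ₗ[K] Y} {B : Y →ₗ[K] Z} (hBA : ∀ x, B (A x) = 0) {a b : ℕ}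
    (hA : Module.finrank K (LinearMap.ker A) ≤ a)
    (hB : Module.finrank K Z ≤ Module.finrank K (LinearMap.range B) + b)
    (hdim : Module.finrank K Y + a + b ≤ Module.finrank K X + Module.finrank K Z) :
    Function.Exact A B := by
  have hle : LinearMap.range A ≤ LinearMap.ker B := by
    rintro _ ⟨x, rfl⟩
    exact hBA x
  have hrankA := LinearMap.finrank_range_add_finrank_ker A
  have hrankB := LinearMap.finrank_range_add_finrank_ker B
  exact LinearMap.exact_iff.mpr (Submodule.eq_of_le_of_finrank_le hle (by omega)).symm

open scoped Finset Classical in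
theorem exists_ne_zero_of_card_lt {ι κ K : Type*} [Fintype ι] [Fintype κ] [Field K]
    (F : (ι → K) →ₗ[K] (κ → K)) {E : Set ι} (hcard : Fintype.card κ < #{i | i ∈ E}) :
    ∃ z, (∃ i ∈ E, z i ≠ 0) ∧ (∀ i ∉ E, z i = 0) ∧ F z = 0 := by
  let ext : (E → K) →ₗ[K] (ι → K) := Function.ExtendByZero.linearMap K Subtype.val
  have hker := LinearMap.ker_ne_bot_of_finrank_lt (f := F.comp ext) (by
    rwa [Module.finrank_fintype_fun_eq_card, Module.finrank_fintype_fun_eq_card,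
      Fintype.card_subtype])
  obtain ⟨x, hx, hne⟩ := Submodule.exists_mem_ne_zero_of_ne_bot hker
  obtain ⟨i, hi⟩ := Function.ne_iff.mp hne
  refine ⟨ext x, ⟨i, i.2, ?_⟩, fun j hj => ?_, LinearMap.mem_ker.mp hx⟩
  · exact (Subtype.val_injective.extend_apply x 0 i).trans_ne hi
  · exact Function.extend_apply' (f := Subtype.val) x 0 j fun ⟨e, he⟩ => hj (he ▸ e.2)

end LinearAlgebra

theorem exists_step_of_sameCycle {H : Type*} [Finite H] {σ : Equiv.Perm H} {a b : H}
    (hab : σ.SameCycle a b) {P : H → Prop} (ha : P a) (hb : ¬ P b) :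
    ∃ c, σ.SameCycle a c ∧ P c ∧ ¬ P (σ c) := by
  by_contra! hstep
  obtain ⟨n, rfl⟩ := hab.exists_nat_pow_eq
  suffices ∀ n : ℕ, P ((σ ^ n) a) from hb (this n)
  intro n
  induction n with
  | zero => simpa using ha
  | succ n ih =>
    rw [pow_succ']
    exact hstep _ ⟨n, rfl⟩ ih

theorem exists_mem_periodicPts {α : Type*} [Finite α] [Nonempty α] (σ : α → α) :
    ∃ x, x ∈ Function.periodicPts σ := by
  obtain ⟨x⟩ := ‹Nonempty α›
  obtain ⟨m, l, hml, heq⟩ := Finite.exists_ne_map_eq_of_infinite fun n : ℕ => σ^[n] x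
  wlog hlt : m < l generalizing m l
  · exact this l m hml.symm heq.symm (hml.symm.lt_of_le (not_lt.mp hlt))
  refine ⟨σ^[m] x, l - m, Nat.sub_pos_of_lt hlt, ?_⟩
  rw [Function.IsPeriodicPt, Function.IsFixedPt, ← Function.iterate_add_apply,
    Nat.sub_add_cancel hlt.le, heq]

section FiberSum

open scoped Classical

variable {H V : Type*} [Fintype H]

section AddCommMonoid

variable {A : Type*} [AddCommMonoid A]

/-- The sum of `z` over the fibre of `o` above `v`; for `o` the map from half-edges to vertices
or to faces, this is the sum around a vertex or along the boundary of a face. -/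
noncomputable def fiberSum (o : H → V) (z : H → A) (v : V) : A := ∑ h with o h = v, z h

theorem fiberSum_add (o : H → V) (z z' : H → A) (v : V) :
    fiberSum o (fun h => z h + z' h) v = fiberSum o z v + fiberSum o z' v :=
  Finset.sum_add_distrib

theorem fiberSum_comp_perm (o : H → V) (σ : Equiv.Perm H) (hσ : ∀ h, o (σ h) = o h) (z : H → A)
    (v : V) : fiberSum o (fun h => z (σ h)) v = fiberSum o z v := by
  simp only [fiberSum, Finset.sum_filter]
  rw [← Equiv.sum_comp σ (fun h => if o h = v then z h else 0)]
  simp only [hσ]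

theorem fiberSum_congr {o : H → V} {z z' : H → A} {v : V} (h : ∀ k, o k = v → z k = z' k) :
    fiberSum o z v = fiberSum o z' v :=
  Finset.sum_congr rfl fun k hk => h k (Finset.mem_filter.mp hk).2

theorem sum_fiberSum [Fintype V] (o : H → V) (z : H → A) : ∑ v, fiberSum o z v = ∑ h, z h :=
  Finset.sum_fiberwise _ _ _

end AddCommMonoid

theorem fiberSum_sub {A : Type*} [AddCommGroup A] (o : H → V) (z z' : H → A) (v : V) :
    fiberSum o (fun h => z h - z' h) v = fiberSum o z v - fiberSum o z' v :=
  Finset.sum_sub_distrib _ _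

section Semiring

variable {K : Type*} [Semiring K]

theorem fiberSum_mul_left (o : H → V) (c : K) (z : H → K) (v : V) :
    fiberSum o (fun h => c * z h) v = c * fiberSum o z v :=
  (Finset.mul_sum _ _ _).symm

theorem fiberSum_single (o : H → V) (a : H) (v : V) :
    fiberSum o (fun h => if h = a then (1 : K) else 0) v = if o a = v then 1 else 0 := by
  simp [fiberSum, Finset.sum_ite_eq']

/-- Summation over the fibres of `o`, as a linear map. -/
noncomputable def fiberSumLinear (K : Type*) [Semiring K] (o : H → V) :
    (H → K) →ₗ[K] (V → K) where
  toFun z v := fiberSum o z v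
  map_add' z z' := funext fun v => fiberSum_add o z z' v
  map_smul' c z := funext fun v => fiberSum_mul_left o c z v

end Semiring

end FiberSum

section Hall

open scoped Finset Classical

/-- Hall's theorem with capacities is Hall's theorem for `d v` copies of each `v`. -/
theorem exists_choice_of_card_le_sum {ι V : Type*} [Fintype ι] [Fintype V] (r : ι → V → Prop)
    (d : V → ℕ) (hd : ∀ s : Finset ι, #s ≤ ∑ v with ∃ i ∈ s, r i v, d v) :
    ∃ z : ι → V, (∀ i, r i (z i)) ∧ ∀ v, #{i | z i = v} ≤ d v := by
  let t : ι → Finset (Σ v : V, Fin (d v)) := fun i =>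
    (Finset.univ.filter (r i)).sigma fun _ => Finset.univ
  have hunion : ∀ s : Finset ι, s.biUnion t =
      (Finset.univ.filter fun v => ∃ i ∈ s, r i v).sigma fun _ => Finset.univ := fun s => by
    ext a
    simp [t]
  obtain ⟨e, he, het⟩ := (Finset.all_card_le_biUnion_card_iff_exists_injective t).mp fun s => by
    rw [hunion, Finset.card_sigma]
    simpa using hd s
  refine ⟨fun i => (e i).1, fun i => by simpa [t] using het i, fun v => ?_⟩
  have hle := Finset.card_le_card_of_injOn (s := {i | (e i).1 = v})
    (t := ({v} : Finset V).sigma fun v => (Finset.univ : Finset (Fin (d v)))) e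
    (fun i hi => by simpa using hi) he.injOn
  simpa using hle

end Hall

namespace PlanarMap

open scoped Finset Classical

section Orbits

variable {H : Type*} (M : PlanarMap H)

theorem origin_eq_iff {h k : H} : M.origin h = M.origin k ↔ M.rot.SameCycle h k :=
  Quotient.eq (r := Equiv.Perm.SameCycle.setoid M.rot)

theorem face_eq_iff {h k : H} : M.face h = M.face k ↔ (M.rot * M.opp).SameCycle h k :=
  Quotient.eq (r := Equiv.Perm.SameCycle.setoid (M.rot * M.opp))

theorem origin_rot (h : H) : M.origin (M.rot h) = M.origin h :=
  M.origin_eq_iff.mpr (Equiv.Perm.sameCycle_apply_left.mpr (Equiv.Perm.SameCycle.refl _ _))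

theorem origin_rot_symm (h : H) : M.origin (M.rot.symm h) = M.origin h := by
  rw [← M.origin_rot (M.rot.symm h), Equiv.apply_symm_apply]

theorem face_rot_opp (h : H) : M.face (M.rot (M.opp h)) = M.face h :=
  M.face_eq_iff.mpr (Equiv.Perm.sameCycle_apply_left (f := M.rot * M.opp).mpr
    (Equiv.Perm.SameCycle.refl _ _))

theorem face_rot (h : H) : M.face (M.rot h) = M.face (M.opp h) := by
  rw [← M.face_rot_opp (M.opp h), M.opp_opp]

theorem face_opp_rot_symm (h : H) : M.face (M.opp (M.rot.symm h)) = M.face h := by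
  rw [← M.face_rot, Equiv.apply_symm_apply]

theorem origin_surjective : Function.Surjective M.origin := Quotient.mk_surjective

theorem face_surjective : Function.Surjective M.face := Quotient.mk_surjective

theorem opp_eq_iff {h k : H} : M.opp h = k ↔ h = M.opp k :=
  ⟨fun hh => by rw [← hh, M.opp_opp], fun hh => by rw [hh, M.opp_opp]⟩

theorem nonempty (M : PlanarMap H) : Nonempty H :=
  let ⟨h, _⟩ := M.face_surjective M.outer
  ⟨h⟩

theorem exists_rot_step {a b : H} (hab : M.origin a = M.origin b) {P : H → Prop} (ha : P a)
    (hb : ¬ P b) : ∃ c, M.origin c = M.origin a ∧ P c ∧ ¬ P (M.rot c) := by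
  have := M.finite
  obtain ⟨c, hac, hc⟩ := exists_step_of_sameCycle (M.origin_eq_iff.mp hab) ha hb
  exact ⟨c, (M.origin_eq_iff.mpr hac).symm, hc⟩

theorem exists_face_step {a b : H} (hab : M.face a = M.face b) {P : H → Prop} (ha : P a)
    (hb : ¬ P b) : ∃ c, M.face c = M.face a ∧ P c ∧ ¬ P (M.rot (M.opp c)) := by
  have := M.finite
  obtain ⟨c, hac, hc⟩ := exists_step_of_sameCycle (M.face_eq_iff.mp hab) ha hb
  exact ⟨c, (M.face_eq_iff.mpr hac).symm, hc⟩

theorem const_of_rot_of_opp {α : Type*} (p : H → α) (hrot : ∀ h, p (M.rot h) = p h)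
    (hopp : ∀ h, p (M.opp h) = p h) (h k : H) : p h = p k := by
  induction M.connected h k with
  | refl => rfl
  | tail _ hstep ih =>
    rcases hstep with rfl | rfl
    · rw [ih, hrot]
    · rw [ih, hopp]

theorem vertex_const {α : Type*} (g : M.Vertex → α)
    (hg : ∀ h, g (M.origin (M.opp h)) = g (M.origin h)) (u v : M.Vertex) : g u = g v := by
  obtain ⟨h, rfl⟩ := M.origin_surjective u
  obtain ⟨k, rfl⟩ := M.origin_surjective v
  exact M.const_of_rot_of_opp (fun h => g (M.origin h)) (fun h => by rw [M.origin_rot]) hg h k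

theorem face_const {α : Type*} (g : M.Face → α)
    (hg : ∀ h, g (M.face (M.opp h)) = g (M.face h)) (f f' : M.Face) : g f = g f' := by
  obtain ⟨h, rfl⟩ := M.face_surjective f
  obtain ⟨k, rfl⟩ := M.face_surjective f'
  exact M.const_of_rot_of_opp (fun h => g (M.face h)) (fun h => by rw [M.face_rot, hg]) hg h k

theorem exists_face_mem_face_opp_notMem {R : Set M.Face} {f g : M.Face} (hf : f ∈ R)
    (hg : g ∉ R) : ∃ h, M.face h ∈ R ∧ M.face (M.opp h) ∉ R := by
  by_contra! hclosed
  have hmem := M.face_const (fun f => f ∈ R) (fun h => propext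
    ⟨fun hh => M.opp_opp h ▸ hclosed _ hh, hclosed h⟩) f g
  exact hg (hmem ▸ hf)

/-- The edges of the map, as the orbits of `opp`. -/
abbrev Edge : Type _ := Quotient (Equiv.Perm.SameCycle.setoid M.opp)

/-- The edge to which a half-edge belongs. -/
def edge (h : H) : M.Edge := Quotient.mk _ h

theorem edge_surjective : Function.Surjective M.edge := Quotient.mk_surjective

theorem edge_opp (h : H) : M.edge (M.opp h) = M.edge h :=
  Quotient.sound (Equiv.Perm.sameCycle_apply_left.mpr (Equiv.Perm.SameCycle.refl _ _))

theorem edge_eq_iff {h k : H} : M.edge h = M.edge k ↔ h = k ∨ h = M.opp k := by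
  constructor
  · intro hh
    obtain ⟨n, hn⟩ := (Quotient.eq (r := Equiv.Perm.SameCycle.setoid M.opp)).mp hh.symm
    have hsq : M.opp ^ (2 : ℤ) = 1 := Equiv.ext M.opp_opp
    rcases Int.even_or_odd' n with ⟨m, rfl | rfl⟩
    · rw [zpow_mul, hsq, one_zpow] at hn
      exact Or.inl hn.symm
    · rw [zpow_add, zpow_mul, hsq, one_zpow] at hn
      exact Or.inr hn.symm
  · rintro (rfl | rfl)
    · rfl
    · exact M.edge_opp k

/-- A choice of one half of each edge. -/
def chosen : Set H := {h | (M.edge h).out = h}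

theorem mem_chosen_iff (h : H) : h ∈ M.chosen ↔ M.opp h ∉ M.chosen := by
  simp only [chosen, Set.mem_ofPred_eq, M.edge_opp]
  rcases M.edge_eq_iff.mp (Quotient.out_eq (M.edge h)) with hout | hout <;> rw [hout]
  · simp [(M.opp_ne h).symm]
  · simp [M.opp_ne h]

/-- The dual map: its vertices are the faces of `M` and conversely. The choice of its outer face,
the one of the half-edge `h₀`, is arbitrary. -/
def dual (h₀ : H) : PlanarMap H where
  finite := M.finite
  rot := M.rot * M.opp
  opp := M.opp
  opp_opp := M.opp_opp
  opp_ne := M.opp_ne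
  connected h k := by
    refine (M.connected h k).trans_induction_on (fun _ => .refl) ?_ fun _ _ => .trans
    rintro a b (rfl | rfl)
    · exact .trans (.single (Or.inr rfl)) (.single (Or.inl (by simp [M.opp_opp])))
    · exact .single (Or.inr rfl)
  euler := by
    have hrot : M.rot * M.opp * M.opp = M.rot := Equiv.ext fun h => by simp [M.opp_opp]
    rw [hrot]
    linarith [M.euler]
  outer := Quotient.mk _ h₀

theorem dual_face_eq_iff {h₀ h k : H} :
    (M.dual h₀).face h = (M.dual h₀).face k ↔ M.origin h = M.origin k := by
  have hrot : (M.dual h₀).rot * (M.dual h₀).opp = M.rot := Equiv.ext fun h => by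
    simp [dual, M.opp_opp]
  rw [face_eq_iff, origin_eq_iff, hrot]

end Orbits

section Counting

variable {H : Type*} [Fintype H] (M : PlanarMap H)

theorem card_eq_two_mul_card_inter_chosen {S : Set H} (hS : ∀ h ∈ S, M.opp h ∈ S) :
    #{h | h ∈ S} =
      2 * #{h | h ∈ S ∧ h ∈ M.chosen} := by
  have hsplit := Finset.card_filter_add_card_filter_not (s := Finset.univ.filter (· ∈ S))
    (fun h => h ∈ M.chosen)
  rw [Finset.filter_filter, Finset.filter_filter] at hsplit
  have hswap : #{h | h ∈ S ∧ h ∉ M.chosen} =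
      #{h | h ∈ S ∧ h ∈ M.chosen} := by
    refine Finset.card_bij (fun h _ => M.opp h) ?_ (fun _ _ _ _ h => M.opp.injective h) ?_
    · intro h hh
      simp only [Finset.mem_filter, Finset.mem_univ, true_and] at hh ⊢
      refine ⟨hS _ hh.1, ?_⟩
      rw [M.mem_chosen_iff, M.opp_opp]
      exact hh.2
    · intro h hh
      simp only [Finset.mem_filter, Finset.mem_univ, true_and] at hh ⊢
      exact ⟨M.opp h, ⟨hS _ hh.1, (M.mem_chosen_iff h).mp hh.2⟩, M.opp_opp h⟩
  omega

theorem card_eq_two_mul_card_edge : Fintype.card H = 2 * Fintype.card M.Edge := by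
  have hhalf := M.card_eq_two_mul_card_inter_chosen (S := Set.univ) (fun _ _ => trivial)
  simp only [Set.mem_univ, Finset.filter_true, Finset.card_univ, true_and] at hhalf
  rw [hhalf]
  congr 1
  refine Finset.card_bij (fun h _ => M.edge h) (fun _ _ => Finset.mem_univ _) ?_ ?_
  · intro h hh k hk hhk
    have hh' : (M.edge h).out = h := (Finset.mem_filter.mp hh).2
    have hk' : (M.edge k).out = k := (Finset.mem_filter.mp hk).2
    rw [← hh', ← hk']
    exact congrArg Quotient.out hhk
  · intro ε _
    exact ⟨ε.out, Finset.mem_filter.mpr ⟨Finset.mem_univ _,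
      congrArg Quotient.out (Quotient.out_eq ε)⟩, Quotient.out_eq _⟩

theorem card_vertex_add_card_face :
    Fintype.card M.Vertex + Fintype.card M.Face = Fintype.card M.Edge + 2 := by
  have heuler := M.euler
  simp only [Nat.card_eq_fintype_card] at heuler
  have : (Fintype.card M.Vertex : ℤ) - Fintype.card M.Edge + Fintype.card M.Face = 2 := heuler
  omega

theorem faceDegree_eq_card (f : M.Face) :
    M.faceDegree f = #{h | M.face h = f} := by
  rw [faceDegree, Nat.card_eq_fintype_card, Fintype.card_subtype]

theorem fiberSum_origin_face_opp {A : Type*} [AddCommMonoid A] (g : M.Face → A) (v : M.Vertex) :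
    fiberSum M.origin (fun h => g (M.face (M.opp h))) v =
      fiberSum M.origin (fun h => g (M.face h)) v := by
  rw [← fiberSum_comp_perm M.origin M.rot M.origin_rot (fun h => g (M.face h))]
  simp only [M.face_rot]

theorem fiberSum_face_rot_symm {A : Type*} [AddCommMonoid A] {p : H → A}
    (hp : ∀ h, p (M.opp h) = p h) (f : M.Face) :
    fiberSum M.face (fun h => p (M.rot.symm h)) f = fiberSum M.face p f := by
  rw [← fiberSum_comp_perm M.face (M.rot * M.opp) M.face_rot_opp]
  simp only [Equiv.Perm.mul_apply, Equiv.symm_apply_apply, hp]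

end Counting

section FacePotential

variable {H : Type*} [Fintype H] (M : PlanarMap H) {K : Type*} [Field K]

variable (K) in
/-- The boundary of a chain: a chain `z` gives the weight `z h - z (opp h)` to the half-edge `h`,
and its boundary is the total weight leaving each vertex. -/
noncomputable def boundary : (H → K) →ₗ[K] (M.Vertex → K) :=
  (fiberSumLinear K M.origin).comp (LinearMap.id - LinearMap.funLeft K K M.opp)

theorem boundary_apply (z : H → K) (v : M.Vertex) :
    M.boundary K z v = fiberSum M.origin (fun h => z h - z (M.opp h)) v := rfl

variable (K) in
/-- The boundary of a combination of faces, together with a chain that is symmetric under `opp`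
and hence carries no weight. -/
def faceEdgeChain : ((M.Face → K) × (M.Edge → K)) →ₗ[K] (H → K) :=
  (LinearMap.funLeft K K M.face).coprod (LinearMap.funLeft K K M.edge)

omit [Fintype H] in
theorem faceEdgeChain_apply (x : (M.Face → K) × (M.Edge → K)) (h : H) :
    M.faceEdgeChain K x h = x.1 (M.face h) + x.2 (M.edge h) := rfl

theorem boundary_faceEdgeChain (x : (M.Face → K) × (M.Edge → K)) :
    M.boundary K (M.faceEdgeChain K x) = 0 := by
  funext v
  simp only [boundary_apply, faceEdgeChain_apply, edge_opp, add_sub_add_right_eq_sub]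
  rw [fiberSum_sub, M.fiberSum_origin_face_opp, sub_self, Pi.zero_apply]

omit [Fintype H] in
theorem eq_zero_of_faceEdgeChain_eq_zero {x : (M.Face → K) × (M.Edge → K)}
    (hx : M.faceEdgeChain K x = 0) {f : M.Face} (hf : x.1 f = 0) : x = 0 := by
  have hx' : ∀ h, x.1 (M.face h) + x.2 (M.edge h) = 0 := congrFun hx
  have hface : ∀ f, x.1 f = 0 := fun f' => (M.face_const x.1 (fun h => by
    have hopp := hx' (M.opp h)
    rw [M.edge_opp] at hopp
    exact add_right_cancel (hopp.trans (hx' h).symm)) f' f).trans hf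
  refine Prod.ext (funext hface) (funext fun ε => ?_)
  obtain ⟨h, rfl⟩ := M.edge_surjective ε
  simpa [hface] using hx' h

theorem boundary_single (h : H) : M.boundary K (Pi.single h 1) =
    Pi.single (M.origin h) 1 - Pi.single (M.origin (M.opp h)) 1 := by
  funext v
  simp only [boundary_apply, Pi.single_apply, M.opp_eq_iff]
  rw [fiberSum_sub, fiberSum_single, fiberSum_single]
  simp only [Pi.sub_apply, Pi.single_apply, eq_comm]

theorem eq_zero_of_comp_boundary_eq_zero {m : (M.Vertex → K) →ₗ[K] K}
    (hm : ∀ z, m (M.boundary K z) = 0) {v : M.Vertex} (hv : m (Pi.single v 1) = 0) : m = 0 := by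
  have hopp : ∀ h, m (Pi.single (M.origin (M.opp h)) 1) = m (Pi.single (M.origin h) 1) := by
    intro h
    have hh := hm (Pi.single h 1)
    rw [boundary_single, map_sub, sub_eq_zero] at hh
    exact hh.symm
  refine LinearMap.pi_ext' fun u => LinearMap.ext_ring ?_
  simpa [hv] using M.vertex_const (fun u => m (Pi.single u 1)) hopp u v

/-- The first homology of the sphere vanishes: Euler's relation is exactly what the dimension
count needs. -/
theorem exact_faceEdgeChain_boundary :
    Function.Exact (M.faceEdgeChain K) (M.boundary K) := by
  obtain ⟨h₀⟩ := M.nonempty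
  refine exact_of_finrank_le M.boundary_faceEdgeChain
    (finrank_ker_le_one_of_functional _ ((LinearMap.proj (M.face h₀)).comp (LinearMap.fst K _ _))
      fun x hx hl => M.eq_zero_of_faceEdgeChain_eq_zero hx hl)
    (finrank_le_finrank_range_add_one_of_vector _ (Pi.single (M.origin h₀) 1)
      fun m hm hm₀ => M.eq_zero_of_comp_boundary_eq_zero hm hm₀) ?_
  have heuler := M.card_vertex_add_card_face
  have hedge := M.card_eq_two_mul_card_edge
  simp only [Module.finrank_prod, Module.finrank_fintype_fun_eq_card]
  omega

theorem exists_potential_of_boundary_eq_zero {z : H → K} (hz : M.boundary K z = 0) :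
    ∃ g : M.Face → K, g M.outer = 0 ∧
      ∀ h, z h - z (M.opp h) = g (M.face h) - g (M.face (M.opp h)) := by
  obtain ⟨x, rfl⟩ := (M.exact_faceEdgeChain_boundary z).mp hz
  refine ⟨fun f => x.1 f - x.1 M.outer, sub_self _, fun h => ?_⟩
  rw [faceEdgeChain_apply, faceEdgeChain_apply, M.edge_opp]
  ring

end FacePotential

section Coloring

variable {H : Type*} (M : PlanarMap H)

/-- The chain of the chosen half-edges has odd weight on every half-edge, so modulo `2` it is a
cycle of the dual map; a potential of this cycle is a proper colouring. -/
theorem exists_coloring (heven : ∀ f, Even (M.faceDegree f)) :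
    ∃ c : M.Vertex → ZMod 2, ∀ h, c (M.origin h) ≠ c (M.origin (M.opp h)) := by
  have := M.finite
  let _ : Fintype H := Fintype.ofFinite H
  obtain ⟨h₀⟩ := M.nonempty
  let z : H → ZMod 2 := fun h => if h ∈ M.chosen then 1 else 0
  have hz : ∀ h, z h - z (M.opp h) = 1 := fun h => by
    by_cases hh : M.opp h ∈ M.chosen <;> simp [z, M.mem_chosen_iff h, hh]
  have hsum : ∀ f, fiberSum M.face (fun h => z h - z (M.opp h)) f = 0 := fun f => by
    rw [← (ZMod.natCast_eq_zero_iff_even).mpr (heven f), faceDegree_eq_card]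
    simp only [hz, fiberSum, Finset.sum_const, nsmul_one]
    congr!
  obtain ⟨g, -, hg⟩ := (M.dual h₀).exists_potential_of_boundary_eq_zero (funext hsum)
  have hout : ∀ h, (M.dual h₀).face (M.origin h).out = (M.dual h₀).face h := fun h =>
    M.dual_face_eq_iff.mpr (Quotient.out_eq (M.origin h))
  refine ⟨fun v => g ((M.dual h₀).face v.out), fun h heq => one_ne_zero (α := ZMod 2) ?_⟩
  dsimp only at heq
  rw [hout, hout] at heq
  rw [← hz h, ← sub_eq_zero.mpr heq]
  exact hg h

end Coloring

section EdgePotential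

variable {H : Type*} [Fintype H] (M : PlanarMap H) {K : Type*} [Field K]

variable (K) in
/-- The differences of a function on edges between neighbouring half-edges of a vertex. -/
noncomputable def edgeDifference : (M.Edge → K) →ₗ[K] (H → K) :=
  LinearMap.funLeft K K M.edge - LinearMap.funLeft K K fun h => M.edge (M.rot.symm h)

omit [Fintype H] in
theorem edgeDifference_apply (x : M.Edge → K) (h : H) :
    M.edgeDifference K x h = x (M.edge h) - x (M.edge (M.rot.symm h)) := rfl

variable (K) in
/-- The sums of a function on half-edges around the vertices and along the faces. -/
noncomputable def vertexFaceSums : (H → K) →ₗ[K] ((M.Vertex → K) × (M.Face → K)) :=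
  (fiberSumLinear K M.origin).prod (fiberSumLinear K M.face)

theorem vertexFaceSums_apply (y : H → K) :
    M.vertexFaceSums K y = (fiberSum M.origin y, fiberSum M.face y) := rfl

theorem vertexFaceSums_edgeDifference (x : M.Edge → K) :
    M.vertexFaceSums K (M.edgeDifference K x) = 0 := by
  refine Prod.ext (funext fun v => ?_) (funext fun f => ?_)
  · change fiberSum M.origin (fun h => x (M.edge h) - x (M.edge (M.rot.symm h))) v = 0
    rw [fiberSum_sub, fiberSum_comp_perm M.origin M.rot.symm M.origin_rot_symm
      (fun h => x (M.edge h)), sub_self]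
  · change fiberSum M.face (fun h => x (M.edge h) - x (M.edge (M.rot.symm h))) f = 0
    rw [fiberSum_sub, M.fiberSum_face_rot_symm (p := fun h => x (M.edge h))
      (fun h => by rw [M.edge_opp]), sub_self]

omit [Fintype H] in
theorem eq_zero_of_edgeDifference_eq_zero {x : M.Edge → K} (hx : M.edgeDifference K x = 0)
    {ε : M.Edge} (hε : x ε = 0) : x = 0 := by
  have hrot : ∀ h, x (M.edge (M.rot h)) = x (M.edge h) := fun h => by
    have hh := congrFun hx (M.rot h)
    rw [edgeDifference_apply, Equiv.symm_apply_apply] at hh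
    exact sub_eq_zero.mp hh
  obtain ⟨k, rfl⟩ := M.edge_surjective ε
  funext ε'
  obtain ⟨h, rfl⟩ := M.edge_surjective ε'
  exact (M.const_of_rot_of_opp (fun h => x (M.edge h)) hrot (fun h => by rw [M.edge_opp])
    h k).trans hε

theorem vertexFaceSums_single (h : H) :
    M.vertexFaceSums K (fun k => if k = h then 1 else 0) =
      (Pi.single (M.origin h) 1, 0) + (0, Pi.single (M.face h) 1) := by
  refine Prod.ext (funext fun v => ?_) (funext fun f => ?_)
  · rw [vertexFaceSums_apply]
    dsimp only
    rw [fiberSum_single]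
    simp [Pi.single_apply, eq_comm]
  · rw [vertexFaceSums_apply]
    dsimp only
    rw [fiberSum_single]
    simp [Pi.single_apply, eq_comm]

theorem eq_zero_of_comp_vertexFaceSums_eq_zero {m : ((M.Vertex → K) × (M.Face → K)) →ₗ[K] K}
    (hm : ∀ y, m (M.vertexFaceSums K y) = 0) {v : M.Vertex} (hv : m (Pi.single v 1, 0) = 0) :
    m = 0 := by
  have hsum : ∀ h, m (Pi.single (M.origin h) 1, 0) = -m (0, Pi.single (M.face h) 1) := fun h => by
    rw [← add_eq_zero_iff_eq_neg, ← map_add, ← vertexFaceSums_single, hm]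
  have hvertex : ∀ u, m (Pi.single u 1, 0) = 0 := fun u =>
    (M.vertex_const (fun u => m (Pi.single u 1, 0))
      (fun h => by rw [← M.origin_rot, hsum, hsum, M.face_rot_opp]) u v).trans hv
  have hface : ∀ f, m (0, Pi.single f 1) = 0 := fun f => by
    obtain ⟨h, rfl⟩ := M.face_surjective f
    rw [← neg_eq_zero, ← hsum, hvertex]
  exact LinearMap.prod_ext
    (LinearMap.pi_ext' fun u => LinearMap.ext_ring (by simpa using hvertex u))
    (LinearMap.pi_ext' fun f => LinearMap.ext_ring (by simpa using hface f))

theorem exact_edgeDifference_vertexFaceSums :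
    Function.Exact (M.edgeDifference K) (M.vertexFaceSums K) := by
  obtain ⟨h₀⟩ := M.nonempty
  refine exact_of_finrank_le M.vertexFaceSums_edgeDifference
    (finrank_ker_le_one_of_functional _ (LinearMap.proj (M.edge h₀))
      fun x hx hl => M.eq_zero_of_edgeDifference_eq_zero hx hl)
    (finrank_le_finrank_range_add_one_of_vector _ (Pi.single (M.origin h₀) 1, 0)
      fun m hm hm₀ => M.eq_zero_of_comp_vertexFaceSums_eq_zero hm hm₀) ?_
  have heuler := M.card_vertex_add_card_face
  have hedge := M.card_eq_two_mul_card_edge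
  simp only [Module.finrank_prod, Module.finrank_fintype_fun_eq_card]
  omega

theorem exists_potential_of_sums_eq_zero {y : H → K} (hvertex : ∀ v, fiberSum M.origin y v = 0)
    (hface : ∀ f, fiberSum M.face y f = 0) :
    ∃ p : H → K, (∀ h, p (M.opp h) = p h) ∧ ∀ h, y h = p h - p (M.rot.symm h) := by
  obtain ⟨x, rfl⟩ := (M.exact_edgeDifference_vertexFaceSums y).mp
    (Prod.ext (funext hvertex) (funext hface))
  exact ⟨fun h => x (M.edge h), fun h => congrArg x (M.edge_opp h), M.edgeDifference_apply x⟩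

end EdgePotential

section Cuts

variable {H : Type*} [Fintype H] {M : PlanarMap H}

variable (M) in
/-- The half-edges that have a face of `R` on their right and a face outside `R` on their left. -/
noncomputable def cut (R : Set M.Face) : Finset H := {h | M.face h ∈ R ∧ M.face (M.opp h) ∉ R}

theorem mem_cut {R : Set M.Face} {h : H} :
    h ∈ M.cut R ↔ M.face h ∈ R ∧ M.face (M.opp h) ∉ R := by simp [cut]

theorem opp_notMem_cut {R : Set M.Face} {h : H} (hh : h ∈ M.cut R) : M.opp h ∉ M.cut R :=
  fun hopp => (mem_cut.mp hh).2 (mem_cut.mp hopp).1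

theorem exists_mem_cut_of_origin_eq {R : Set M.Face} {a b : H} (hab : M.origin a = M.origin b)
    (ha : M.face a ∈ R) (hb : M.face b ∉ R) : ∃ k ∈ M.cut R, M.origin k = M.origin a := by
  obtain ⟨k, hka, hkR, hk⟩ := M.exists_rot_step hab (P := fun h => M.face h ∈ R) ha hb
  rw [M.face_rot] at hk
  exact ⟨k, mem_cut.mpr ⟨hkR, hk⟩, hka⟩

theorem exists_cut_succ {R : Set M.Face} {h : H} (hh : h ∈ M.cut R) :
    ∃ k ∈ M.cut R, M.origin k = M.origin (M.opp h) := by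
  have hrot : M.origin (M.rot (M.opp h)) = M.origin (M.opp h) := M.origin_rot _
  obtain ⟨k, hk, hkh⟩ := exists_mem_cut_of_origin_eq (R := R) hrot
    (by rw [M.face_rot_opp]; exact (mem_cut.mp hh).1) (mem_cut.mp hh).2
  exact ⟨k, hk, hkh.trans hrot⟩

theorem cut_nonempty {R : Set M.Face} (hne : R.Nonempty) (hout : M.outer ∉ R) :
    (M.cut R).Nonempty := by
  obtain ⟨f, hf⟩ := hne
  obtain ⟨h, hh⟩ := M.exists_face_mem_face_opp_notMem hf hout
  exact ⟨h, mem_cut.mpr hh⟩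

theorem card_cut_union_add_card_cut_inter_le (R P : Set M.Face) :
    #(M.cut (R ∪ P)) + #(M.cut (R ∩ P)) ≤ #(M.cut R) + #(M.cut P) := by
  simp only [cut, Finset.card_filter, ← Finset.sum_add_distrib]
  refine Finset.sum_le_sum fun h _ => ?_
  by_cases hR : M.face h ∈ R <;> by_cases hP : M.face h ∈ P <;>
    by_cases hR' : M.face (M.opp h) ∈ R <;> by_cases hP' : M.face (M.opp h) ∈ P <;>
    simp [hR, hP, hR', hP']

end Cuts

/-- The rational indicator function of a set of faces or of half-edges. -/
noncomputable def ind {α : Type*} (R : Set α) (x : α) : ℚ := if x ∈ R then 1 else 0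

theorem ind_of_mem {α : Type*} {R : Set α} {x : α} (hx : x ∈ R) : ind R x = 1 := if_pos hx

theorem ind_of_notMem {α : Type*} {R : Set α} {x : α} (hx : x ∉ R) : ind R x = 0 := if_neg hx

theorem ind_nonneg {α : Type*} (R : Set α) (x : α) : 0 ≤ ind R x := by
  unfold ind
  split_ifs <;> norm_num

theorem ind_le_one {α : Type*} (R : Set α) (x : α) : ind R x ≤ 1 := by
  unfold ind
  split_ifs <;> norm_num

theorem ind_injective {α : Type*} : Function.Injective (ind : Set α → α → ℚ) := fun R R' hRR' =>
  Set.ext fun x => by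
    have hx := congrFun hRR' x
    by_cases hxR : x ∈ R <;> by_cases hxR' : x ∈ R' <;> simp [ind, hxR, hxR'] at hx ⊢

/-- The number of times that a finite sequence of half-edges goes through a given one. -/
noncomputable def passes {H : Type*} {n : ℕ} (c : Fin n → H) (h : H) : ℚ :=
  ∑ i, ind {c i} h

section Passes

variable {H : Type*} {n : ℕ} {c : Fin n → H}

theorem passes_eq_zero {h : H} (hh : h ∉ Set.range c) : passes c h = 0 :=
  Finset.sum_eq_zero fun i _ => ind_of_notMem fun hi => hh ⟨i, (Set.mem_singleton_iff.mp hi).symm⟩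

theorem passes_of_injective (hc : Function.Injective c) (h : H) :
    passes c h = ind (Set.range c) h := by
  by_cases hh : h ∈ Set.range c
  · rw [ind_of_mem hh]
    obtain ⟨i, rfl⟩ := hh
    simp [passes, ind, hc.eq_iff]
  · rw [ind_of_notMem hh, passes_eq_zero hh]

end Passes

section WindingNumber

variable {H : Type*} {M : PlanarMap H} {n : ℕ} {c : Fin n → H} {φ : M.Face → ℚ}

variable (M) in
/-- `φ f` is the number of times that the closed walk `c` winds clockwise around the face `f`. -/
structure IsWindingNumber (c : Fin n → H) (φ : M.Face → ℚ) : Prop where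
  outer : φ M.outer = 0
  gradient : ∀ h, φ (M.face h) - φ (M.face (M.opp h)) = passes c h - passes c (M.opp h)

variable (M) in
theorem ind_singleton_opp (a h : H) : ind {M.opp a} h = ind {a} (M.opp h) := by
  simp only [ind, Set.mem_singleton_iff, M.opp_eq_iff]

theorem boundary_passes_eq_zero [Fintype H] [NeZero n]
    (hc : ∀ i, M.origin (M.opp (c i)) = M.origin (c (i + 1))) : M.boundary ℚ (passes c) = 0 := by
  have hpasses : passes c = ∑ i, Pi.single (c i) 1 := by
    funext h
    simp [passes, ind, Pi.single_apply, Finset.sum_apply]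
  simp only [hpasses, map_sum, boundary_single, Finset.sum_sub_distrib, hc, sub_eq_zero]
  exact (Equiv.sum_comp (Equiv.addRight (1 : Fin n)) _).symm

theorem exists_isWindingNumber [NeZero n]
    (hc : ∀ i, M.origin (M.opp (c i)) = M.origin (c (i + 1))) :
    ∃ φ, M.IsWindingNumber c φ := by
  have := M.finite
  let _ : Fintype H := Fintype.ofFinite H
  obtain ⟨φ, houter, hφ⟩ := M.exists_potential_of_boundary_eq_zero (boundary_passes_eq_zero hc)
  exact ⟨φ, houter, fun h => (hφ h).symm⟩

theorem IsWindingNumber.unique {ψ : M.Face → ℚ} (hφ : M.IsWindingNumber c φ)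
    (hψ : M.IsWindingNumber c ψ) : φ = ψ := by
  funext f
  have hconst := M.face_const (fun f => φ f - ψ f)
    (fun h => by linarith [hφ.gradient h, hψ.gradient h]) f M.outer
  simp only [hφ.outer, hψ.outer, sub_self] at hconst
  exact sub_eq_zero.mp hconst

theorem IsWindingNumber.eq_of_notMem_range (hφ : M.IsWindingNumber c φ) {h : H}
    (hh : h ∉ Set.range c) (hopp : M.opp h ∉ Set.range c) :
    φ (M.face h) = φ (M.face (M.opp h)) := by
  have hgrad := hφ.gradient h
  rwa [passes_eq_zero hh, passes_eq_zero hopp, sub_zero, sub_eq_zero] at hgrad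

theorem IsWindingNumber.card_cut_le [Fintype H] (hφ : M.IsWindingNumber c φ) (q : ℚ) :
    #(M.cut {f | φ f = q}) ≤ n := by
  have hinj : Set.InjOn M.edge (M.cut {f | φ f = q}) := by
    intro h hh k hk hhk
    refine (M.edge_eq_iff.mp hhk).resolve_right ?_
    rintro rfl
    exact opp_notMem_cut hk hh
  rw [← Finset.card_image_of_injOn hinj]
  calc #((M.cut {f | φ f = q}).image M.edge)
    _ ≤ #(Finset.univ.image fun i => M.edge (c i)) := by
        refine Finset.card_le_card (Finset.image_subset_iff.mpr fun h hh => ?_)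
        rw [Finset.mem_image]
        by_contra! hc
        have heq := hφ.eq_of_notMem_range (h := h)
          (fun ⟨i, hi⟩ => hc i (Finset.mem_univ _) (congrArg M.edge hi))
          (fun ⟨i, hi⟩ => hc i (Finset.mem_univ _) (by rw [hi, M.edge_opp]))
        obtain ⟨hin, hnotin⟩ := mem_cut.mp hh
        exact hnotin (heq.symm.trans hin)
    _ ≤ n := Finset.card_image_le.trans (by simp)

theorem isWindingNumber_ind_of_cut [Fintype H] {R : Set M.Face} (hout : M.outer ∉ R)
    (hc : Function.Injective c) (hR : ∀ h, h ∈ M.cut R ↔ h ∈ Set.range c) :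
    M.IsWindingNumber c (ind R) where
  outer := ind_of_notMem hout
  gradient h := by
    rw [passes_of_injective hc, passes_of_injective hc]
    simp only [ind, ← hR, mem_cut, M.opp_opp]
    by_cases hh : M.face h ∈ R <;> by_cases hh' : M.face (M.opp h) ∈ R <;> simp [hh, hh']

theorem ind_singleton_face_eq_passes {f : M.Face} {σ : H → H} (hc : Function.Injective c)
    (hface : ∀ h, M.face h = f ↔ σ h ∈ Set.range c) (h : H) :
    ind {f} (M.face h) = passes c (σ h) := by
  rw [passes_of_injective hc]
  simp only [ind, Set.mem_singleton_iff, hface]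
  congr!

theorem isWindingNumber_ind_singleton {f : M.Face} (hf : f ≠ M.outer) (hc : Function.Injective c)
    (hface : ∀ h, M.face h = f ↔ h ∈ Set.range c) : M.IsWindingNumber c (ind {f}) where
  outer := ind_of_notMem hf.symm
  gradient h := by simp only [ind_singleton_face_eq_passes (σ := id) hc hface, id]

theorem isWindingNumber_neg_ind_singleton {f : M.Face} (hf : f ≠ M.outer)
    (hc : Function.Injective c) (hface : ∀ h, M.face h = f ↔ M.opp h ∈ Set.range c) :
    M.IsWindingNumber c (-ind {f}) where
  outer := neg_eq_zero.mpr (ind_of_notMem hf.symm)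
  gradient h := by
    simp only [Pi.neg_apply, ind_singleton_face_eq_passes hc hface, M.opp_opp]
    exact neg_sub_neg _ _

end WindingNumber

section Faces

variable {H : Type*} {M : PlanarMap H}

variable (M) in
theorem minimalPeriod_eq_faceDegree (h : H) :
    Function.minimalPeriod (M.rot * M.opp) h = M.faceDegree (M.face h) := by
  have horbit : ∀ k, M.face k = M.face h ↔
      k ∈ MulAction.orbit (Subgroup.zpowers (M.rot * M.opp)) h := fun k => by
    rw [eq_comm, face_eq_iff]
    exact ⟨fun ⟨i, hi⟩ => ⟨⟨_, i, rfl⟩, hi⟩, fun ⟨⟨_, i, rfl⟩, hk⟩ => ⟨i, hk⟩⟩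
  rw [faceDegree, Nat.card_congr ((Equiv.subtypeEquivRight horbit).trans
    (MulAction.orbitZPowersEquiv (M.rot * M.opp) h)), Nat.card_zmod]
  rfl

theorem exists_enum_of_faceDegree {n : ℕ} [NeZero n] {h : H} (hn : M.faceDegree (M.face h) = n) :
    ∃ c : Fin n → H, c 0 = h ∧ Function.Injective c ∧ (∀ i, c (i + 1) = M.rot (M.opp (c i))) ∧
      ∀ k, M.face k = M.face h ↔ k ∈ Set.range c := by
  have hperiod : Function.minimalPeriod (M.rot * M.opp) h = n :=
    (M.minimalPeriod_eq_faceDegree h).trans hn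
  have hmod : ∀ m, (M.rot * M.opp)^[m % n] h = (M.rot * M.opp)^[m] h := fun m => by
    rw [← hperiod, Function.iterate_mod_minimalPeriod_eq]
  refine ⟨fun i => (M.rot * M.opp)^[i] h, rfl, fun i j hij => Fin.ext ?_, fun i => ?_, fun k => ?_⟩
  · exact Function.iterate_injOn_Iio_minimalPeriod (i.isLt.trans_eq hperiod.symm)
      (j.isLt.trans_eq hperiod.symm) hij
  · dsimp only
    rw [Fin.val_add, Fin.val_one', Nat.add_mod_mod, hmod, Function.iterate_succ_apply']
    rfl
  · constructor
    · intro hk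
      have := M.finite
      obtain ⟨m, rfl⟩ := (M.face_eq_iff.mp hk.symm).exists_nat_pow_eq
      exact ⟨⟨m % n, Nat.mod_lt _ (NeZero.pos n)⟩, (hmod m).trans (by rw [Equiv.Perm.coe_pow])⟩
    · rintro ⟨i, rfl⟩
      rw [eq_comm, face_eq_iff]
      exact ⟨i, by rw [zpow_natCast, Equiv.Perm.coe_pow]⟩

end Faces

section ShortCycles

variable {H : Type*} {M : PlanarMap H}

theorem IsSimpleCycle.injective {n : ℕ} [NeZero n] {c : Fin n → H} (hc : M.IsSimpleCycle c) :
    Function.Injective c := fun _ _ hij => hc.vertices_distinct (congrArg M.origin hij)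

theorem IsHexagonDissection.even_faceDegree (hD : M.IsHexagonDissection) (f : M.Face) :
    Even (M.faceDegree f) := by
  by_cases hf : f = M.outer
  · rw [hf, hD.outer_degree]
    decide
  · rw [hD.inner_degree f hf]
    decide

theorem IsHexagonDissection.origin_opp_ne (hD : M.IsHexagonDissection) (h : H) :
    M.origin (M.opp h) ≠ M.origin h := by
  obtain ⟨c, hc⟩ := M.exists_coloring hD.even_faceDegree
  exact fun hh => hc h (by rw [hh])

theorem IsHexagonDissection.origin_ne_of_three_steps (hD : M.IsHexagonDissection) {h k l : H}
    (hk : M.origin k = M.origin (M.opp h)) (hl : M.origin l = M.origin (M.opp k)) :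
    M.origin (M.opp l) ≠ M.origin h := by
  obtain ⟨c, hc⟩ := M.exists_coloring hD.even_faceDegree
  intro heq
  have hch := hc h
  have hck := hc k
  have hcl := hc l
  rw [hk] at hck
  rw [heq, hl] at hcl
  generalize c (M.origin h) = x, c (M.origin (M.opp h)) = y, c (M.origin (M.opp k)) = z at *
  revert x y z
  decide

theorem isSimpleCycle_of_four (hD : M.IsHexagonDissection) {a b c d : H}
    (hab : M.origin (M.opp a) = M.origin b) (hbc : M.origin (M.opp b) = M.origin c)
    (hcd : M.origin (M.opp c) = M.origin d) (hda : M.origin (M.opp d) = M.origin a)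
    (hac : M.origin a ≠ M.origin c) (hbd : M.origin b ≠ M.origin d) :
    M.IsSimpleCycle ![a, b, c, d] := by
  have nab : M.origin a ≠ M.origin b := hab ▸ (hD.origin_opp_ne a).symm
  have nbc : M.origin b ≠ M.origin c := hbc ▸ (hD.origin_opp_ne b).symm
  have ncd : M.origin c ≠ M.origin d := hcd ▸ (hD.origin_opp_ne c).symm
  have nda : M.origin d ≠ M.origin a := hda ▸ (hD.origin_opp_ne d).symm
  have chain : ∀ i, M.origin (M.opp (![a, b, c, d] i)) = M.origin (![a, b, c, d] (i + 1)) := by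
    intro i
    fin_cases i
    exacts [hab, hbc, hcd, hda]
  have inj : Function.Injective fun i => M.origin (![a, b, c, d] i) := by
    intro i j hij
    fin_cases i <;> fin_cases j <;>
      simp [nab, nbc, ncd, nda, hac, hbd, nab.symm, nbc.symm, ncd.symm, nda.symm, hac.symm,
        hbd.symm] at hij ⊢
  refine ⟨chain, inj, fun i j hij => ?_⟩
  have hji : j = i + 1 := inj (by dsimp only; rw [hij, chain])
  have hij' : i = j + 1 := inj (by dsimp only; rw [← chain, hij, M.opp_opp])
  rw [hji] at hij'
  clear hij hji
  revert i
  decide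

theorem passes_four (a b c d : H) : passes ![a, b, c, d] = passes ![a, b] + passes ![c, d] := by
  funext h
  simp only [passes, Pi.add_apply, Fin.sum_univ_four, Fin.sum_univ_two]
  exact add_assoc _ _ _

theorem IsWindingNumber.ind_insert {R : Set M.Face} {f : M.Face} (hf : f ∉ R) {a b c d e : H}
    (hR : M.IsWindingNumber ![a, b] (ind R))
    (hface : M.IsWindingNumber ![M.opp a, c, d, e] (ind {f})) :
    M.IsWindingNumber ![b, c, d, e] (ind (insert f R)) := by
  have hind : ∀ g, ind (insert f R) g = ind R g + ind {f} g := fun g => by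
    by_cases hg : g = f
    · simp [ind, hg, hf]
    · simp [ind, hg]
  refine ⟨by rw [hind, hR.outer, hface.outer, add_zero], fun h => ?_⟩
  have hRh := hR.gradient h
  have hfh := hface.gradient h
  simp only [passes, Fin.sum_univ_four, Fin.sum_univ_two, Matrix.cons_val_zero,
    Matrix.cons_val_one, Matrix.cons_val, M.ind_singleton_opp, M.opp_opp] at hRh hfh ⊢
  rw [hind, hind]
  linarith

theorem IsWindingNumber.rotate_four {a b c d : H} {φ : M.Face → ℚ}
    (hφ : M.IsWindingNumber ![a, b, c, d] φ) : M.IsWindingNumber ![b, c, d, a] φ := by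
  have hpasses : passes ![b, c, d, a] = passes ![a, b, c, d] := by
    funext h
    simp only [passes, Fin.sum_univ_four, Matrix.cons_val]
    abel
  exact ⟨hφ.outer, hpasses ▸ hφ.gradient⟩

theorem IsIrreducible.exists_isWindingNumber_smul_ind (hI : M.IsIrreducible)
    (hD : M.IsHexagonDissection) {c : Fin 4 → H} (hc : M.IsSimpleCycle c) :
    ∃ (f : M.Face) (s : ℚ), M.IsWindingNumber c (s • ind {f}) := by
  have := M.finite
  let _ : Fintype H := Fintype.ofFinite H
  have hinner : ∀ f, ∀ σ : Equiv.Perm H, (∀ h, M.face h = f ↔ σ h ∈ Set.range c) →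
      f ≠ M.outer := by
    rintro f σ hf rfl
    have hle : #{h | M.face h = M.outer} ≤
        #(Finset.univ.image c) :=
      Finset.card_le_card_of_injOn σ (fun h hh => by simpa [hf] using hh) σ.injective.injOn
    have hdegree := hD.outer_degree
    rw [faceDegree_eq_card] at hdegree
    have hfour : #(Finset.univ.image c) ≤ 4 := Finset.card_image_le.trans (by simp)
    omega
  obtain ⟨f, hf | hf⟩ := hI.no_separating c hc
  · refine ⟨f, 1, ?_⟩
    rw [one_smul]
    exact isWindingNumber_ind_singleton (hinner f 1 hf) hc.injective hf
  · refine ⟨f, -1, ?_⟩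
    rw [neg_one_smul]
    exact isWindingNumber_neg_ind_singleton (hinner f M.opp hf) hc.injective hf

theorem IsIrreducible.subsingleton_of_isWindingNumber (hI : M.IsIrreducible)
    (hD : M.IsHexagonDissection) {c : Fin 4 → H} (hc : M.IsSimpleCycle c) {R : Set M.Face}
    (hR : M.IsWindingNumber c (ind R)) : R.Subsingleton := by
  obtain ⟨f, s, hs⟩ := hI.exists_isWindingNumber_smul_ind hD hc
  have hmem : ∀ g ∈ R, g = f := fun g hg => by
    by_contra hgf
    have hsg := congrFun (hR.unique hs) g
    rw [ind_of_mem hg, Pi.smul_apply, ind_of_notMem (R := {f}) hgf, smul_zero] at hsg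
    exact one_ne_zero hsg
  exact fun g hg g' hg' => (hmem g hg).trans (hmem g' hg').symm

end ShortCycles

section SmallCuts

variable {H : Type*} [Fintype H] {M : PlanarMap H}

theorem one_lt_card_cut (hD : M.IsHexagonDissection) {R : Set M.Face} (hne : R.Nonempty)
    (hout : M.outer ∉ R) : 1 < #(M.cut R) := by
  obtain ⟨h, hh⟩ := cut_nonempty hne hout
  obtain ⟨k, hk, hhk⟩ := exists_cut_succ hh
  refine Finset.one_lt_card.mpr ⟨h, hh, k, hk, ?_⟩
  rintro rfl
  exact hD.origin_opp_ne h hhk.symm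

theorem exists_cut_eq_pair (hD : M.IsHexagonDissection) {R : Set M.Face}
    (hcard : #(M.cut R) ≤ 2) {h : H} (hh : h ∈ M.cut R) :
    ∃ k, h ≠ k ∧ M.cut R = {h, k} ∧ M.origin (M.opp h) = M.origin k ∧
      M.origin (M.opp k) = M.origin h := by
  obtain ⟨k, hk, hhk⟩ := exists_cut_succ hh
  obtain ⟨l, hl, hkl⟩ := exists_cut_succ hk
  have hne : h ≠ k := by
    rintro rfl
    exact hD.origin_opp_ne h hhk.symm
  have hpair : M.cut R = {h, k} := (Finset.eq_of_subset_of_card_le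
    (by simp [Finset.insert_subset_iff, hh, hk]) (by rwa [Finset.card_pair hne])).symm
  rw [hpair, Finset.mem_insert, Finset.mem_singleton] at hl
  obtain rfl : l = h := hl.resolve_right (by rintro rfl; exact hD.origin_opp_ne l hkl.symm)
  exact ⟨k, hne, hpair, hhk.symm, hkl.symm⟩

variable (M) in
/-- A set of inner faces bounded by at most two edges that absorbs every other such set meeting
it. -/
structure IsMaximalSmallCut (R : Set M.Face) : Prop where
  nonempty : R.Nonempty
  outer_notMem : M.outer ∉ R
  card_cut_le : #(M.cut R) ≤ 2
  subset_of_inter_nonempty : ∀ P : Set M.Face, M.outer ∉ P → #(M.cut P) ≤ 2 →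
    (P ∩ R).Nonempty → P ⊆ R

theorem exists_isMaximalSmallCut (hD : M.IsHexagonDissection) {R : Set M.Face}
    (hne : R.Nonempty) (hout : M.outer ∉ R) (hcard : #(M.cut R) ≤ 2) :
    ∃ R, M.IsMaximalSmallCut R := by
  obtain ⟨R, ⟨hne, hout, hcard⟩, hmax⟩ := (Set.toFinite {R : Set M.Face | R.Nonempty ∧
    M.outer ∉ R ∧ #(M.cut R) ≤ 2}).exists_maximal ⟨R, hne, hout, hcard⟩
  refine ⟨R, hne, hout, hcard, fun P hPout hPcard hPR => ?_⟩
  have hinter : 1 < #(M.cut (R ∩ P)) :=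
    one_lt_card_cut hD (Set.inter_comm P R ▸ hPR) fun h => hout h.1
  have hsubmodular := card_cut_union_add_card_cut_inter_le R P
  exact Set.subset_union_right.trans (hmax (y := R ∪ P)
    ⟨hne.mono Set.subset_union_left, fun h => h.elim hout hPout, by omega⟩ Set.subset_union_left)

theorem IsMaximalSmallCut.eq_zero_of_isWindingNumber {R : Set M.Face}
    (hR : M.IsMaximalSmallCut R) {h : H} (hh : h ∈ M.cut R) {c : Fin 2 → H} {φ : M.Face → ℚ}
    (hφ : M.IsWindingNumber c φ) (hc : h ∉ Set.range c) (hc' : M.opp h ∉ Set.range c) :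
    φ (M.face (M.opp h)) = 0 := by
  by_contra hne
  exact (mem_cut.mp hh).2 (hR.subset_of_inter_nonempty {f | φ f = φ (M.face (M.opp h))}
    (fun houter => hne (houter.symm.trans hφ.outer)) (hφ.card_cut_le _)
    ⟨M.face h, hφ.eq_of_notMem_range hc hc', (mem_cut.mp hh).1⟩ rfl)

/-- The winding number of one of the two digons must be nonzero at the face across `h`. Its level
set there is a small cut that meets `R` and is not contained in it. -/
theorem IsMaximalSmallCut.notMem_of_two_digons {R P : Set M.Face} (hR : M.IsMaximalSmallCut R)
    {h : H} (hh : h ∈ M.cut R) {a b c d : H} (hab : M.origin (M.opp a) = M.origin b)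
    (hba : M.origin (M.opp b) = M.origin a) (hP : M.IsWindingNumber ![a, b, c, d] (ind P))
    (hc : h ∉ Set.range ![a, b, c, d]) (hc' : M.opp h ∉ Set.range ![a, b, c, d]) :
    M.face (M.opp h) ∉ P := by
  intro hmem
  simp only [Matrix.range_cons, Matrix.range_empty, Set.union_empty, Set.singleton_union,
    Set.mem_insert_iff, Set.mem_singleton_iff, not_or] at hc hc'
  obtain ⟨φ, hφ⟩ := exists_isWindingNumber (c := ![a, b]) (M := M) (by
    intro i
    fin_cases i
    exacts [hab, hba])
  have hψ : M.IsWindingNumber ![c, d] (ind P - φ) :=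
    ⟨by rw [Pi.sub_apply, hP.outer, hφ.outer, sub_zero], fun k => by
      have hPk := hP.gradient k
      have hφk := hφ.gradient k
      simp only [passes_four, Pi.add_apply] at hPk
      simp only [Pi.sub_apply]
      linarith⟩
  have hφzero := hR.eq_zero_of_isWindingNumber hh hφ (by simp [hc]) (by simp [hc'])
  have hψzero := hR.eq_zero_of_isWindingNumber hh hψ (by simp [hc]) (by simp [hc'])
  rw [Pi.sub_apply, hφzero, ind_of_mem hmem] at hψzero
  norm_num at hψzero

/-- Adding to `R` the quadrangle across one of its boundary edges replaces this edge by the three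
other sides of the quadrangle. The new boundary is either a 4-cycle, contrary to irreducibility,
or splits into two digons. -/
theorem IsMaximalSmallCut.face_opp_eq_outer (hD : M.IsHexagonDissection) (hI : M.IsIrreducible)
    {R : Set M.Face} (hR : M.IsMaximalSmallCut R) {h : H} (hh : h ∈ M.cut R) :
    M.face (M.opp h) = M.outer := by
  by_contra hf
  obtain ⟨hhR, hfR⟩ := mem_cut.mp hh
  obtain ⟨b, hhb, hcut, hob, hbo⟩ := exists_cut_eq_pair hD hR.card_cut_le hh
  obtain ⟨c, hc0, hinj, hsucc, hface⟩ := exists_enum_of_faceDegree (hD.inner_degree _ hf)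
  have horigin : ∀ i, M.origin (M.opp (c i)) = M.origin (c (i + 1)) := fun i => by
    rw [hsucc, M.origin_rot]
  have hc : c = ![M.opp h, c 1, c 2, c 3] := by
    funext i
    fin_cases i
    exacts [hc0, rfl, rfl, rfl]
  have hwR : M.IsWindingNumber ![h, b] (ind R) :=
    isWindingNumber_ind_of_cut hR.outer_notMem (by simp [Function.Injective, Fin.forall_fin_two,
      hhb, hhb.symm]) (fun x => by simp [hcut, Matrix.range_cons, or_comm])
  have hwf : M.IsWindingNumber ![M.opp h, c 1, c 2, c 3] (ind {M.face (M.opp h)}) :=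
    hc ▸ isWindingNumber_ind_singleton hf hinj hface
  have hw := hwR.ind_insert hfR hwf
  have hhc : ∀ i, h ≠ c i := fun i hi => hfR ((hface h).mpr ⟨i, hi.symm⟩ ▸ hhR)
  have hoppb : M.opp h ≠ b := fun hb => opp_notMem_cut hh (by simp [hcut, hb])
  have hoppc : ∀ i, i ≠ 0 → M.opp h ≠ c i := fun i hi hci => hi (hinj (by rw [← hci, hc0]))
  have hbc : M.origin (M.opp b) = M.origin (c 1) := by
    rw [hbo, ← M.opp_opp h, ← hc0, horigin, zero_add]
  have hcb : M.origin (M.opp (c 3)) = M.origin b := by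
    rw [horigin, ← hob, ← hc0]
    rfl
  by_cases h2 : M.origin (c 2) = M.origin b
  · exact hR.notMem_of_two_digons hh hbc ((horigin 1).trans h2) hw (by simp [hhb, hhc])
      (by simp [hoppb, hoppc]) (Set.mem_insert _ _)
  by_cases h3 : M.origin (c 3) = M.origin (c 1)
  · exact hR.notMem_of_two_digons hh (horigin 1) ((horigin 2).trans h3) hw.rotate_four
      (by simp [hhb, hhc]) (by simp [hoppb, hoppc]) (Set.mem_insert _ _)
  have hsub := hI.subsingleton_of_isWindingNumber hD (isSimpleCycle_of_four hD hbc (horigin 1)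
    (horigin 2) hcb (Ne.symm h2) (Ne.symm h3)) hw
  exact hfR (hsub (Set.mem_insert _ _) (Set.mem_insert_of_mem _ hhR) ▸ hhR)

omit [Fintype H] in
theorem six_le_card_of_closed (hD : M.IsHexagonDissection) {A : Finset H} {a : H} (ha : a ∈ A)
    (haf : M.face a = M.outer) (hA : ∀ h ∈ A, M.rot (M.opp h) ∈ A) : 6 ≤ #A := by
  rw [← hD.outer_degree, ← Nat.card_eq_finsetCard]
  have := M.finite
  refine Nat.card_mono (Set.toFinite (A : Set H)) fun h (hh : M.face h = M.outer) => ?_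
  by_contra hhA
  obtain ⟨k, -, hk, hk'⟩ := M.exists_face_step (P := fun h => h ∈ A) (haf.trans hh.symm) ha hhA
  exact hk' (hA k hk)

omit [Fintype H] in
theorem face_opp_ne_outer_of_digon (hD : M.IsHexagonDissection) {h k : H}
    (hhk : M.origin (M.opp h) = M.origin k) (hkh : M.origin (M.opp k) = M.origin h)
    (hh : M.face (M.opp h) = M.outer) : M.face (M.opp k) ≠ M.outer := by
  have := M.finite
  let _ : Fintype H := Fintype.ofFinite H
  intro hk
  have hrot : M.rot h = M.opp k := hD.outer_simple _ _ (by rw [M.face_rot, hh]) hk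
    (by rw [M.origin_rot, hkh])
  have hrot' : M.rot k = M.opp h := hD.outer_simple _ _ (by rw [M.face_rot, hk]) hh
    (by rw [M.origin_rot, hhk])
  have hsix := six_le_card_of_closed hD (A := {M.opp h, M.opp k}) (a := M.opp h) (by simp) hh
    (by simp [M.opp_opp, hrot, hrot'])
  have htwo : ({M.opp h, M.opp k} : Finset H).card ≤ 2 := Finset.card_le_two
  omega

theorem two_lt_card_cut (hD : M.IsHexagonDissection) (hI : M.IsIrreducible) {R : Set M.Face}
    (hne : R.Nonempty) (hout : M.outer ∉ R) : 2 < #(M.cut R) := by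
  by_contra! hcard
  obtain ⟨R, hR⟩ := exists_isMaximalSmallCut hD hne hout hcard
  obtain ⟨h, hh⟩ := cut_nonempty hR.nonempty hR.outer_notMem
  obtain ⟨k, -, hcut, hhk, hkh⟩ := exists_cut_eq_pair hD hR.card_cut_le hh
  exact face_opp_ne_outer_of_digon hD hhk hkh (hR.face_opp_eq_outer hD hI hh)
    (hR.face_opp_eq_outer hD hI (by simp [hcut]))

omit [Fintype H] in
/-- Otherwise the two parallel edges form a digon, and a nonzero level set of its winding number
is bounded by at most two edges. -/
theorem eq_of_parallel (hD : M.IsHexagonDissection) (hI : M.IsIrreducible) {a b : H}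
    (ho : M.origin a = M.origin b) (ho' : M.origin (M.opp a) = M.origin (M.opp b)) : a = b := by
  have := M.finite
  let _ : Fintype H := Fintype.ofFinite H
  by_contra hne
  obtain ⟨φ, hφ⟩ := exists_isWindingNumber (M := M) (c := ![a, M.opp b]) (by
    intro i
    fin_cases i
    exacts [ho', (congrArg M.origin (M.opp_opp b)).trans ho.symm])
  have hzero : ∀ f, φ f = 0 := fun f => by
    by_contra hf
    have hcut := two_lt_card_cut hD hI (R := {g | φ g = φ f}) ⟨f, rfl⟩
      fun houter => hf (houter.symm.trans hφ.outer)
    exact absurd (hφ.card_cut_le (φ f)) (not_le.mpr hcut)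
  have hab : a ≠ M.opp b := fun h => hD.origin_opp_ne b (by rw [← h, ho])
  have hgrad := hφ.gradient a
  simp only [passes, Fin.sum_univ_two] at hgrad
  simp [hzero, ind, hab, M.opp_ne a, hne] at hgrad

theorem origin_ne_of_cut_path (hD : M.IsHexagonDissection) (hI : M.IsIrreducible)
    {R : Set M.Face} {h k l : H} (hh : h ∈ M.cut R) (hk : k ∈ M.cut R)
    (hhk : M.origin k = M.origin (M.opp h)) (hkl : M.origin l = M.origin (M.opp k)) :
    M.origin l ≠ M.origin h := by
  intro hlh
  obtain rfl : k = M.opp h := eq_of_parallel hD hI hhk (by rw [← hkl, hlh, M.opp_opp])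
  exact opp_notMem_cut hh hk

theorem exists_isSimpleCycle_of_card_cut_le_four (hD : M.IsHexagonDissection)
    (hI : M.IsIrreducible) {R : Set M.Face} (hne : R.Nonempty) (hout : M.outer ∉ R)
    (hcard : #(M.cut R) ≤ 4) :
    ∃ c : Fin 4 → H, M.IsSimpleCycle c ∧ ∀ h, h ∈ M.cut R ↔ h ∈ Set.range c := by
  obtain ⟨a, ha⟩ := cut_nonempty hne hout
  obtain ⟨b, hb, hab⟩ := exists_cut_succ ha
  obtain ⟨c, hc, hbc⟩ := exists_cut_succ hb
  obtain ⟨d, hd, hcd⟩ := exists_cut_succ hc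
  obtain ⟨e, he, hde⟩ := exists_cut_succ hd
  have nac := origin_ne_of_cut_path hD hI ha hb hab hbc
  have nbd := origin_ne_of_cut_path hD hI hb hc hbc hcd
  have nce := origin_ne_of_cut_path hD hI hc hd hcd hde
  have nab : M.origin b ≠ M.origin a := hab ▸ hD.origin_opp_ne a
  have nbc : M.origin c ≠ M.origin b := hbc ▸ hD.origin_opp_ne b
  have ncd : M.origin d ≠ M.origin c := hcd ▸ hD.origin_opp_ne c
  have nde : M.origin e ≠ M.origin d := hde ▸ hD.origin_opp_ne d
  have nad : M.origin d ≠ M.origin a := hcd ▸ hD.origin_ne_of_three_steps hab hbc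
  have nbe : M.origin e ≠ M.origin b := hde ▸ hD.origin_ne_of_three_steps hbc hcd
  have ne_of_origin : ∀ {x y : H}, M.origin x ≠ M.origin y → y ≠ x :=
    fun h hxy => h (congrArg M.origin hxy.symm)
  have hset : ({a, b, c, d} : Finset H) = M.cut R := by
    refine Finset.eq_of_subset_of_card_le (by simp [Finset.insert_subset_iff, ha, hb, hc, hd]) ?_
    rwa [Finset.card_insert_of_notMem, Finset.card_insert_of_notMem,
      Finset.card_pair (ne_of_origin ncd)]
    · simp [ne_of_origin nbc, ne_of_origin nbd]
    · simp [ne_of_origin nab, ne_of_origin nac, ne_of_origin nad]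
  obtain rfl : e = a := by
    have hmem : e ∈ ({a, b, c, d} : Finset H) := hset ▸ he
    simpa [(ne_of_origin nbe).symm, (ne_of_origin nce).symm, (ne_of_origin nde).symm] using hmem
  refine ⟨![e, b, c, d], isSimpleCycle_of_four hD hab.symm hbc.symm hcd.symm hde.symm nac.symm
    nbd.symm, fun h => ?_⟩
  rw [← hset]
  simp only [Finset.mem_insert, Finset.mem_singleton, Matrix.range_cons, Matrix.range_empty,
    Set.union_empty, Set.singleton_union, Set.mem_insert_iff, Set.mem_singleton_iff]

theorem subsingleton_of_card_cut_le_four (hD : M.IsHexagonDissection) (hI : M.IsIrreducible)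
    {R : Set M.Face} (hout : M.outer ∉ R) (hcard : #(M.cut R) ≤ 4) : R.Subsingleton := by
  obtain rfl | hne := R.eq_empty_or_nonempty
  · exact Set.subsingleton_empty
  obtain ⟨c, hc, hcut⟩ := exists_isSimpleCycle_of_card_cut_le_four hD hI hne hout hcard
  exact hI.subsingleton_of_isWindingNumber hD hc
    (isWindingNumber_ind_of_cut hout hc.injective hcut)

end SmallCuts

section OuterFace

variable {H : Type*} {M : PlanarMap H}

theorem face_opp_ne_outer (hD : M.IsHexagonDissection) {h : H} (hh : M.face h = M.outer) :
    M.face (M.opp h) ≠ M.outer :=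
  face_opp_ne_outer_of_digon hD (h := M.opp h) (congrArg M.origin (M.opp_opp h)) rfl
    (by rw [M.opp_opp, hh])

theorem isOuterVertex_of_face {h : H} (hh : M.face h = M.outer) : M.IsOuterVertex (M.origin h) :=
  ⟨h, rfl, hh⟩

theorem isOuterVertex_of_face_opp {h : H} (hh : M.face (M.opp h) = M.outer) :
    M.IsOuterVertex (M.origin h) := ⟨M.rot h, M.origin_rot h, by rw [M.face_rot, hh]⟩

theorem isInner_of_not_isOuterVertex {h : H} (hh : ¬ M.IsOuterVertex (M.origin h)) :
    M.IsInner h :=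
  ⟨fun hf => hh (isOuterVertex_of_face hf), fun hf => hh (isOuterVertex_of_face_opp hf)⟩

theorem exists_isInner_of_ne_outer (hD : M.IsHexagonDissection) {f : M.Face} (hf : f ≠ M.outer) :
    ∃ h, M.face h = f ∧ M.IsInner h := by
  have := M.finite
  let _ : Fintype H := Fintype.ofFinite H
  by_contra! hnone
  have hall : ∀ h, M.face h = f → M.face (M.opp h) = M.outer := fun h hh => by
    by_contra hne
    exact hnone h hh ⟨hh.trans_ne hf, hne⟩
  have hsucc : ∀ h, M.face h = f → M.rot h = M.rot.symm h := fun h hh => by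
    have hprev := hall (M.opp (M.rot.symm h)) (by rw [M.face_opp_rot_symm, hh])
    rw [M.opp_opp] at hprev
    exact hD.outer_simple _ _ (by rw [M.face_rot, hall h hh]) hprev
      (by rw [M.origin_rot, M.origin_rot_symm])
  obtain ⟨h, rfl⟩ := M.face_surjective f
  have hsix := six_le_card_of_closed hD
    (A := (Finset.univ.filter fun k => M.face k = M.face h).image M.opp) (a := M.opp h)
    (Finset.mem_image_of_mem _ (by simp)) (hall h rfl) (by
      simp only [Finset.forall_mem_image, Finset.mem_filter_univ, M.opp_opp]
      intro k hk
      rw [hsucc k hk]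
      exact Finset.mem_image.mpr ⟨M.opp (M.rot.symm k),
        by simpa [M.face_opp_rot_symm] using hk, M.opp_opp _⟩)
  have hfour := Finset.card_image_le (s := Finset.univ.filter fun k => M.face k = M.face h)
    (f := M.opp)
  rw [← faceDegree_eq_card, hD.inner_degree _ hf] at hfour
  omega

theorem exists_isInner_of_isOuterVertex (hD : M.IsHexagonDissection) {h : H}
    (hf : M.face h ≠ M.outer) (hh : M.IsOuterVertex (M.origin h)) :
    ∃ k, M.face k = M.face h ∧ M.IsInner k ∧ M.IsOuterVertex (M.origin k) := by
  obtain ⟨l, hlh, hl⟩ := exists_isInner_of_ne_outer hD hf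
  by_contra! hnone
  have hall : ∀ k, M.face k = M.face h → M.IsOuterVertex (M.origin k) →
      M.face (M.opp k) = M.outer := fun k hk hkout => by
    by_contra hne
    exact hnone k hk ⟨hk ▸ hf, hne⟩ hkout
  obtain ⟨k, hk, hkout, hkrot⟩ := M.exists_face_step (P := fun k => M.IsOuterVertex (M.origin k))
    hlh.symm hh (hnone l hlh hl)
  rw [M.origin_rot] at hkrot
  exact hkrot (isOuterVertex_of_face (hall k hk hkout))

theorem isWindingNumber_outer {n : ℕ} {c : Fin n → H} (hc : Function.Injective c)
    (hface : ∀ h, M.face h = M.outer ↔ h ∈ Set.range c) :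
    M.IsWindingNumber c (ind {M.outer} - 1) where
  outer := sub_eq_zero.mpr (ind_of_mem rfl)
  gradient h := by
    simp only [Pi.sub_apply, ind_singleton_face_eq_passes (σ := id) hc hface, id]
    exact sub_sub_sub_cancel_right _ _ _

theorem IsHexagonDissection.exists_hexagon (hD : M.IsHexagonDissection) {v : M.Vertex}
    (hv : M.IsOuterVertex v) : ∃ c : Fin 6 → H, M.origin (c 0) = v ∧
      (∀ i, M.origin (M.opp (c i)) = M.origin (c (i + 1))) ∧
      Function.Injective (fun i => M.origin (c i)) ∧
      ∀ h, M.face h = M.outer ↔ h ∈ Set.range c := by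
  obtain ⟨h, rfl, hh⟩ := hv
  obtain ⟨c, rfl, hinj, hsucc, hface⟩ := exists_enum_of_faceDegree (hh ▸ hD.outer_degree)
  rw [hh] at hface
  refine ⟨c, rfl, fun i => by rw [hsucc, M.origin_rot], fun i j hij => ?_, hface⟩
  exact hinj (hD.outer_simple _ _ ((hface _).mpr ⟨i, rfl⟩) ((hface _).mpr ⟨j, rfl⟩) hij)

/-- Such a diagonal would split the hexagon into two 4-cycles, each bounding a single face, and
the map would have only three faces. -/
theorem IsIrreducible.origin_opp_ne_antipode (hI : M.IsIrreducible) (hD : M.IsHexagonDissection)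
    {c : Fin 6 → H} (hchain : ∀ i, M.origin (M.opp (c i)) = M.origin (c (i + 1)))
    (hinj : Function.Injective fun i => M.origin (c i))
    (hface : ∀ h, M.face h = M.outer ↔ h ∈ Set.range c) {h : H}
    (hh : M.origin h = M.origin (c 0)) : M.origin (M.opp h) ≠ M.origin (c 3) := by
  intro hopp
  have := M.finite
  have hleft := isSimpleCycle_of_four hD (b := c 1) (c := c 2) (hchain 0) (hchain 1) (d := M.opp h)
    ((hchain 2).trans hopp.symm) ((congrArg M.origin (M.opp_opp h)).trans hh)
    (hinj.ne (by decide)) (hopp ▸ hinj.ne (by decide))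
  have hright := isSimpleCycle_of_four hD (b := c 4) (c := c 5) (hchain 3) (hchain 4) (d := h)
    ((hchain 5).trans hh.symm) hopp (hinj.ne (by decide)) (hh ▸ hinj.ne (by decide))
  obtain ⟨f, s, hf⟩ := hI.exists_isWindingNumber_smul_ind hD hleft
  obtain ⟨f', s', hf'⟩ := hI.exists_isWindingNumber_smul_ind hD hright
  have hsum : M.IsWindingNumber c (s • ind {f} + s' • ind {f'}) := by
    refine ⟨by rw [Pi.add_apply, hf.outer, hf'.outer, add_zero], fun k => ?_⟩
    have hfk := hf.gradient k
    have hfk' := hf'.gradient k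
    simp only [passes, Fin.sum_univ_four, Fin.sum_univ_six, Matrix.cons_val, M.ind_singleton_opp,
      M.opp_opp, Pi.add_apply, Fin.isValue] at hfk hfk' ⊢
    linarith
  have heq := hsum.unique (isWindingNumber_outer (Function.Injective.of_comp hinj) hface)
  obtain ⟨g, hg⟩ : ∃ g, g ∉ ({M.outer, f, f'} : Finset M.Face) := by
    by_contra! hall
    have hle := Set.ncard_le_ncard (s := Set.univ) (t := ↑({M.outer, f, f'} : Finset M.Face))
      fun g _ => hall g
    rw [Set.ncard_univ, Set.ncard_coe_finset] at hle
    exact absurd (hI.four_le_faces.trans (hle.trans Finset.card_le_three)) (by norm_num)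
  simp only [Finset.mem_insert, Finset.mem_singleton, not_or] at hg
  simpa [ind, hg] using congrFun heq g

theorem not_isOuterVertex_opp (hD : M.IsHexagonDissection) (hI : M.IsIrreducible) {h : H}
    (hin : M.IsInner h) (hh : M.IsOuterVertex (M.origin h)) :
    ¬ M.IsOuterVertex (M.origin (M.opp h)) := by
  rintro ⟨b, hb, hbf⟩
  obtain ⟨c, hc0, hchain, hinj, hface⟩ := hD.exists_hexagon hh
  obtain ⟨j, rfl⟩ := (hface b).mp hbf
  have hinner : ∀ i, M.face (c i) = M.outer := fun i => (hface _).mpr ⟨i, rfl⟩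
  fin_cases j
  · exact hD.origin_opp_ne h (hb.symm.trans hc0)
  · have heq : h = c 0 := eq_of_parallel hD hI hc0.symm (hb.symm.trans (hchain 0).symm)
    exact hin.1 (heq ▸ hinner 0)
  · exact hD.origin_ne_of_three_steps (h := c 0) (k := c 1) (l := M.opp h) (hchain 0).symm
      (hb.symm.trans (hchain 1).symm) ((congrArg M.origin (M.opp_opp h)).trans hc0.symm)
  · exact hI.origin_opp_ne_antipode hD hchain hinj hface hc0.symm hb.symm
  · exact hD.origin_ne_of_three_steps (h := c 4) (k := c 5) (l := h) (hchain 4).symm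
      (hc0.symm.trans (hchain 5).symm) hb.symm
  · have heq : h = M.opp (c 5) := eq_of_parallel hD hI (hc0.symm.trans (hchain 5).symm)
      (by rw [M.opp_opp]; exact hb.symm)
    exact hin.2 (by rw [heq, M.opp_opp, hinner])

end OuterFace

variable {H : Type*} [Fintype H] {M : PlanarMap H}

section DissectionCounts

omit [Fintype H] in
theorem IsHexagonDissection.faceDegree_eq (hD : M.IsHexagonDissection) (f : M.Face) :
    M.faceDegree f = 4 + if f = M.outer then 2 else 0 := by
  split_ifs with hf
  · rw [hf, hD.outer_degree]
  · rw [hD.inner_degree f hf]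

theorem IsHexagonDissection.card_face_mem (hD : M.IsHexagonDissection) (T : Finset M.Face) :
    #{h | M.face h ∈ T} = 4 * #T + if M.outer ∈ T then 2 else 0 := by
  rw [← Finset.sum_card_fiberwise_eq_card_filter]
  simp only [← faceDegree_eq_card, hD.faceDegree_eq]
  rw [Finset.sum_add_distrib, Finset.sum_const, smul_eq_mul, mul_comm, Finset.sum_ite_eq']

theorem IsHexagonDissection.card_halfEdge (hD : M.IsHexagonDissection) :
    Fintype.card H = 4 * Fintype.card M.Face + 2 := by
  simpa using hD.card_face_mem Finset.univ

theorem IsHexagonDissection.card_vertex (hD : M.IsHexagonDissection) :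
    Fintype.card M.Vertex = Fintype.card M.Face + 3 := by
  have hhalf := hD.card_halfEdge
  have heuler := M.card_vertex_add_card_face
  have hedge := M.card_eq_two_mul_card_edge
  omega

theorem IsHexagonDissection.card_isOuterVertex (hD : M.IsHexagonDissection) :
    #{v | M.IsOuterVertex v} = 6 := by
  have himage : ({v | M.IsOuterVertex v} : Finset M.Vertex) =
      Finset.image M.origin {h | M.face h = M.outer} := by
    ext v
    simp only [Finset.mem_filter_univ, Finset.mem_image]
    exact exists_congr fun h => and_comm
  rw [himage, Finset.card_image_of_injOn, ← faceDegree_eq_card, hD.outer_degree]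
  intro h hh k hk
  exact hD.outer_simple h k (by simpa using hh) (by simpa using hk)

theorem IsHexagonDissection.card_isInner (hD : M.IsHexagonDissection) :
    #{h | M.IsInner h} + 12 = Fintype.card H := by
  have hright : #{h | M.face h = M.outer} = 6 := by rw [← faceDegree_eq_card, hD.outer_degree]
  have hleft : #{h | M.face (M.opp h) = M.outer} = 6 := by
    rw [← hright]
    exact Finset.card_equiv M.opp fun h => by simp
  have hunion : ({h | ¬ M.IsInner h} : Finset H) =
      ({h | M.face h = M.outer} : Finset H) ∪ ({h | M.face (M.opp h) = M.outer} : Finset H) := by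
    ext h
    simp only [Finset.mem_filter_univ, Finset.mem_union]
    exact not_and_or.trans (or_congr not_not not_not)
  have hdisjoint : Disjoint ({h | M.face h = M.outer} : Finset H)
      ({h | M.face (M.opp h) = M.outer} : Finset H) :=
    Finset.disjoint_filter.mpr fun h _ hh => face_opp_ne_outer hD hh
  have hsplit := Finset.card_filter_add_card_filter_not (s := (Finset.univ : Finset H)) M.IsInner
  rw [hunion, Finset.card_union_of_disjoint hdisjoint, hright, hleft, Finset.card_univ] at hsplit
  exact hsplit

theorem IsHexagonDissection.card_isInner_add_one (hD : M.IsHexagonDissection) :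
    #{h | M.IsInner h} + 1 =
      ∑ v : M.Vertex, (if M.IsOuterVertex v then 0 else 3) + Fintype.card M.Face := by
  have hcompl := Finset.card_filter_add_card_filter_not (s := Finset.univ) M.IsOuterVertex
  rw [hD.card_isOuterVertex, Finset.card_univ] at hcompl
  rw [Finset.sum_ite, Finset.sum_const_zero, Finset.sum_const, smul_eq_mul]
  have hinner := hD.card_isInner
  have hvertex := hD.card_vertex
  have hhalf := hD.card_halfEdge
  omega

end DissectionCounts

section DimensionCount

/-- Summation by parts. -/
theorem sum_vertex_diff_mul_face_diff (g : M.Vertex → ℚ) (q : M.Face → ℚ) :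
    ∑ h, (g (M.origin h) - g (M.origin (M.opp h))) * (q (M.face h) - q (M.face (M.opp h))) = 0 := by
  have hright : ∑ h, g (M.origin h) * (q (M.face h) - q (M.face (M.opp h))) = 0 := by
    rw [← sum_fiberSum M.origin]
    refine Finset.sum_eq_zero fun v _ => ?_
    rw [fiberSum_congr (z' := fun h => g v * (q (M.face h) - q (M.face (M.opp h))))
        fun k hk => by rw [hk],
      fiberSum_mul_left, fiberSum_sub, M.fiberSum_origin_face_opp, sub_self, mul_zero]
  have hleft : ∑ h, g (M.origin (M.opp h)) * (q (M.face h) - q (M.face (M.opp h))) = 0 := by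
    rw [← Equiv.sum_comp M.opp, ← neg_eq_zero, ← Finset.sum_neg_distrib, ← hright]
    refine Finset.sum_congr rfl fun h _ => ?_
    rw [M.opp_opp]
    ring
  simp only [sub_mul, Finset.sum_sub_distrib]
  rw [hright, hleft, sub_zero]

variable (M) in
/-- The linear map that adds the difference of a function on vertices along each half-edge to the
difference of a function on faces across it. -/
def differences : ((M.Vertex → ℚ) × (M.Face → ℚ)) →ₗ[ℚ] (H → ℚ) :=
  (LinearMap.funLeft ℚ ℚ M.origin - LinearMap.funLeft ℚ ℚ fun h => M.origin (M.opp h)).coprod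
    (LinearMap.funLeft ℚ ℚ M.face - LinearMap.funLeft ℚ ℚ fun h => M.face (M.opp h))

omit [Fintype H] in
theorem differences_apply (x : (M.Vertex → ℚ) × (M.Face → ℚ)) (h : H) : M.differences x h =
    (x.1 (M.origin h) - x.1 (M.origin (M.opp h))) + (x.2 (M.face h) - x.2 (M.face (M.opp h))) :=
  rfl

omit [Fintype H] in
theorem differences_eq_zero_of_chosen {S : Set H} (hS : ∀ h ∈ S, M.opp h ∈ S)
    {x : (M.Vertex → ℚ) × (M.Face → ℚ)} (hx : ∀ h ∈ S, h ∈ M.chosen → M.differences x h = 0)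
    {h : H} (hh : h ∈ S) : M.differences x h = 0 := by
  by_cases hc : h ∈ M.chosen
  · exact hx h hh hc
  · have hopp := hx (M.opp h) (hS h hh) (by rwa [M.mem_chosen_iff, M.opp_opp])
    rw [differences_apply, M.opp_opp] at hopp
    rw [differences_apply]
    linarith

omit [Fintype H] in
/-- The two differences are opposite on `S`, so the sum of their products is minus a sum of
squares. -/
theorem eq_of_differences_eq_zero {S : Set H} {x : (M.Vertex → ℚ) × (M.Face → ℚ)}
    (hS : ∀ h ∈ S, M.differences x h = 0)
    (hoff : ∀ h ∉ S, (x.1 (M.origin h) - x.1 (M.origin (M.opp h))) *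
      (x.2 (M.face h) - x.2 (M.face (M.opp h))) = 0) {h : H} (hh : h ∈ S) :
    x.1 (M.origin (M.opp h)) = x.1 (M.origin h) ∧ x.2 (M.face (M.opp h)) = x.2 (M.face h) := by
  have := M.finite
  let _ : Fintype H := Fintype.ofFinite H
  have hproduct : ∀ k ∈ S, (x.1 (M.origin k) - x.1 (M.origin (M.opp k))) *
      (x.2 (M.face k) - x.2 (M.face (M.opp k))) =
        -(x.1 (M.origin k) - x.1 (M.origin (M.opp k))) ^ 2 := fun k hk => by
    have hzero := hS k hk
    rw [differences_apply, add_comm, add_eq_zero_iff_eq_neg] at hzero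
    rw [hzero]
    ring
  have hnonpos : ∀ k ∈ Finset.univ, (x.1 (M.origin k) - x.1 (M.origin (M.opp k))) *
      (x.2 (M.face k) - x.2 (M.face (M.opp k))) ≤ 0 := fun k _ => by
    by_cases hk : k ∈ S
    · rw [hproduct k hk]
      exact neg_nonpos.mpr (sq_nonneg _)
    · exact (hoff k hk).le
  have hvertex := (Finset.sum_eq_zero_iff_of_nonpos hnonpos).mp
    (sum_vertex_diff_mul_face_diff x.1 x.2) h (Finset.mem_univ h)
  rw [hproduct h hh, neg_eq_zero, sq_eq_zero_iff] at hvertex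
  have hsum := hS h hh
  rw [differences_apply, hvertex, zero_add] at hsum
  exact ⟨(sub_eq_zero.mp hvertex).symm, (sub_eq_zero.mp hsum).symm⟩

omit [Fintype H] in
/-- The hypotheses make the map that sends a pair of functions to its differences on `S`, its image
under `l` and its restrictions to the complements of `A` and `B` injective. -/
theorem card_add_card_le_of_differences {S : Finset H} (hS : ∀ h ∈ S, M.opp h ∈ S)
    {A : Finset M.Vertex} {B : Finset M.Face}
    (hAB : ∀ h ∉ S, (M.origin h ∉ A ∧ M.origin (M.opp h) ∉ A) ∨
      (M.face h ∉ B ∧ M.face (M.opp h) ∉ B))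
    (l : ((M.Vertex → ℚ) × (M.Face → ℚ)) →ₗ[ℚ] ℚ)
    (hl : ∀ x : (M.Vertex → ℚ) × (M.Face → ℚ), (∀ v ∉ A, x.1 v = 0) → (∀ f ∉ B, x.2 f = 0) →
      (∀ h ∈ S, x.1 (M.origin (M.opp h)) = x.1 (M.origin h) ∧
        x.2 (M.face (M.opp h)) = x.2 (M.face h)) → l x = 0 → x = 0) :
    2 * (#A + #B) ≤ #S + 2 := by
  have := M.finite
  let _ : Fintype H := Fintype.ofFinite H
  let restrict : ((M.Vertex → ℚ) × (M.Face → ℚ)) →ₗ[ℚ]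
      ({v // v ∉ A} → ℚ) × ({f // f ∉ B} → ℚ) :=
    (LinearMap.funLeft ℚ ℚ Subtype.val).prodMap (LinearMap.funLeft ℚ ℚ Subtype.val)
  let D : ((M.Vertex → ℚ) × (M.Face → ℚ)) →ₗ[ℚ] ({h // h ∈ S ∧ h ∈ M.chosen} → ℚ) :=
    (LinearMap.funLeft ℚ ℚ Subtype.val).comp M.differences
  have hinj : Function.Injective ((D.prod l).prod restrict) := by
    rw [← LinearMap.ker_eq_bot, LinearMap.ker_eq_bot']
    intro x hx
    have hA : ∀ v ∉ A, x.1 v = 0 := fun v hv =>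
      congrFun (congrArg (fun y => y.2.1) hx) ⟨v, hv⟩
    have hB : ∀ f ∉ B, x.2 f = 0 := fun f hf => congrFun (congrArg (fun y => y.2.2) hx) ⟨f, hf⟩
    have hchosen : ∀ h ∈ S, h ∈ M.chosen → M.differences x h = 0 := fun h hh hc =>
      congrFun (congrArg (fun y => y.1.1) hx) ⟨h, hh, hc⟩
    have hzero : ∀ h ∈ S, M.differences x h = 0 := fun h =>
      differences_eq_zero_of_chosen (S := (S : Set H)) hS hchosen
    refine hl x hA hB (fun h => eq_of_differences_eq_zero (S := (S : Set H)) hzero fun k hk => ?_)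
      (congrArg (fun y => y.1.2) hx)
    rcases hAB k hk with ⟨hk, hk'⟩ | ⟨hk, hk'⟩
    · rw [hA _ hk, hA _ hk', sub_self, zero_mul]
    · rw [hB _ hk, hB _ hk', sub_self, mul_zero]
  have hle := LinearMap.finrank_le_finrank_of_injective hinj
  simp only [Module.finrank_prod, Module.finrank_fintype_fun_eq_card, Module.finrank_self,
    Fintype.card_subtype_compl, Fintype.card_coe] at hle
  rw [Fintype.card_subtype] at hle
  have hhalf := M.card_eq_two_mul_card_inter_chosen (S := (S : Set H)) hS
  simp only [Finset.mem_coe, Finset.filter_univ_mem] at hhalf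
  have hAle := Finset.card_le_univ A
  have hBle := Finset.card_le_univ B
  omega

end DimensionCount

section VertexSets

variable {H : Type*} {M : PlanarMap H}

variable (M) in
/-- Disjoint sets of vertices without an edge between them. -/
structure Separated (W₁ W₂ : Finset M.Vertex) : Prop where
  disjoint : Disjoint W₁ W₂
  no_edge : ∀ h, M.origin h ∈ W₁ → M.origin (M.opp h) ∉ W₂

theorem Separated.symm {W₁ W₂ : Finset M.Vertex} (hW : M.Separated W₁ W₂) :
    M.Separated W₂ W₁ where
  disjoint := hW.disjoint.symm
  no_edge h hh hh' := hW.no_edge (M.opp h) hh' (by rwa [M.opp_opp])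

variable (M) in
/-- A set of vertices that induces a connected submap, or is empty. -/
def VertexConnected (W : Finset M.Vertex) : Prop :=
  ∀ W₁ W₂, W = W₁ ∪ W₂ → M.Separated W₁ W₂ → W₁ = ∅ ∨ W₂ = ∅

theorem induction_on_separated {P : Finset M.Vertex → Prop} (W : Finset M.Vertex) (hempty : P ∅)
    (hconnected : ∀ W, W.Nonempty → M.VertexConnected W → P W)
    (hunion : ∀ W₁ W₂, W₁.Nonempty → W₂.Nonempty → M.Separated W₁ W₂ → P W₁ → P W₂ →
      P (W₁ ∪ W₂)) : P W := by
  induction W using Finset.strongInduction with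
  | H W ih =>
    rcases W.eq_empty_or_nonempty with rfl | hne
    · exact hempty
    by_cases hW : M.VertexConnected W
    · exact hconnected W hne hW
    simp only [VertexConnected, not_forall, not_or, ← ne_eq, ← Finset.nonempty_iff_ne_empty] at hW
    obtain ⟨W₁, W₂, rfl, hsep, hne₁, hne₂⟩ := hW
    refine hunion W₁ W₂ hne₁ hne₂ hsep (ih _ ?_) (ih _ ?_)
    · exact Finset.ssubset_iff_subset_ne.mpr ⟨Finset.subset_union_left, fun heq =>
        hne₂.ne_empty (hsep.disjoint.eq_bot_of_ge (Finset.union_eq_left.mp heq.symm))⟩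
    · exact Finset.ssubset_iff_subset_ne.mpr ⟨Finset.subset_union_right, fun heq =>
        hne₁.ne_empty (hsep.disjoint.eq_bot_of_le (Finset.union_eq_right.mp heq.symm))⟩

theorem VertexConnected.forall_of_step {W : Finset M.Vertex} (hW : M.VertexConnected W)
    {P : M.Vertex → Prop} {w₀ : M.Vertex} (hw₀ : w₀ ∈ W) (hP₀ : P w₀)
    (hP : ∀ h, M.origin h ∈ W → M.origin (M.opp h) ∈ W → P (M.origin h) → P (M.origin (M.opp h))) :
    ∀ w ∈ W, P w := by
  have hsep : M.Separated (W.filter P) (W.filter fun w => ¬ P w) :=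
    ⟨Finset.disjoint_filter_filter_not W W P, fun h hh hh' => by
      rw [Finset.mem_filter] at hh hh'
      exact hh'.2 (hP h hh.1 hh'.1 hh.2)⟩
  rcases hW _ _ (Finset.filter_union_filter_not_eq P W).symm hsep with hempty | hempty
  · exact absurd hP₀ (Finset.filter_eq_empty_iff.mp hempty hw₀)
  · exact fun w hw => not_not.mp (Finset.filter_eq_empty_iff.mp hempty hw)

theorem Separated.forall_mem_or_forall_mem {W₁ W₂ : Finset M.Vertex} (hsep : M.Separated W₁ W₂)
    {f : M.Face} (hf : ∀ h, M.face h = f → M.origin h ∈ W₁ ∪ W₂) :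
    (∀ h, M.face h = f → M.origin h ∈ W₁) ∨ ∀ h, M.face h = f → M.origin h ∈ W₂ := by
  by_contra! hcon
  obtain ⟨⟨a, ha, ha₁⟩, b, hb, hb₂⟩ := hcon
  obtain ⟨c, hcf, hc, hc'⟩ := M.exists_face_step (P := fun h => M.origin h ∈ W₁)
    (hb.trans ha.symm) ((Finset.mem_union.mp (hf b hb)).resolve_right hb₂) ha₁
  refine hsep.no_edge c hc ?_
  rw [← M.origin_rot]
  refine (Finset.mem_union.mp (hf _ ?_)).resolve_left hc'
  rw [M.face_rot_opp, hcf, hb]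

variable [Fintype H]

variable (M) in
/-- The half-edges attached to a set of vertices. -/
noncomputable def halfEdgesAt (W : Finset M.Vertex) : Finset H := {h | M.origin h ∈ W}

variable (M) in
/-- The halves of the edges with an end in a set of vertices. -/
noncomputable def halfEdgesTouching (W : Finset M.Vertex) : Finset H :=
  {h | M.origin h ∈ W ∨ M.origin (M.opp h) ∈ W}

variable (M) in
/-- The halves of the edges with both ends in a set of vertices. -/
noncomputable def halfEdgesInside (W : Finset M.Vertex) : Finset H :=
  {h | M.origin h ∈ W ∧ M.origin (M.opp h) ∈ W}

variable (M) in
/-- The faces incident to a set of vertices. -/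
noncomputable def facesTouching (W : Finset M.Vertex) : Finset M.Face :=
  {f | ∃ h, M.face h = f ∧ M.origin h ∈ W}

variable (M) in
/-- The faces all of whose vertices belong to a set of vertices. -/
noncomputable def facesInside (W : Finset M.Vertex) : Finset M.Face :=
  {f | ∀ h, M.face h = f → M.origin h ∈ W}

theorem mem_halfEdgesAt {W : Finset M.Vertex} {h : H} : h ∈ M.halfEdgesAt W ↔ M.origin h ∈ W := by
  simp [halfEdgesAt]

theorem mem_halfEdgesTouching {W : Finset M.Vertex} {h : H} :
    h ∈ M.halfEdgesTouching W ↔ M.origin h ∈ W ∨ M.origin (M.opp h) ∈ W := by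
  simp [halfEdgesTouching]

theorem mem_halfEdgesInside {W : Finset M.Vertex} {h : H} :
    h ∈ M.halfEdgesInside W ↔ M.origin h ∈ W ∧ M.origin (M.opp h) ∈ W := by
  simp [halfEdgesInside]

theorem mem_facesTouching {W : Finset M.Vertex} {f : M.Face} :
    f ∈ M.facesTouching W ↔ ∃ h, M.face h = f ∧ M.origin h ∈ W := by
  simp [facesTouching]

theorem mem_facesInside {W : Finset M.Vertex} {f : M.Face} :
    f ∈ M.facesInside W ↔ ∀ h, M.face h = f → M.origin h ∈ W := by
  simp [facesInside]

theorem face_mem_facesTouching {W : Finset M.Vertex} {h : H} (hh : h ∈ M.halfEdgesTouching W) :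
    M.face h ∈ M.facesTouching W := by
  rcases mem_halfEdgesTouching.mp hh with hh | hh
  · exact mem_facesTouching.mpr ⟨h, rfl, hh⟩
  · exact mem_facesTouching.mpr ⟨_, M.face_rot_opp h, by rwa [M.origin_rot]⟩

theorem face_notMem_facesInside {W : Finset M.Vertex} {h : H} (hh : h ∉ M.halfEdgesInside W) :
    M.face h ∉ M.facesInside W := fun hf => by
  have hright := mem_facesInside.mp hf _ (M.face_rot_opp h)
  rw [M.origin_rot] at hright
  exact hh (mem_halfEdgesInside.mpr ⟨mem_facesInside.mp hf h rfl, hright⟩)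

theorem opp_mem_halfEdgesTouching {W : Finset M.Vertex} {h : H} :
    M.opp h ∈ M.halfEdgesTouching W ↔ h ∈ M.halfEdgesTouching W := by
  rw [mem_halfEdgesTouching, mem_halfEdgesTouching, M.opp_opp, or_comm]

theorem opp_mem_halfEdgesInside {W : Finset M.Vertex} {h : H} :
    M.opp h ∈ M.halfEdgesInside W ↔ h ∈ M.halfEdgesInside W := by
  rw [mem_halfEdgesInside, mem_halfEdgesInside, M.opp_opp, and_comm]

theorem outer_notMem_facesTouching {W : Finset M.Vertex} (hin : ∀ w ∈ W, ¬ M.IsOuterVertex w) :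
    M.outer ∉ M.facesTouching W := fun hout => by
  obtain ⟨h, hf, hh⟩ := mem_facesTouching.mp hout
  exact hin _ hh (isOuterVertex_of_face hf)

theorem outer_notMem_facesInside {W : Finset M.Vertex} (hin : ∀ w ∈ W, ¬ M.IsOuterVertex w) :
    M.outer ∉ M.facesInside W := fun hout => by
  obtain ⟨h, hf⟩ := M.face_surjective M.outer
  exact hin _ (mem_facesInside.mp hout h hf) (isOuterVertex_of_face hf)

theorem ne_univ_of_forall_not_isOuterVertex {W : Finset M.Vertex}
    (hin : ∀ w ∈ W, ¬ M.IsOuterVertex w) : W ≠ Finset.univ := fun hW => by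
  obtain ⟨h, hf⟩ := M.face_surjective M.outer
  exact hin _ (hW ▸ Finset.mem_univ _) (isOuterVertex_of_face hf)

theorem card_halfEdgesTouching_add_card_halfEdgesInside (W : Finset M.Vertex) :
    #(M.halfEdgesTouching W) + #(M.halfEdgesInside W) = 2 * #(M.halfEdgesAt W) := by
  have himage : ∀ h, h ∈ (M.halfEdgesAt W).map M.opp.toEmbedding ↔ M.origin (M.opp h) ∈ W := by
    intro h
    rw [Finset.mem_map_equiv, (Equiv.symm_apply_eq M.opp).mpr (M.opp_opp h).symm, mem_halfEdgesAt]
  have hunion : M.halfEdgesTouching W =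
      M.halfEdgesAt W ∪ (M.halfEdgesAt W).map M.opp.toEmbedding := by
    ext h
    rw [Finset.mem_union, himage, mem_halfEdgesTouching, mem_halfEdgesAt]
  have hinter : M.halfEdgesInside W =
      M.halfEdgesAt W ∩ (M.halfEdgesAt W).map M.opp.toEmbedding := by
    ext h
    rw [Finset.mem_inter, himage, mem_halfEdgesInside, mem_halfEdgesAt]
  rw [hunion, hinter, Finset.card_union_add_card_inter, Finset.card_map, two_mul]

theorem even_card_halfEdgesTouching (W : Finset M.Vertex) : Even #(M.halfEdgesTouching W) := by
  have hhalf := M.card_eq_two_mul_card_inter_chosen (S := (M.halfEdgesTouching W : Set H))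
    fun _ => opp_mem_halfEdgesTouching.mpr
  simp only [Finset.mem_coe, Finset.filter_univ_mem] at hhalf
  rw [hhalf]
  exact even_two_mul _

theorem Separated.card_halfEdgesTouching_union {W₁ W₂ : Finset M.Vertex}
    (hsep : M.Separated W₁ W₂) : #(M.halfEdgesTouching (W₁ ∪ W₂)) =
      #(M.halfEdgesTouching W₁) + #(M.halfEdgesTouching W₂) := by
  rw [← Finset.card_union_of_disjoint]
  · congr 1
    ext h
    simp only [mem_halfEdgesTouching, Finset.mem_union]
    tauto
  · rw [Finset.disjoint_left]
    intro h hh₁ hh₂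
    rcases mem_halfEdgesTouching.mp hh₁ with hh₁ | hh₁ <;>
      rcases mem_halfEdgesTouching.mp hh₂ with hh₂ | hh₂
    · exact Finset.disjoint_left.mp hsep.disjoint hh₁ hh₂
    · exact hsep.no_edge h hh₁ hh₂
    · exact hsep.symm.no_edge h hh₂ hh₁
    · exact Finset.disjoint_left.mp hsep.disjoint hh₁ hh₂

theorem Separated.card_halfEdgesAt_union {W₁ W₂ : Finset M.Vertex} (hsep : M.Separated W₁ W₂) :
    #(M.halfEdgesAt (W₁ ∪ W₂)) = #(M.halfEdgesAt W₁) + #(M.halfEdgesAt W₂) := by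
  rw [halfEdgesAt, halfEdgesAt, halfEdgesAt, ← Finset.card_union_of_disjoint]
  · rw [← Finset.filter_or]
    simp only [Finset.mem_union]
  · exact Finset.disjoint_filter.mpr fun h _ hh => Finset.disjoint_left.mp hsep.disjoint hh

theorem Separated.card_facesInside_union_le {W₁ W₂ : Finset M.Vertex}
    (hsep : M.Separated W₁ W₂) :
    #(M.facesInside (W₁ ∪ W₂)) ≤ #(M.facesInside W₁) + #(M.facesInside W₂) := by
  refine (Finset.card_le_card fun f hf => ?_).trans (Finset.card_union_le _ _)
  rw [Finset.mem_union, mem_facesInside, mem_facesInside]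
  exact hsep.forall_mem_or_forall_mem (mem_facesInside.mp hf)

end VertexSets

section VertexConnected

variable {H : Type*} [Fintype H] {M : PlanarMap H} {W : Finset M.Vertex}

theorem VertexConnected.eq_zero_of_touching (hW : M.VertexConnected W) {q : M.Face → ℚ}
    (hq : ∀ h ∈ M.halfEdgesTouching W, q (M.face (M.opp h)) = q (M.face h)) {h₀ : H}
    (hh₀ : M.origin h₀ ∈ W) (hq₀ : q (M.face h₀) = 0) {f : M.Face} (hf : f ∈ M.facesTouching W) :
    q f = 0 := by
  have hturn : ∀ h k, M.origin k = M.origin h → M.origin h ∈ W → q (M.face h) = 0 →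
      q (M.face k) = 0 := by
    intro h k hk hh hqh
    by_contra hqk
    obtain ⟨c, hc, hqc, hqc'⟩ := M.exists_rot_step (P := fun h => q (M.face h) = 0) hk.symm hqh hqk
    refine hqc' ?_
    rw [M.face_rot, hq c (mem_halfEdgesTouching.mpr (Or.inl (hc ▸ hh))), hqc]
  obtain ⟨k, rfl, hk⟩ := mem_facesTouching.mp hf
  refine hW.forall_of_step (P := fun w => ∀ h, M.origin h = w → q (M.face h) = 0) hh₀
    (fun h hh => hturn h₀ h hh hh₀ hq₀) (fun h hh hh' hqh l hl => ?_) _ hk k rfl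
  refine hturn (M.opp h) l hl hh' ?_
  rw [hq h (mem_halfEdgesTouching.mpr (Or.inl hh)), hqh h rfl]

theorem VertexConnected.card_add_card_facesTouching_le (hW : M.VertexConnected W)
    (hne : W.Nonempty) (huniv : W ≠ Finset.univ) :
    2 * (#W + #(M.facesTouching W)) ≤ #(M.halfEdgesTouching W) + 2 := by
  obtain ⟨w₀, hw₀⟩ := hne
  obtain ⟨h₀, rfl⟩ := M.origin_surjective w₀
  obtain ⟨v, hv⟩ : ∃ v, v ∉ W := by simpa [Finset.eq_univ_iff_forall] using huniv
  have hoff : ∀ h ∉ M.halfEdgesTouching W, M.origin h ∉ W ∧ M.origin (M.opp h) ∉ W :=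
    fun h hh => not_or.mp fun hor => hh (mem_halfEdgesTouching.mpr hor)
  refine card_add_card_le_of_differences (fun _ => opp_mem_halfEdgesTouching.mpr)
    (fun h hh => Or.inl (hoff h hh))
    ((LinearMap.proj (M.face h₀)).comp (LinearMap.snd ℚ (M.Vertex → ℚ) (M.Face → ℚ))) ?_
  intro x hvertex hface hx hx₀
  have hconst : ∀ h, x.1 (M.origin (M.opp h)) = x.1 (M.origin h) := by
    intro h
    by_cases hh : h ∈ M.halfEdgesTouching W
    · exact (hx h hh).1
    · rw [hvertex _ (hoff h hh).1, hvertex _ (hoff h hh).2]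
  refine Prod.ext (funext fun u => (M.vertex_const x.1 hconst u v).trans (hvertex v hv))
    (funext fun f => ?_)
  by_cases hf : f ∈ M.facesTouching W
  · exact hW.eq_zero_of_touching (fun h hh => (hx h hh).2) hw₀ hx₀ hf
  · exact hface f hf

theorem VertexConnected.card_add_card_facesInside_le (hW : M.VertexConnected W)
    (hne : W.Nonempty) (hout : M.outer ∉ M.facesInside W) :
    2 * (#W + #(M.facesInside W)) ≤ #(M.halfEdgesInside W) + 2 := by
  obtain ⟨w₀, hw₀⟩ := hne
  have hoff : ∀ h ∉ M.halfEdgesInside W, M.face h ∉ M.facesInside W ∧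
      M.face (M.opp h) ∉ M.facesInside W := fun h hh =>
    ⟨face_notMem_facesInside hh, face_notMem_facesInside fun hopp =>
      hh (opp_mem_halfEdgesInside.mp hopp)⟩
  refine card_add_card_le_of_differences (fun _ => opp_mem_halfEdgesInside.mpr)
    (fun h hh => Or.inr (hoff h hh))
    ((LinearMap.proj w₀).comp (LinearMap.fst ℚ (M.Vertex → ℚ) (M.Face → ℚ))) ?_
  intro x hvertex hface hx hx₀
  have hconst : ∀ h, x.2 (M.face (M.opp h)) = x.2 (M.face h) := by
    intro h
    by_cases hh : h ∈ M.halfEdgesInside W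
    · exact (hx h hh).2
    · rw [hface _ (hoff h hh).1, hface _ (hoff h hh).2]
  refine Prod.ext (funext fun v => ?_)
    (funext fun f => (M.face_const x.2 hconst f M.outer).trans (hface _ hout))
  by_cases hv : v ∈ W
  · refine hW.forall_of_step (P := fun w => x.1 w = 0) hw₀ hx₀ (fun h hh hh' hxh => ?_) v hv
    rw [(hx h (mem_halfEdgesInside.mpr ⟨hh, hh'⟩)).1, hxh]
  · exact hvertex v hv

end VertexConnected

section SparseSets

variable {H : Type*} [Fintype H] {M : PlanarMap H} {W : Finset M.Vertex}

theorem halfEdgesTouching_nonempty (hne : W.Nonempty) : (M.halfEdgesTouching W).Nonempty := by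
  obtain ⟨w, hw⟩ := hne
  obtain ⟨h, rfl⟩ := M.origin_surjective w
  exact ⟨h, mem_halfEdgesTouching.mpr (Or.inl hw)⟩

theorem card_halfEdgesTouching_add_card_cut_le (hD : M.IsHexagonDissection)
    (hout : M.outer ∉ M.facesTouching W) :
    #(M.halfEdgesTouching W) + #(M.cut (M.facesTouching W : Set M.Face)) ≤
      4 * #(M.facesTouching W) := by
  have hsides := hD.card_face_mem (M.facesTouching W)
  rw [if_neg hout, add_zero] at hsides
  rw [← hsides, ← Finset.card_union_of_disjoint]
  · refine Finset.card_le_card fun h hh => (Finset.mem_filter_univ h).mpr ?_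
    rcases Finset.mem_union.mp hh with hh | hh
    · exact face_mem_facesTouching hh
    · exact (mem_cut.mp hh).1
  · exact Finset.disjoint_left.mpr fun h hh hcut =>
      (mem_cut.mp hcut).2 (face_mem_facesTouching (opp_mem_halfEdgesTouching.mpr hh))

theorem five_le_card_cut_facesTouching (hD : M.IsHexagonDissection) (hI : M.IsIrreducible)
    (hne : W.Nonempty) (hout : M.outer ∉ M.facesTouching W) :
    5 ≤ #(M.cut (M.facesTouching W : Set M.Face)) := by
  by_contra! hcut
  obtain ⟨h, hh⟩ := halfEdgesTouching_nonempty hne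
  have hone : #(M.facesTouching W) ≤ 1 := Finset.card_le_one_iff_subsingleton.mpr
    (subsingleton_of_card_cut_le_four hD hI hout (Nat.le_of_lt_succ hcut))
  have hthree := two_lt_card_cut hD hI ⟨_, face_mem_facesTouching hh⟩ hout
  have htouching : 1 < #(M.halfEdgesTouching W) := Finset.one_lt_card.mpr
    ⟨h, hh, M.opp h, opp_mem_halfEdgesTouching.mpr hh, (M.opp_ne h).symm⟩
  have hsides := card_halfEdgesTouching_add_card_cut_le hD hout
  omega

theorem VertexConnected.four_mul_card_add_two_le (hD : M.IsHexagonDissection)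
    (hI : M.IsIrreducible) (hW : M.VertexConnected W) (hne : W.Nonempty)
    (hin : ∀ w ∈ W, ¬ M.IsOuterVertex w) : 4 * #W + 2 ≤ #(M.halfEdgesTouching W) := by
  have hout := outer_notMem_facesTouching hin
  have hdim := hW.card_add_card_facesTouching_le hne (ne_univ_of_forall_not_isOuterVertex hin)
  have hsides := card_halfEdgesTouching_add_card_cut_le hD hout
  have hcut := five_le_card_cut_facesTouching hD hI hne hout
  obtain ⟨m, hm⟩ := even_card_halfEdgesTouching W
  omega

theorem four_mul_card_le_card_halfEdgesTouching (hD : M.IsHexagonDissection)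
    (hI : M.IsIrreducible) (hin : ∀ w ∈ W, ¬ M.IsOuterVertex w) :
    4 * #W ≤ #(M.halfEdgesTouching W) := by
  induction W using induction_on_separated with
  | hempty => simp
  | hconnected W hne hW => exact le_of_add_le_left (hW.four_mul_card_add_two_le hD hI hne hin)
  | hunion W₁ W₂ _ _ hsep ih₁ ih₂ =>
    rw [hsep.card_halfEdgesTouching_union, Finset.card_union_of_disjoint hsep.disjoint, mul_add]
    exact add_le_add (ih₁ fun w hw => hin w (Finset.mem_union_left _ hw))
      (ih₂ fun w hw => hin w (Finset.mem_union_right _ hw))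

theorem three_mul_card_add_card_facesInside_le (hD : M.IsHexagonDissection)
    (hI : M.IsIrreducible) (hin : ∀ w ∈ W, ¬ M.IsOuterVertex w) :
    3 * #W + #(M.facesInside W) ≤ #(M.halfEdgesAt W) := by
  induction W using induction_on_separated with
  | hempty =>
    have hfaces : M.facesInside ∅ = ∅ := Finset.eq_empty_iff_forall_notMem.mpr fun f hf => by
      obtain ⟨h, hh⟩ := M.face_surjective f
      exact Finset.notMem_empty _ (mem_facesInside.mp hf h hh)
    simp [hfaces]
  | hconnected W hne hW =>
    have htouching := hW.four_mul_card_add_two_le hD hI hne hin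
    have hinside := hW.card_add_card_facesInside_le hne (outer_notMem_facesInside hin)
    have hsum := card_halfEdgesTouching_add_card_halfEdgesInside W
    omega
  | hunion W₁ W₂ _ _ hsep ih₁ ih₂ =>
    have hW₁ := ih₁ fun w hw => hin w (Finset.mem_union_left _ hw)
    have hW₂ := ih₂ fun w hw => hin w (Finset.mem_union_right _ hw)
    have hfaces := hsep.card_facesInside_union_le
    rw [hsep.card_halfEdgesAt_union, Finset.card_union_of_disjoint hsep.disjoint]
    omega

theorem VertexConnected.four_mul_card_le_card_halfEdgesTouching_add_six
    (hD : M.IsHexagonDissection) (hW : M.VertexConnected W) (hne : W.Nonempty)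
    (huniv : W ≠ Finset.univ) : 4 * #W ≤ #(M.halfEdgesTouching W) + 6 := by
  have hdim := hW.card_add_card_facesTouching_le hne huniv
  have hsides := hD.card_face_mem (M.facesTouching W)
  have htouching : #(M.halfEdgesTouching W) ≤ #{h | M.face h ∈ M.facesTouching W} :=
    Finset.card_le_card fun h hh => (Finset.mem_filter_univ h).mpr (face_mem_facesTouching hh)
  split_ifs at hsides <;> omega

omit [Fintype H] in
theorem Separated.outer_subset_or_outer_subset {W₁ W₂ : Finset M.Vertex}
    (hsep : M.Separated W₁ W₂) (hout : ∀ w, M.IsOuterVertex w → w ∈ W₁ ∪ W₂) :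
    (∀ w, M.IsOuterVertex w → w ∈ W₁) ∨ ∀ w, M.IsOuterVertex w → w ∈ W₂ := by
  refine (hsep.forall_mem_or_forall_mem fun h hh => hout _ (isOuterVertex_of_face hh)).imp ?_ ?_ <;>
  · rintro hall w ⟨h, rfl, hh⟩
    exact hall h hh

theorem four_mul_card_le_card_halfEdgesTouching_add_six (hD : M.IsHexagonDissection)
    (hI : M.IsIrreducible) (huniv : W ≠ Finset.univ) (hout : ∀ w, M.IsOuterVertex w → w ∈ W) :
    4 * #W ≤ #(M.halfEdgesTouching W) + 6 := by
  induction W using induction_on_separated with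
  | hempty => simp
  | hconnected W hne hW =>
    exact hW.four_mul_card_le_card_halfEdgesTouching_add_six hD hne huniv
  | hunion W₁ W₂ hne₁ hne₂ hsep ih₁ ih₂ =>
    have hne_univ : ∀ {U₁ U₂ : Finset M.Vertex}, U₂.Nonempty → Disjoint U₁ U₂ →
        U₁ ≠ Finset.univ := by
      rintro U₁ U₂ ⟨u, hu⟩ hdisj rfl
      exact Finset.disjoint_left.mp hdisj (Finset.mem_univ u) hu
    rw [hsep.card_halfEdgesTouching_union, Finset.card_union_of_disjoint hsep.disjoint]
    rcases hsep.outer_subset_or_outer_subset hout with hout₁ | hout₂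
    · have hW₁ := ih₁ (hne_univ hne₂ hsep.disjoint) hout₁
      have hW₂ := four_mul_card_le_card_halfEdgesTouching hD hI fun w hw ho =>
        Finset.disjoint_left.mp hsep.disjoint (hout₁ w ho) hw
      omega
    · have hW₂ := ih₂ (hne_univ hne₁ hsep.disjoint.symm) hout₂
      have hW₁ := four_mul_card_le_card_halfEdgesTouching hD hI fun w hw ho =>
        Finset.disjoint_left.mp hsep.disjoint hw (hout₂ w ho)
      omega

theorem card_halfEdgesInside_add_four_le (hD : M.IsHexagonDissection) (hI : M.IsIrreducible)
    (hne : W.Nonempty) (hin : ∀ w ∈ W, ¬ M.IsOuterVertex w) :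
    #(M.halfEdgesInside W) + 4 ≤ 4 * #W := by
  have htouching := four_mul_card_le_card_halfEdgesTouching_add_six hD hI (W := Wᶜ)
    (fun hW => hne.ne_empty (Finset.compl_eq_univ_iff W |>.mp hW))
    fun w ho => Finset.mem_compl.mpr fun hw => hin w hw ho
  have hcompl : M.halfEdgesInside W = (M.halfEdgesTouching Wᶜ)ᶜ := by
    ext h
    simp only [mem_halfEdgesInside, Finset.mem_compl, mem_halfEdgesTouching, not_or, not_not]
  have hedges := Finset.card_add_card_compl (M.halfEdgesTouching Wᶜ)
  rw [← hcompl, hD.card_halfEdge] at hedges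
  have hvertices := Finset.card_add_card_compl W
  rw [hD.card_vertex] at hvertices
  omega

end SparseSets

section ExistsBalanced

variable {H : Type*} [Fintype H] {M : PlanarMap H}

variable (M) in
/-- A set of half-edges, considered as the outward ones, that contains three half-edges at each
inner vertex, none at the outer vertices, and all but one of the inner half-edges that have a given
inner face on their right. -/
structure Balanced (S : Set H) : Prop where
  not_outer : ∀ h ∈ S, ¬ M.IsOuterVertex (M.origin h)
  vertex : ∀ v, ¬ M.IsOuterVertex v → #{h | M.origin h = v ∧ h ∈ S} = 3
  face : ∀ f, f ≠ M.outer → ∃! h, M.face h = f ∧ M.IsInner h ∧ h ∉ S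

variable (M) in
/-- The number of inward half-edges at a vertex in a balanced set. -/
noncomputable def demand (v : M.Vertex) : ℕ :=
  #{h | M.origin h = v ∧ M.IsInner h} - if M.IsOuterVertex v then 0 else 3

theorem filter_origin_isInner_of_not_isOuterVertex {v : M.Vertex} (hv : ¬ M.IsOuterVertex v) :
    ({h | M.origin h = v ∧ M.IsInner h} : Finset H) = ({h | M.origin h = v} : Finset H) :=
  Finset.filter_congr fun _ _ =>
    and_iff_left_of_imp fun hh => isInner_of_not_isOuterVertex (hh.symm ▸ hv)

theorem demand_add (hD : M.IsHexagonDissection) (hI : M.IsIrreducible) (v : M.Vertex) :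
    M.demand v + (if M.IsOuterVertex v then 0 else 3) = #{h | M.origin h = v ∧ M.IsInner h} := by
  refine Nat.sub_add_cancel ?_
  split_ifs with hv
  · exact Nat.zero_le _
  · have hdegree := three_mul_card_add_card_facesInside_le hD hI (W := {v}) (by simpa using hv)
    rw [Finset.card_singleton, halfEdgesAt] at hdegree
    simp only [Finset.mem_singleton] at hdegree
    rw [filter_origin_isInner_of_not_isOuterVertex hv]
    omega

theorem sum_demand (hD : M.IsHexagonDissection) (hI : M.IsIrreducible) :
    ∑ v, M.demand v + 1 = Fintype.card M.Face := by
  have hinner : ∑ v, #{h | M.origin h = v ∧ M.IsInner h} = #{h | M.IsInner h} := by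
    rw [Finset.card_eq_sum_card_fiberwise (f := M.origin) fun _ _ => Finset.mem_univ _]
    simp only [Finset.filter_filter, and_comm]
  simp only [← demand_add hD hI, Finset.sum_add_distrib] at hinner
  have hcard := hD.card_isInner_add_one
  omega

theorem card_le_sum_demand_of_isOuterVertex {s : Finset M.Face} {W : Finset M.Vertex}
    (hout : ∀ w ∈ W, M.IsOuterVertex w)
    (hs : ∀ f ∈ s, ∃ h, M.face h = f ∧ M.IsInner h ∧ M.origin h ∈ W) :
    #s ≤ ∑ v ∈ W, M.demand v := by
  have hsum : ∑ v ∈ W, M.demand v = #{h | M.IsInner h ∧ M.origin h ∈ W} := by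
    rw [← Finset.filter_filter, ← Finset.sum_card_fiberwise_eq_card_filter]
    refine Finset.sum_congr rfl fun v hv => ?_
    rw [demand, if_pos (hout v hv), Nat.sub_zero, Finset.filter_filter]
    simp only [and_comm]
  rw [hsum]
  refine (Finset.card_le_card fun f hf => ?_).trans (Finset.card_image_le (f := M.face))
  obtain ⟨h, hface, hh⟩ := hs f hf
  exact Finset.mem_image.mpr ⟨h, (Finset.mem_filter_univ h).mpr hh, hface⟩

theorem card_facesInside_le_sum_demand (hD : M.IsHexagonDissection) (hI : M.IsIrreducible)
    {W : Finset M.Vertex} (hin : ∀ w ∈ W, ¬ M.IsOuterVertex w) :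
    #(M.facesInside W) ≤ ∑ v ∈ W, M.demand v := by
  have hsum : ∑ v ∈ W, M.demand v + 3 * #W = #(M.halfEdgesAt W) := by
    rw [halfEdgesAt, ← Finset.sum_card_fiberwise_eq_card_filter, mul_comm, ← smul_eq_mul,
      ← Finset.sum_const, ← Finset.sum_add_distrib]
    refine Finset.sum_congr rfl fun v hv => ?_
    have hdemand := demand_add hD hI v
    rwa [if_neg (hin v hv), filter_origin_isInner_of_not_isOuterVertex (hin v hv)] at hdemand
  have hfaces := three_mul_card_add_card_facesInside_le hD hI hin
  omega

theorem card_le_sum_demand (hD : M.IsHexagonDissection) (hI : M.IsIrreducible)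
    {s : Finset M.Face} (hs : M.outer ∉ s) :
    #s ≤ ∑ v with ∃ h, M.face h ∈ s ∧ M.IsInner h ∧ M.origin h = v, M.demand v := by
  rw [← Finset.sum_filter_add_sum_filter_not _ M.IsOuterVertex,
    ← Finset.card_filter_add_card_filter_not (s := s)
      fun f => ∃ h, M.face h = f ∧ M.IsInner h ∧ M.IsOuterVertex (M.origin h)]
  refine add_le_add (card_le_sum_demand_of_isOuterVertex (by simp) fun f hf => ?_)
    (le_trans (Finset.card_le_card fun f hf => ?_)
      (card_facesInside_le_sum_demand hD hI (by simp)))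
  · obtain ⟨hfs, h, rfl, hin, hout⟩ := Finset.mem_filter.mp hf
    exact ⟨h, rfl, hin, by simpa [hout] using ⟨h, hfs, hin, rfl⟩⟩
  · obtain ⟨hfs, hf⟩ := Finset.mem_filter.mp hf
    refine mem_facesInside.mpr ?_
    rintro h rfl
    have hout : ¬ M.IsOuterVertex (M.origin h) := fun hout =>
      hf (exists_isInner_of_isOuterVertex hD (fun hf => hs (hf ▸ hfs)) hout)
    simpa [hout] using ⟨h, hfs, isInner_of_not_isOuterVertex hout, rfl⟩

theorem exists_choice_with_demand (hD : M.IsHexagonDissection) (hI : M.IsIrreducible) :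
    ∃ z : {f : M.Face // f ≠ M.outer} → H, (∀ f, M.face (z f) = f) ∧ (∀ f, M.IsInner (z f)) ∧
      ∀ v, #{f | M.origin (z f) = v} = M.demand v := by
  obtain ⟨w, hw, hle⟩ := exists_choice_of_card_le_sum
    (fun (f : {f : M.Face // f ≠ M.outer}) v => ∃ h, M.face h = f ∧ M.IsInner h ∧ M.origin h = v)
    M.demand fun s => by
      rw [← Finset.card_map (Function.Embedding.subtype _)]
      refine (card_le_sum_demand hD hI (by simp)).trans (le_of_eq ?_)
      congr! 3
      simp only [Finset.mem_map, Function.Embedding.subtype_apply]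
      grind
  choose z hface hin horigin using hw
  obtain rfl : w = fun f => M.origin (z f) := funext fun f => (horigin f).symm
  replace hle : ∀ v, #{f | M.origin (z f) = v} ≤ M.demand v := fun v => by convert hle v
  refine ⟨z, hface, hin, fun v =>
    (Finset.sum_eq_sum_iff_of_le fun v _ => hle v).mp ?_ v (Finset.mem_univ v)⟩
  rw [← Finset.card_eq_sum_card_fiberwise fun _ _ => Finset.mem_univ _, Finset.card_univ,
    Fintype.card_subtype_compl, Fintype.card_subtype_eq]
  exact (Nat.eq_sub_of_add_eq (sum_demand hD hI)).symm

theorem exists_balanced (hD : M.IsHexagonDissection) (hI : M.IsIrreducible) :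
    ∃ S, M.Balanced S := by
  obtain ⟨z, hface, hin, hdemand⟩ := exists_choice_with_demand hD hI
  have hcard : ∀ v, #{h | (M.origin h = v ∧ M.IsInner h) ∧ h ∈ Set.range z} = M.demand v := by
    intro v
    have hinj : Function.Injective z := fun f f' hff' =>
      Subtype.ext (by rw [← hface, ← hface, hff'])
    rw [← hdemand v, ← Finset.card_image_of_injective _ hinj]
    congr 1
    ext h
    simp only [Finset.mem_filter_univ, Finset.mem_image, Set.mem_range]
    grind
  have hnot : ∀ v, #{h | (M.origin h = v ∧ M.IsInner h) ∧ h ∉ Set.range z} =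
      if M.IsOuterVertex v then 0 else 3 := by
    intro v
    have hsplit := Finset.card_filter_add_card_filter_not
      (s := {h | M.origin h = v ∧ M.IsInner h}) (· ∈ Set.range z)
    rw [Finset.filter_filter, Finset.filter_filter, hcard, ← demand_add hD hI] at hsplit
    exact Nat.add_left_cancel hsplit
  have houter : ∀ h, M.IsInner h → h ∉ Set.range z → ¬ M.IsOuterVertex (M.origin h) := by
    intro h hh hz hout
    have hzero := hnot (M.origin h)
    rw [if_pos hout, Finset.card_eq_zero, Finset.filter_eq_empty_iff] at hzero
    exact hzero (Finset.mem_univ h) ⟨⟨rfl, hh⟩, hz⟩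
  refine ⟨{h | M.IsInner h ∧ h ∉ Set.range z}, fun h hh => houter h hh.1 hh.2,
    fun v hv => ?_, fun f hf => ⟨z ⟨f, hf⟩, ?_⟩⟩
  · rw [← if_neg (c := M.IsOuterVertex v) (t := 0) (e := 3) hv, ← hnot v]
    simp only [Set.mem_ofPred_eq, and_assoc]
  · simp only [Set.mem_ofPred_eq, Set.mem_range]
    grind

end ExistsBalanced

section Potentials

variable {H : Type*} [Fintype H] {M : PlanarMap H} {S S' S'' : Set H} {p q : H → ℚ}

theorem fiberSum_ind {V : Type*} (o : H → V) (S : Set H) (v : V)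
    [DecidablePred fun h => o h = v ∧ h ∈ S] :
    fiberSum o (ind S) v = #{h | o h = v ∧ h ∈ S} := by
  simp only [fiberSum, ind, Finset.sum_boole, Finset.filter_filter]
  congr!

theorem card_face_notMem_add_card_face_mem (hS : ∀ h ∈ S, ¬ M.IsOuterVertex (M.origin h))
    (f : M.Face) : #{h | M.face h = f ∧ M.IsInner h ∧ h ∉ S} + #{h | M.face h = f ∧ h ∈ S} =
      #{h | M.face h = f ∧ M.IsInner h} := by
  rw [← Finset.card_filter_add_card_filter_not (s := {h | M.face h = f ∧ M.IsInner h}) (· ∉ S),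
    Finset.filter_filter, Finset.filter_filter]
  congr! 2
  · simp only [and_assoc]
  · refine Finset.filter_congr fun h _ => ?_
    rw [not_not, and_assoc]
    exact and_congr_right fun _ =>
      (and_iff_right_of_imp fun hh => isInner_of_not_isOuterVertex (hS h hh)).symm

theorem Balanced.card_origin (hS : M.Balanced S) (v : M.Vertex) :
    #{h | M.origin h = v ∧ h ∈ S} = if M.IsOuterVertex v then 0 else 3 := by
  split_ifs with hv
  · refine Finset.card_eq_zero.mpr (Finset.filter_eq_empty_iff.mpr ?_)
    rintro h - ⟨rfl, hh⟩
    exact hS.not_outer h hh hv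
  · exact hS.vertex v hv

theorem Balanced.card_face (hS : M.Balanced S) (f : M.Face) :
    #{h | M.face h = f ∧ h ∈ S} + (if f = M.outer then 0 else 1) =
      #{h | M.face h = f ∧ M.IsInner h} := by
  rw [← card_face_notMem_add_card_face_mem hS.not_outer, add_comm]
  congr 1
  split_ifs with hf
  · refine (Finset.card_eq_zero.mpr (Finset.filter_eq_empty_iff.mpr ?_)).symm
    rintro h - ⟨rfl, hh, -⟩
    exact hh.1 hf
  · exact ((Fintype.existsUnique_iff_card_one _).mp (hS.face f hf)).symm

theorem Balanced.of_fiberSum_eq (hS : M.Balanced S)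
    (hS' : ∀ h ∈ S', ¬ M.IsOuterVertex (M.origin h))
    (hvertex : ∀ v, fiberSum M.origin (ind S') v = fiberSum M.origin (ind S) v)
    (hface : ∀ f, fiberSum M.face (ind S') f = fiberSum M.face (ind S) f) : M.Balanced S' where
  not_outer := hS'
  vertex v hv := by
    have hsum := hvertex v
    rw [fiberSum_ind, fiberSum_ind, Nat.cast_inj] at hsum
    rw [hsum, hS.vertex v hv]
  face f hf := by
    have hsum := hface f
    rw [fiberSum_ind, fiberSum_ind, Nat.cast_inj] at hsum
    have hcard := hS.card_face f
    rw [if_neg hf, ← card_face_notMem_add_card_face_mem hS', hsum, add_comm] at hcard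
    exact (Fintype.existsUnique_iff_card_one _).mpr (Nat.add_right_cancel hcard).symm

variable (M) in
/-- A function on edges that vanishes around the outer vertices, and whose variation when one turns
around a vertex is the difference between two sets of half-edges. -/
structure IsPotential (S S' : Set H) (p : H → ℚ) : Prop where
  opp : ∀ h, p (M.opp h) = p h
  outer : ∀ h, M.IsOuterVertex (M.origin h) → p h = 0
  gradient : ∀ h, ind S h - ind S' h = p h - p (M.rot.symm h)

omit [Fintype H] in
theorem eq_of_isOuterVertex (hp : ∀ h, p (M.opp h) = p h)
    (hrot : ∀ h, M.IsOuterVertex (M.origin h) → p (M.rot h) = p h) {h k : H}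
    (hh : M.IsOuterVertex (M.origin h)) (hk : M.IsOuterVertex (M.origin k)) : p h = p k := by
  have hvertex : ∀ a b, M.origin a = M.origin b → M.IsOuterVertex (M.origin a) → p b = p a := by
    intro a b hab ha
    by_contra hne
    obtain ⟨c, hca, hc, hcrot⟩ := M.exists_rot_step (P := fun h => p h = p a) hab rfl hne
    exact hcrot ((hrot c (hca ▸ ha)).trans hc)
  have hface : ∀ a b, M.face a = M.outer → M.face b = M.outer → p b = p a := by
    intro a b ha hb
    by_contra hne
    obtain ⟨c, hca, hc, hcrot⟩ := M.exists_face_step (P := fun h => p h = p a) (ha.trans hb.symm)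
      rfl hne
    refine hcrot ?_
    rw [hrot _ (isOuterVertex_of_face_opp (by rw [M.opp_opp, hca, ha])), hp]
    exact hc
  obtain ⟨a, hah, ha⟩ := hh
  obtain ⟨b, hbk, hb⟩ := hk
  rw [hvertex a h hah (isOuterVertex_of_face ha), hvertex b k hbk (isOuterVertex_of_face hb),
    hface b a hb ha]

theorem Balanced.exists_isPotential (hS : M.Balanced S) (hS' : M.Balanced S') :
    ∃ p, M.IsPotential S S' p := by
  obtain ⟨p, hopp, hp⟩ := M.exists_potential_of_sums_eq_zero (y := fun h => ind S h - ind S' h)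
    (fun v => by
      rw [fiberSum_sub, fiberSum_ind, fiberSum_ind, hS.card_origin, hS'.card_origin, sub_self])
    (fun f => by
      rw [fiberSum_sub, fiberSum_ind, fiberSum_ind, sub_eq_zero, Nat.cast_inj]
      exact Nat.add_right_cancel ((hS.card_face f).trans (hS'.card_face f).symm))
  have hrot : ∀ h, M.IsOuterVertex (M.origin h) → p (M.rot h) = p h := by
    intro h hh
    have hout : M.IsOuterVertex (M.origin (M.rot h)) := by rwa [M.origin_rot]
    have hgrad := hp (M.rot h)
    rw [ind_of_notMem fun hS₁ => hS.not_outer _ hS₁ hout, Equiv.symm_apply_apply,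
      ind_of_notMem fun hS₁ => hS'.not_outer _ hS₁ hout, sub_self] at hgrad
    exact sub_eq_zero.mp hgrad.symm
  obtain ⟨h₀, hh₀⟩ := M.face_surjective M.outer
  exact ⟨fun h => p h - p h₀, fun h => by rw [hopp], fun h hh => sub_eq_zero.mpr
    (eq_of_isOuterVertex hopp hrot hh (isOuterVertex_of_face hh₀)), fun h => by rw [hp]; ring⟩

omit [Fintype H] in
theorem IsPotential.neg (hp : M.IsPotential S S' p) : M.IsPotential S' S (-p) where
  opp h := neg_inj.mpr (hp.opp h)
  outer h hh := neg_eq_zero.mpr (hp.outer h hh)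
  gradient h := by
    simp only [Pi.neg_apply]
    linarith [hp.gradient h]

omit [Fintype H] in
theorem IsPotential.add (hp : M.IsPotential S S' p) (hq : M.IsPotential S' S'' q) :
    M.IsPotential S S'' (p + q) where
  opp h := congrArg₂ (· + ·) (hp.opp h) (hq.opp h)
  outer h hh := by rw [Pi.add_apply, hp.outer h hh, hq.outer h hh, add_zero]
  gradient h := by
    simp only [Pi.add_apply]
    linarith [hp.gradient h, hq.gradient h]

omit [Fintype H] in
theorem IsPotential.unique (hp : M.IsPotential S S' p) (hq : M.IsPotential S S' q) : p = q := by
  obtain ⟨h₀, hh₀⟩ := M.face_surjective M.outer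
  funext h
  have hconst := M.const_of_rot_of_opp (fun h => p h - q h) (fun h => by
    have hpgrad := hp.gradient (M.rot h)
    have hqgrad := hq.gradient (M.rot h)
    rw [Equiv.symm_apply_apply] at hpgrad hqgrad
    linarith) (fun h => by rw [hp.opp, hq.opp]) h h₀
  simp only [hp.outer h₀ (isOuterVertex_of_face hh₀), hq.outer h₀ (isOuterVertex_of_face hh₀),
    sub_self] at hconst
  exact sub_eq_zero.mp hconst

end Potentials

section ClockwiseEdgeSets

variable {H : Type*} {M : PlanarMap H} {S S' B : Set H} {p : H → ℚ}

variable (M) in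
/-- A set of edges, avoiding the outer vertices, whose boundary is directed clockwise: around each
vertex, one enters it along an inward half-edge and leaves it before an outward one. -/
structure IsClockwiseEdgeSet (S B : Set H) : Prop where
  nonempty : B.Nonempty
  opp_mem : ∀ h, M.opp h ∈ B ↔ h ∈ B
  not_outer : ∀ h ∈ B, ¬ M.IsOuterVertex (M.origin h)
  enter : ∀ h ∈ B, M.rot.symm h ∉ B → h ∉ S
  leave : ∀ h, h ∉ B → M.rot.symm h ∈ B → h ∈ S

theorem IsPotential.exists_isClockwiseEdgeSet (hp : M.IsPotential S S' p) {h : H} (hh : 0 < p h) :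
    ∃ B, M.IsClockwiseEdgeSet S' B := by
  have := M.finite
  have := M.nonempty
  obtain ⟨m, hm⟩ := Finite.exists_max p
  refine ⟨{h | p h = p m}, ⟨m, rfl⟩, fun h => ?_, fun k hk hout => ?_, fun k hk hrot hkS' => ?_,
    fun k hk hrot => ?_⟩
  · simp only [Set.mem_ofPred_eq, hp.opp]
  · exact (hh.trans_le (hm h)).ne' (hk.symm.trans (hp.outer k hout))
  · have hlt : p (M.rot.symm k) < p k := ((hm _).trans_eq hk.symm).lt_of_ne (hk ▸ hrot)
    linarith [hp.gradient k, ind_of_mem hkS', ind_le_one S k]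
  · by_contra hkS'
    have hlt : p k < p (M.rot.symm k) := ((hm k).lt_of_ne hk).trans_eq hrot.symm
    linarith [hp.gradient k, ind_of_notMem hkS', ind_nonneg S k]

theorem Balanced.exists_isClockwiseEdgeSet [Fintype H] (hS : M.Balanced S) (hS' : M.Balanced S')
    (hne : S ≠ S') :
    (∃ B, M.IsClockwiseEdgeSet S B) ∨ ∃ B, M.IsClockwiseEdgeSet S' B := by
  obtain ⟨p, hp⟩ := hS.exists_isPotential hS'
  obtain ⟨h, hh⟩ : ∃ h, p h ≠ 0 := by
    by_contra! hzero
    refine hne (ind_injective (funext fun h => sub_eq_zero.mp ?_))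
    rw [hp.gradient, hzero, hzero, sub_self]
  rcases hh.lt_or_gt with hneg | hpos
  · exact Or.inl (hp.neg.exists_isClockwiseEdgeSet (neg_pos.mpr hneg))
  · exact Or.inr (hp.exists_isClockwiseEdgeSet hpos)

variable (M) in
/-- The set of half-edges obtained from `S` by shifting counterclockwise, at the places where one
turns into or out of the set of edges `B`, the outward half-edges. -/
def push (S B : Set H) : Set H :=
  {h | (h ∈ S ∧ (M.rot.symm h ∈ B → h ∈ B)) ∨ (h ∈ B ∧ M.rot.symm h ∉ B)}

theorem IsClockwiseEdgeSet.isPotential_push (hB : M.IsClockwiseEdgeSet S B) :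
    M.IsPotential (M.push S B) S (ind B) where
  opp h := by simp only [ind, hB.opp_mem]
  outer h hh := ind_of_notMem fun hhB => hB.not_outer h hhB hh
  gradient h := by
    have henter := hB.enter h
    have hleave := hB.leave h
    by_cases hh : h ∈ B <;> by_cases hrot : M.rot.symm h ∈ B <;> by_cases hhS : h ∈ S <;>
      simp_all [ind, push]

theorem IsClockwiseEdgeSet.balanced_push [Fintype H] (hB : M.IsClockwiseEdgeSet S B)
    (hS : M.Balanced S) : M.Balanced (M.push S B) := by
  have hp := hB.isPotential_push
  have hind : ind (M.push S B) = fun h => ind S h + (ind B h - ind B (M.rot.symm h)) :=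
    funext fun h => by linarith [hp.gradient h]
  refine hS.of_fiberSum_eq (fun h hh => ?_) (fun v => ?_) (fun f => ?_)
  · exact hh.elim (fun hh => hS.not_outer h hh.1) (fun hh => hB.not_outer h hh.1)
  · rw [hind, fiberSum_add, fiberSum_sub,
      fiberSum_comp_perm M.origin M.rot.symm M.origin_rot_symm (ind B), sub_self, add_zero]
  · rw [hind, fiberSum_add, fiberSum_sub, M.fiberSum_face_rot_symm hp.opp, sub_self, add_zero]

theorem exists_balanced_without_isClockwiseEdgeSet [Fintype H] (hD : M.IsHexagonDissection)
    (hI : M.IsIrreducible) : ∃ S, M.Balanced S ∧ ∀ B, ¬ M.IsClockwiseEdgeSet S B := by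
  obtain ⟨S₀, hS₀⟩ := exists_balanced hD hI
  choose! p hp using fun S (hS : M.Balanced S) => hS.exists_isPotential hS₀
  obtain ⟨S, hS, hmax⟩ := Set.Finite.exists_maximalFor (fun S => ∑ h, p S h) {S | M.Balanced S}
    (Set.toFinite _) ⟨S₀, hS₀⟩
  refine ⟨S, hS, fun B hB => ?_⟩
  have hpush := hB.balanced_push hS
  have hadd : p (M.push S B) = ind B + p S :=
    (hp _ hpush).unique (hB.isPotential_push.add (hp S hS))
  obtain ⟨b, hb⟩ := hB.nonempty
  have hpos : 0 < ∑ h, ind B h := Finset.sum_pos' (fun h _ => ind_nonneg B h)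
    ⟨b, Finset.mem_univ b, by rw [ind_of_mem hb]; exact one_pos⟩
  have hlt : ∑ h, p S h < ∑ h, p (M.push S B) h := by
    simp only [hadd, Pi.add_apply, Finset.sum_add_distrib]
    exact lt_add_of_pos_left _ hpos
  exact hlt.not_ge (hmax hpush hlt.le)

end ClockwiseEdgeSets

section Cycles

theorem exists_isSimpleCycle_of_succ {H : Type*} {M : PlanarMap H} {C : Set H} (hne : C.Nonempty)
    (hopp : ∀ h ∈ C, M.opp h ∉ C) (hsucc : ∀ h ∈ C, ∃ k ∈ C, M.origin k = M.origin (M.opp h)) :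
    ∃ (n : ℕ) (_ : NeZero n) (c : Fin n → H), M.IsSimpleCycle c ∧ ∀ i, c i ∈ C := by
  have := M.finite
  have : Nonempty (M.origin '' C) := (hne.image _).to_subtype
  choose a haC ha using fun v : M.origin '' C => v.2
  let σ : M.origin '' C → M.origin '' C := fun v => ⟨M.origin (M.opp (a v)), hsucc _ (haC v)⟩
  obtain ⟨u, hu⟩ := exists_mem_periodicPts σ
  have : NeZero (Function.minimalPeriod σ u) :=
    ⟨(Function.minimalPeriod_pos_of_mem_periodicPts hu).ne'⟩
  refine ⟨Function.minimalPeriod σ u, inferInstance, fun i => a (σ^[i] u),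
    ⟨fun i => ?_, fun i j hij => ?_, fun i j hij => ?_⟩, fun i => haC _⟩
  · rw [ha, Fin.val_add, Fin.val_one', Nat.add_mod_mod, Function.iterate_mod_minimalPeriod_eq,
      Function.iterate_succ_apply']
  · simp only [ha] at hij
    exact Fin.ext (Function.iterate_injOn_Iio_minimalPeriod i.2 j.2 (Subtype.ext hij))
  · exact hopp _ (haC _) (hij ▸ haC _)

variable {H : Type*} {M : PlanarMap H} {n : ℕ} {c : Fin n → H} {φ : M.Face → ℚ}

theorem passes_nonneg (c : Fin n → H) (h : H) : 0 ≤ passes c h :=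
  Finset.sum_nonneg fun _ _ => ind_nonneg _ _

theorem IsWindingNumber.face_opp_le (hφ : M.IsWindingNumber c φ) {h : H}
    (hopp : M.opp h ∉ Set.range c) : φ (M.face (M.opp h)) ≤ φ (M.face h) := by
  have hgrad := hφ.gradient h
  rw [passes_eq_zero hopp, sub_zero] at hgrad
  exact sub_nonneg.mp (hgrad ▸ passes_nonneg c h)

theorem IsWindingNumber.eq_of_reflTransGen_adjacentOff (hφ : M.IsWindingNumber c φ)
    {f g : M.Face} (hfg : Relation.ReflTransGen (M.AdjacentOff c) f g) : φ g = φ f := by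
  induction hfg with
  | refl => rfl
  | tail _ hadj ih =>
    obtain ⟨h, hh, hopp, rfl, rfl⟩ := hadj
    rw [← hφ.eq_of_notMem_range hh hopp, ih]

theorem IsSimpleCycle.windingNumber_face [NeZero n] (hc : M.IsSimpleCycle c)
    (hφ : M.IsWindingNumber c φ) (i : Fin n) :
    φ (M.face (c i)) = φ (M.face (M.opp (c i))) + 1 := by
  have hgrad := hφ.gradient (c i)
  have hopp : M.opp (c i) ∉ Set.range c := fun ⟨j, hj⟩ => hc.edges_distinct i j hj
  rw [passes_of_injective hc.injective, ind_of_mem (Set.mem_range_self i),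
    passes_eq_zero hopp, sub_zero] at hgrad
  exact sub_eq_iff_eq_add'.mp hgrad

theorem IsSimpleCycle.exists_windingNumber_pos [NeZero n] (hc : M.IsSimpleCycle c)
    (hright : ∀ i, M.InInterior c (M.face (c i))) (hφ : M.IsWindingNumber c φ) :
    ∃ f, 0 < φ f := by
  obtain ⟨h, hh, hopp⟩ := M.exists_face_mem_face_opp_notMem
    (R := {f | Relation.ReflTransGen (M.AdjacentOff c) M.outer f}) (f := M.outer)
    (g := M.face (c 0)) Relation.ReflTransGen.refl (hright 0)
  have hrange : h ∉ Set.range c := by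
    rintro ⟨i, rfl⟩
    exact hright i hh
  by_cases hopprange : M.opp h ∈ Set.range c
  · obtain ⟨i, hi⟩ := hopprange
    refine ⟨M.face (c i), ?_⟩
    rw [hc.windingNumber_face hφ, hi, M.opp_opp, hφ.eq_of_reflTransGen_adjacentOff hh, hφ.outer]
    norm_num
  · exact absurd (Relation.ReflTransGen.tail hh ⟨h, hrange, hopprange, rfl, rfl⟩) hopp

end Cycles

section ClockwiseFaceSets

variable {H : Type*} [Fintype H] {M : PlanarMap H} {S B : Set H} {R : Set M.Face}

variable (M) in
/-- A nonempty set of bounded faces whose boundary, directed clockwise, consists of outward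
half-edges. -/
structure IsClockwiseFaceSet (S : Set H) (R : Set M.Face) : Prop where
  nonempty : R.Nonempty
  outer_notMem : M.outer ∉ R
  cut_subset : ∀ h ∈ M.cut R, h ∈ S

theorem Balanced.mem_of_face_eq (hS : M.Balanced S) (hD : M.IsHexagonDissection) {g h : H}
    (hg : g ∉ S) (hout : ¬ M.IsOuterVertex (M.origin g)) (hface : M.face h = M.face g)
    (hne : h ≠ g) : h ∈ S := by
  have hf : M.face g ≠ M.outer := fun hf => hout (isOuterVertex_of_face hf)
  have huniq : ∀ k, M.face k = M.face g → M.IsInner k → k ∉ S → k = g := fun k hk hin hkS =>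
    (hS.face _ hf).unique ⟨hk, hin, hkS⟩ ⟨rfl, isInner_of_not_isOuterVertex hout, hg⟩
  have hhout : ¬ M.IsOuterVertex (M.origin h) := by
    intro hh
    obtain ⟨k, hk, hin, hkout⟩ := exists_isInner_of_isOuterVertex hD (hface ▸ hf) hh
    exact hout (huniq k (hk.trans hface) hin (fun hkS => hS.not_outer k hkS hkout) ▸ hkout)
  by_contra hhS
  exact hne (huniq h hface (isInner_of_not_isOuterVertex hhout) hhS)

theorem IsClockwiseEdgeSet.isClockwiseFaceSet (hB : M.IsClockwiseEdgeSet S B)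
    (hD : M.IsHexagonDissection) (hS : M.Balanced S) : M.IsClockwiseFaceSet S (M.face '' B) := by
  refine ⟨hB.nonempty.image _, ?_, fun h hh => ?_⟩
  · rintro ⟨b, hb, hout⟩
    exact hB.not_outer b hb (isOuterVertex_of_face hout)
  · obtain ⟨⟨b, hb, hbh⟩, hopp⟩ := mem_cut.mp hh
    have hhB : h ∉ B := fun hhB => hopp ⟨_, (hB.opp_mem h).mpr hhB, rfl⟩
    obtain ⟨k, hkh, hkB, hrot⟩ := M.exists_face_step (P := (· ∉ B)) hbh.symm hhB (not_not.mpr hb)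
    rw [not_not] at hrot
    refine hS.mem_of_face_eq hD (hB.enter _ hrot ?_) (hB.not_outer _ hrot) ?_
      (ne_of_mem_of_not_mem hrot hhB).symm
    · rwa [Equiv.symm_apply_apply, hB.opp_mem]
    · rw [M.face_rot_opp, hkh]

theorem IsClockwiseFaceSet.union_neg {n : ℕ} {c : Fin n → H} {φ : M.Face → ℚ}
    (hR : M.IsClockwiseFaceSet S R) (hcut : ∀ i, c i ∈ M.cut R) (hφ : M.IsWindingNumber c φ) :
    M.IsClockwiseFaceSet S (R ∪ {f | φ f < 0}) := by
  refine ⟨hR.nonempty.mono Set.subset_union_left, ?_, fun h hh => ?_⟩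
  · rintro (hout | hout)
    · exact hR.outer_notMem hout
    · exact hout.ne hφ.outer
  · obtain ⟨hface, hopp⟩ := mem_cut.mp hh
    simp only [Set.mem_union, Set.mem_ofPred_eq, not_or, not_lt] at hface hopp
    refine hR.cut_subset h (mem_cut.mpr ⟨hface.resolve_right fun hneg => ?_, hopp.1⟩)
    have hrange : M.opp h ∉ Set.range c := by
      rintro ⟨i, hi⟩
      exact hopp.1 (hi ▸ (mem_cut.mp (hcut i)).1)
    exact ((hφ.face_opp_le hrange).trans_lt hneg).not_ge hopp.2

theorem IsClockwiseFaceSet.exists_isSimpleCycle (hR : M.IsClockwiseFaceSet S R) :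
    ∃ (n : ℕ) (_ : NeZero n) (c : Fin n → H), M.IsSimpleCycle c ∧
      (∀ i, M.InInterior c (M.face (c i))) ∧ ∀ i, c i ∈ S := by
  obtain ⟨P, hP, hmax⟩ := (Set.toFinite {P | M.IsClockwiseFaceSet S P}).exists_maximal ⟨R, hR⟩
  replace hP : M.IsClockwiseFaceSet S P := hP
  obtain ⟨n, hn, c, hc, hcut⟩ := exists_isSimpleCycle_of_succ (C := (↑(M.cut P) : Set H))
    (cut_nonempty hP.nonempty hP.outer_notMem) (fun _ => opp_notMem_cut) (fun _ => exists_cut_succ)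
  obtain ⟨φ, hφ⟩ := exists_isWindingNumber hc.chain
  refine ⟨n, hn, c, hc, fun i hreach => ?_, fun i => hP.cut_subset _ (hcut i)⟩
  have hneg : φ (M.face (M.opp (c i))) < 0 := by
    have hface := hc.windingNumber_face hφ i
    rw [hφ.eq_of_reflTransGen_adjacentOff hreach, hφ.outer] at hface
    linarith
  exact (mem_cut.mp (hcut i)).2 (hmax (hP.union_neg hcut hφ) Set.subset_union_left (Or.inr hneg))

theorem IsSimpleCycle.exists_isClockwiseFaceSet {n : ℕ} [NeZero n] {c : Fin n → H}
    (hc : M.IsSimpleCycle c) (hright : ∀ i, M.InInterior c (M.face (c i))) (hS : ∀ i, c i ∈ S) :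
    ∃ R, M.IsClockwiseFaceSet S R := by
  obtain ⟨φ, hφ⟩ := exists_isWindingNumber hc.chain
  refine ⟨{f | 0 < φ f}, hc.exists_windingNumber_pos hright hφ, hφ.outer.not_gt, fun h hh => ?_⟩
  obtain ⟨hpos, hopp⟩ := mem_cut.mp hh
  by_contra hhS
  refine hopp (lt_of_lt_of_le hpos ?_ : 0 < φ _)
  have hrange : M.opp (M.opp h) ∉ Set.range c := by
    rw [M.opp_opp]
    rintro ⟨i, rfl⟩
    exact hhS (hS i)
  have hle := hφ.face_opp_le hrange
  rwa [M.opp_opp] at hle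

end ClockwiseFaceSets

section Fill

variable {H : Type*} {M : PlanarMap H} {R : Set M.Face}

variable (M) in
/-- A set of faces together with the holes that it surrounds: the faces that cannot be reached from
the outer face without meeting `R`. -/
def fill (R : Set M.Face) : Set M.Face :=
  {f | ¬ Relation.ReflTransGen
    (fun f g => g ∉ R ∧ ∃ h, M.face h = f ∧ M.face (M.opp h) = g) M.outer f}

theorem outer_notMem_fill (R : Set M.Face) : M.outer ∉ M.fill R :=
  fun hout => hout Relation.ReflTransGen.refl

theorem subset_fill (hR : M.outer ∉ R) : R ⊆ M.fill R := by
  intro f hf hreach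
  cases hreach with
  | refl => exact hR hf
  | tail _ hstep => exact hstep.1 hf

theorem fill_mono {P : Set M.Face} (hPR : P ⊆ R) : M.fill P ⊆ M.fill R :=
  fun _ hf hreach => hf (Relation.ReflTransGen.mono
    (fun _ _ hstep => ⟨fun hP => hstep.1 (hPR hP), hstep.2⟩) _ _ hreach)

theorem fill_fill (R : Set M.Face) : M.fill (M.fill R) = M.fill R := by
  refine Set.Subset.antisymm (fun f hf hreach => hf ?_) (subset_fill (outer_notMem_fill R))
  clear hf
  induction hreach with
  | refl => exact Relation.ReflTransGen.refl
  | tail hreach hstep ih =>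
    exact ih.tail ⟨fun hfill => hfill (hreach.tail hstep), hstep.2⟩

theorem face_mem_of_mem_cut_fill [Fintype H] {h : H} (hh : h ∈ M.cut (M.fill R)) :
    M.face h ∈ R := by
  obtain ⟨hface, hopp⟩ := mem_cut.mp hh
  by_contra hfaceR
  exact hface ((not_not.mp hopp).tail ⟨hfaceR, M.opp h, rfl, by rw [M.opp_opp]⟩)

end Fill

section MinimalFaceSets

variable {H : Type*} [Fintype H] {M : PlanarMap H} {S : Set H} {R : Set M.Face}

theorem IsClockwiseFaceSet.fill (hR : M.IsClockwiseFaceSet S R) :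
    M.IsClockwiseFaceSet S (M.fill R) where
  nonempty := hR.nonempty.mono (subset_fill hR.outer_notMem)
  outer_notMem := outer_notMem_fill R
  cut_subset h hh := hR.cut_subset h (mem_cut.mpr ⟨face_mem_of_mem_cut_fill hh,
    fun hopp => (mem_cut.mp hh).2 (subset_fill hR.outer_notMem hopp)⟩)

theorem IsClockwiseFaceSet.not_isOuterVertex (hS : M.Balanced S) (hR : M.IsClockwiseFaceSet S R)
    {h : H} (hh : M.face h ∈ R) : ¬ M.IsOuterVertex (M.origin h) := by
  rintro ⟨k, hkh, hk⟩
  obtain ⟨b, hb, hbk⟩ := exists_mem_cut_of_origin_eq hkh.symm hh (hk ▸ hR.outer_notMem)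
  exact hS.not_outer b (hR.cut_subset b hb) ⟨k, hkh.trans hbk.symm, hk⟩

variable (M) in
/-- A clockwise set of faces without holes, minimal as such. -/
structure IsMinimalClockwiseFaceSet (S : Set H) (R : Set M.Face) : Prop
    extends M.IsClockwiseFaceSet S R where
  fill_eq : M.fill R = R
  minimal : ∀ P, M.IsClockwiseFaceSet S P → M.fill P = P → P ⊆ R → R ⊆ P

theorem IsClockwiseFaceSet.exists_isMinimalClockwiseFaceSet (hR : M.IsClockwiseFaceSet S R) :
    ∃ P, M.IsMinimalClockwiseFaceSet S P := by
  obtain ⟨P, hP⟩ := (Set.toFinite {P | M.IsClockwiseFaceSet S P ∧ M.fill P = P}).exists_minimal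
    ⟨M.fill R, hR.fill, fill_fill R⟩
  exact ⟨P, { hP.prop.1 with
    fill_eq := hP.prop.2
    minimal := fun Q hQ hfill hQP => hP.le_of_le ⟨hQ, hfill⟩ hQP }⟩

namespace IsMinimalClockwiseFaceSet

variable {φ : M.Face → ℚ} {z : H → ℚ}

theorem eq_zero_of_notMem (hR : M.IsMinimalClockwiseFaceSet S R) (hout : φ M.outer = 0)
    (hφ : ∀ h, φ (M.face (M.opp h)) < φ (M.face h) → h ∈ S ∧ M.face h ∈ R) {f : M.Face}
    (hf : f ∉ R) : φ f = 0 := by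
  have hle : ∀ h, M.face h ∉ R → φ (M.face h) ≤ φ (M.face (M.opp h)) := fun h hh =>
    not_lt.mp fun hlt => hh (hφ h hlt).2
  rw [← hR.fill_eq] at hf
  replace hf := not_not.mp hf
  induction hf with
  | refl => exact hout
  | tail hreach hstep ih =>
    obtain ⟨hopp, h, rfl, rfl⟩ := hstep
    have hface : M.face h ∉ R := by
      rw [← hR.fill_eq]
      exact not_not.mpr hreach
    have hge := hle (M.opp h) hopp
    rw [M.opp_opp] at hge
    rw [← ih]
    exact le_antisymm hge (hle h hface)

theorem nonpos (hR : M.IsMinimalClockwiseFaceSet S R) (hout : φ M.outer = 0)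
    (hφ : ∀ h, φ (M.face (M.opp h)) < φ (M.face h) → h ∈ S ∧ M.face h ∈ R)
    (hcut : ∃ h ∈ M.cut R, φ (M.face h) = 0) (f : M.Face) : φ f ≤ 0 := by
  by_contra! hf
  obtain ⟨h, hh, hzero⟩ := hcut
  set P : Set M.Face := {f | 0 < φ f}
  have hPR : P ⊆ R := fun g hg => by_contra fun hgR => hg.ne' (hR.eq_zero_of_notMem hout hφ hgR)
  have hP : M.IsClockwiseFaceSet S P := by
    refine ⟨⟨f, hf⟩, hout.not_gt, fun k hk => (hφ k ?_).1⟩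
    obtain ⟨hpos, hopp⟩ := mem_cut.mp hk
    exact (not_lt.mp hopp).trans_lt hpos
  have hsub : M.fill P ⊆ R := (fill_mono hPR).trans hR.fill_eq.subset
  have heq : M.fill P = R := hsub.antisymm (hR.minimal _ hP.fill (fill_fill P) hsub)
  rw [← heq] at hh
  exact (face_mem_of_mem_cut_fill hh : 0 < φ (M.face h)).ne' hzero

theorem eq_zero_of_mem_cut (hR : M.IsMinimalClockwiseFaceSet S R) (hz : M.boundary ℚ z = 0)
    (hnonneg : ∀ h, 0 ≤ z h) (hsupp : ∀ h, z h ≠ 0 → h ∈ S ∧ M.face h ∈ R) {b k : H}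
    (hb : b ∈ M.cut R) (hzb : z b = 0) (hk : k ∈ M.cut R) : z k = 0 := by
  obtain ⟨φ, hout, hgrad⟩ := M.exists_potential_of_boundary_eq_zero hz
  have hφ : ∀ h, φ (M.face (M.opp h)) < φ (M.face h) → h ∈ S ∧ M.face h ∈ R := fun h hlt =>
    hsupp h (by linarith [hgrad h, hnonneg (M.opp h)])
  have hcut : ∀ h ∈ M.cut R, z h = φ (M.face h) := fun h hh => by
    have hopp := (mem_cut.mp hh).2
    have hz_opp : z (M.opp h) = 0 := by_contra fun hne => hopp (hsupp _ hne).2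
    have hgrad' := hgrad h
    rwa [hz_opp, hR.eq_zero_of_notMem hout hφ hopp, sub_zero, sub_zero] at hgrad'
  refine le_antisymm ?_ (hnonneg k)
  rw [hcut k hk]
  exact hR.nonpos hout hφ ⟨b, hb, hcut b hb ▸ hzb⟩ _

theorem eq_opp_of_boundary_eq_zero (hR : M.IsMinimalClockwiseFaceSet S R)
    (hz : M.boundary ℚ z = 0) (hsupp : ∀ h, z h ≠ z (M.opp h) → h ∈ S ∧ M.face h ∈ R) (h : H) :
    z h = z (M.opp h) := by
  obtain ⟨φ, hout, hgrad⟩ := M.exists_potential_of_boundary_eq_zero hz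
  have hsupp' : ∀ h, φ (M.face h) ≠ φ (M.face (M.opp h)) → h ∈ S ∧ M.face h ∈ R := fun h hne =>
    hsupp h (sub_ne_zero.mp (hgrad h ▸ sub_ne_zero.mpr hne))
  have hφ : ∀ h, φ (M.face (M.opp h)) < φ (M.face h) → h ∈ S ∧ M.face h ∈ R := fun h hlt =>
    hsupp' h hlt.ne'
  obtain ⟨b, hb⟩ := cut_nonempty hR.nonempty hR.outer_notMem
  have hzero : φ (M.face b) = 0 := by
    have hopp := (mem_cut.mp hb).2
    rw [← hR.eq_zero_of_notMem hout hφ hopp]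
    by_contra hne
    refine hopp (hsupp' (M.opp b) ?_).2
    rw [M.opp_opp]
    exact Ne.symm hne
  have hφ_zero : ∀ f, φ f = 0 := fun f => by
    refine le_antisymm (hR.nonpos hout hφ ⟨b, hb, hzero⟩ f) (neg_nonpos.mp ?_)
    exact hR.nonpos (φ := fun f => -φ f) (by simpa using hout)
      (fun h hlt => hsupp' h (neg_lt_neg_iff.mp hlt).ne) ⟨b, hb, by simpa using hzero⟩ f
  rw [← sub_eq_zero, hgrad, hφ_zero, hφ_zero, sub_zero]

end IsMinimalClockwiseFaceSet

end MinimalFaceSets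

section Flows

variable {H : Type*} {M : PlanarMap H}

variable (M) in
/-- One vertex follows another one along a half-edge of `T`. -/
def Step (T : Set H) (u w : M.Vertex) : Prop :=
  ∃ k ∈ T, M.origin k = u ∧ M.origin (M.opp k) = w

theorem exists_unit_flow [Fintype H] {T : Set H} {s t : M.Vertex}
    (hst : Relation.ReflTransGen (M.Step T) s t) :
    ∃ a : H → ℚ, (∀ h, 0 ≤ a h) ∧ (∀ h ∉ T, a h = 0) ∧
      M.boundary ℚ a = Pi.single s 1 - Pi.single t 1 := by
  induction hst with
  | refl => exact ⟨0, fun _ => le_rfl, fun _ _ => rfl, by rw [map_zero, sub_self]⟩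
  | tail _ hstep ih =>
    obtain ⟨a, hnonneg, hsupp, ha⟩ := ih
    obtain ⟨k, hkT, rfl, rfl⟩ := hstep
    refine ⟨a + Pi.single k 1, fun h => add_nonneg (hnonneg h) ?_, fun h hh => ?_, ?_⟩
    · exact (Pi.single_nonneg.mpr zero_le_one : (0 : H → ℚ) ≤ Pi.single k 1) h
    · rw [Pi.add_apply, hsupp h hh, Pi.single_eq_of_ne (ne_of_mem_of_not_mem hkT hh).symm, add_zero]
    · rw [map_add, ha, boundary_single]
      abel

variable (M) in
/-- The half-edges of `S` that separate two faces of `R`. -/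
def innerArcs (S : Set H) (R : Set M.Face) : Set H :=
  {k | k ∈ S ∧ M.face k ∈ R ∧ M.face (M.opp k) ∈ R}

variable [Fintype H] {S : Set H} {R : Set M.Face} {b m : H}

theorem IsMinimalClockwiseFaceSet.reflTransGen_step_cut (hR : M.IsMinimalClockwiseFaceSet S R)
    (hb : b ∈ M.cut R) (hm : m ∈ M.cut R) :
    Relation.ReflTransGen (M.Step {k | k ∈ M.cut R ∧ M.origin k ≠ M.origin b})
      (M.origin m) (M.origin b) := by
  set T : Set H := {k | k ∈ M.cut R ∧ M.origin k ≠ M.origin b}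
  by_contra hret
  have hne : ∀ k, Relation.ReflTransGen (M.Step T) (M.origin m) (M.origin k) →
      M.origin k ≠ M.origin b := fun k hk heq => hret (heq ▸ hk)
  obtain ⟨n, hn, c, hc, hcC⟩ := exists_isSimpleCycle_of_succ
    (C := {k | k ∈ M.cut R ∧ Relation.ReflTransGen (M.Step T) (M.origin m) (M.origin k)})
    ⟨m, hm, Relation.ReflTransGen.refl⟩ (fun k hk hopp => opp_notMem_cut hk.1 hopp.1)
    (fun k hk => by
      obtain ⟨l, hl, hlk⟩ := exists_cut_succ hk.1
      exact ⟨l, ⟨hl, hk.2.tail ⟨k, ⟨hk.1, hne k hk.2⟩, rfl, hlk.symm⟩⟩, hlk⟩)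
  have hzero : passes c (c 0) = 0 := by
    refine hR.eq_zero_of_mem_cut (boundary_passes_eq_zero hc.chain) (passes_nonneg c)
      (fun h hh => ?_) hb (passes_eq_zero ?_) (hcC 0).1
    · obtain ⟨i, rfl⟩ := not_imp_comm.mp passes_eq_zero hh
      exact ⟨hR.cut_subset _ (hcC i).1, (mem_cut.mp (hcC i).1).1⟩
    · rintro ⟨i, rfl⟩
      exact hne _ (hcC i).2 rfl
  rw [passes_of_injective hc.injective, ind_of_mem (Set.mem_range_self 0)] at hzero
  exact one_ne_zero hzero

/-- Otherwise the inner path could be closed up along the boundary, giving a circulation that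
omits `b`. -/
theorem IsMinimalClockwiseFaceSet.origin_eq_of_reflTransGen_step
    (hR : M.IsMinimalClockwiseFaceSet S R) (hb : b ∈ M.cut R) (hm : m ∈ M.cut R)
    (hbm : Relation.ReflTransGen (M.Step (M.innerArcs S R)) (M.origin b) (M.origin m)) :
    M.origin m = M.origin b := by
  by_contra hne
  obtain ⟨a, ha_nonneg, ha_supp, ha⟩ := exists_unit_flow hbm
  obtain ⟨r, hr_nonneg, hr_supp, hr⟩ := exists_unit_flow (hR.reflTransGen_step_cut hb hm)
  have ha_cut : ∀ h ∈ M.cut R, a h = 0 := fun h hh =>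
    ha_supp h fun hinner => (mem_cut.mp hh).2 hinner.2.2
  have hr_cut : ∀ h ∉ M.cut R, r h = 0 := fun h hh => hr_supp h fun hT => hh hT.1
  have hzero : ∀ k ∈ M.cut R, (a + r) k = 0 := fun k hk => by
    refine hR.eq_zero_of_mem_cut (z := a + r) ?_ (fun h => add_nonneg (ha_nonneg h) (hr_nonneg h))
      (fun h hh => ?_) hb ?_ hk
    · rw [map_add, ha, hr, sub_add_sub_cancel, sub_self]
    · by_cases hcut : h ∈ M.cut R
      · exact ⟨hR.cut_subset h hcut, (mem_cut.mp hcut).1⟩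
      · rw [Pi.add_apply, hr_cut h hcut, add_zero] at hh
        obtain ⟨hS, hface, -⟩ := not_imp_comm.mp (ha_supp h) hh
        exact ⟨hS, hface⟩
    · rw [Pi.add_apply, ha_cut b hb, hr_supp b fun hT => hT.2 rfl, add_zero]
  have hr_zero : r = 0 := funext fun h => by
    by_cases hcut : h ∈ M.cut R
    · have hsum := hzero h hcut
      rwa [Pi.add_apply, ha_cut h hcut, zero_add] at hsum
    · exact hr_cut h hcut
  have hflow := congrFun hr (M.origin m)
  simp [hr_zero, hne] at hflow

theorem IsMinimalClockwiseFaceSet.face_mem_of_reflTransGen_step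
    (hR : M.IsMinimalClockwiseFaceSet S R) (hb : b ∈ M.cut R) {l : H}
    (hl : Relation.ReflTransGen (M.Step (M.innerArcs S R)) (M.origin b) (M.origin l))
    (hne : M.origin l ≠ M.origin b) : M.face l ∈ R := by
  by_contra hlR
  obtain ⟨v, -, k, hk, -, hkl⟩ := (Relation.ReflTransGen.cases_tail hl).resolve_left hne
  obtain ⟨m, hm, hmk⟩ := exists_mem_cut_of_origin_eq hkl hk.2.2 hlR
  have hml := hmk.trans hkl
  exact hne (hml ▸ hR.origin_eq_of_reflTransGen_step hb hm (hml ▸ hl))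

end Flows

section Circulations

variable {H : Type*} [Fintype H] {M : PlanarMap H} {K : Type*} [Field K] {z : H → K}

theorem sum_boundary (z : H → K) : ∑ v, M.boundary K z v = 0 := by
  simp only [boundary_apply]
  rw [sum_fiberSum, Finset.sum_sub_distrib, Equiv.sum_comp M.opp z, sub_self]

theorem boundary_eq_zero_of_forall_ne {v₀ : M.Vertex} (hz : ∀ v ≠ v₀, M.boundary K z v = 0) :
    M.boundary K z = 0 := by
  funext v
  by_cases hv : v = v₀
  · rw [hv, ← Finset.sum_eq_single_of_mem v₀ (Finset.mem_univ _) fun v _ => hz v]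
    exact M.sum_boundary z
  · exact hz v hv

theorem boundary_eq_zero_of_forall_origin {v : M.Vertex}
    (hz : ∀ h, M.origin h = v → z h = z (M.opp h)) : M.boundary K z v = 0 := by
  rw [boundary_apply]
  exact Finset.sum_eq_zero fun h hh => sub_eq_zero.mpr (hz h (by simpa using hh))

/-- Half the edges carry independent chains, and all but one of the vertices give the equations
of a circulation. -/
theorem exists_circulation_of_card_le {B : Set H} (hB : ∀ h ∈ B, M.opp h ∈ B)
    {Y : Finset M.Vertex} (hY : Y.Nonempty) (hBY : ∀ h ∈ B, M.origin h ∈ Y)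
    (hcard : 2 * #Y ≤ #{h | h ∈ B}) :
    ∃ z : H → K, M.boundary K z = 0 ∧ (∀ h, z h ≠ z (M.opp h) → h ∈ B) ∧
      ∃ h, z h ≠ z (M.opp h) := by
  obtain ⟨v₀, hv₀⟩ := hY
  rw [M.card_eq_two_mul_card_inter_chosen hB] at hcard
  have hpos := Finset.card_pos.mpr ⟨v₀, hv₀⟩
  obtain ⟨z, ⟨k, ⟨-, hk⟩, hzk⟩, hsupp, hz⟩ := exists_ne_zero_of_card_lt
    (E := {h | h ∈ B ∧ h ∈ M.chosen})
    ((LinearMap.funLeft K K (Subtype.val : Y.erase v₀ → M.Vertex)).comp (M.boundary K)) (by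
      rw [Fintype.card_coe, Finset.card_erase_of_mem hv₀]
      simp only [Set.mem_ofPred_eq]
      omega)
  have hzB : ∀ h, z h ≠ z (M.opp h) → h ∈ B := fun h hne => by
    by_contra hh
    have hopp : M.opp h ∉ B := fun hopp => hh (M.opp_opp h ▸ hB _ hopp)
    exact hne ((hsupp h fun hE => hh hE.1).trans (hsupp _ fun hE => hopp hE.1).symm)
  refine ⟨z, boundary_eq_zero_of_forall_ne (v₀ := v₀) fun v hv => ?_, hzB, k, ?_⟩
  · by_cases hvY : v ∈ Y
    · exact congrFun hz ⟨v, Finset.mem_erase.mpr ⟨hv, hvY⟩⟩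
    · refine boundary_eq_zero_of_forall_origin fun h hh => by_contra fun hne => hvY ?_
      exact hh ▸ hBY h (hzB h hne)
  · rwa [hsupp (M.opp k) fun hE => (M.mem_chosen_iff k).mp hk hE.2]

end Circulations

section InnerPaths

variable {H : Type*} [Fintype H] {M : PlanarMap H} {S : Set H} {R : Set M.Face}

theorem two_mul_card_le_card_biOriented (hD : M.IsHexagonDissection) (hI : M.IsIrreducible)
    {Y : Finset M.Vertex} (hY : Y.Nonempty) (hin : ∀ v ∈ Y, ¬ M.IsOuterVertex v) {T : Finset H}
    (hT : T ⊆ M.halfEdgesInside Y) (hcard : 3 * #Y ≤ #T + 2) :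
    2 * #Y ≤ #{h ∈ T | M.opp h ∈ T} := by
  have hinter : T ∩ T.image M.opp = {h ∈ T | M.opp h ∈ T} := by
    ext h
    simp only [Finset.mem_inter, Finset.mem_filter, Finset.mem_image, M.opp_eq_iff, exists_eq_right]
  have hunion : T ∪ T.image M.opp ⊆ M.halfEdgesInside Y := by
    refine Finset.union_subset hT fun h hh => ?_
    obtain ⟨k, hk, rfl⟩ := Finset.mem_image.mp hh
    obtain ⟨horigin, hopp⟩ := mem_halfEdgesInside.mp (hT hk)
    exact mem_halfEdgesInside.mpr ⟨hopp, by rwa [M.opp_opp]⟩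
  have hsum := Finset.card_union_add_card_inter T (T.image M.opp)
  rw [Finset.card_image_of_injective _ M.opp.injective, hinter] at hsum
  have hle := Finset.card_le_card hunion
  have hsparse := card_halfEdgesInside_add_four_le hD hI hY hin
  omega

variable (M) in
/-- The vertices that can be reached from `v` along half-edges of `A`. -/
noncomputable def reachable (A : Set H) (v : M.Vertex) : Finset M.Vertex :=
  {w | Relation.ReflTransGen (M.Step A) v w}

theorem mem_reachable {A : Set H} {v w : M.Vertex} :
    w ∈ M.reachable A v ↔ Relation.ReflTransGen (M.Step A) v w := by simp [reachable]

variable (M) in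
/-- The half-edges of `A` at the vertices that can be reached from `v`. -/
noncomputable def reachableArcs (A : Set H) (v : M.Vertex) : Finset H :=
  {h | h ∈ A ∧ M.origin h ∈ M.reachable A v}

theorem mem_reachableArcs {A : Set H} {v : M.Vertex} {h : H} :
    h ∈ M.reachableArcs A v ↔ h ∈ A ∧ M.origin h ∈ M.reachable A v := by simp [reachableArcs]

theorem reachableArcs_subset_halfEdgesInside (A : Set H) (v : M.Vertex) :
    M.reachableArcs A v ⊆ M.halfEdgesInside (M.reachable A v) := fun h hh => by
  obtain ⟨hA, hreach⟩ := mem_reachableArcs.mp hh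
  exact mem_halfEdgesInside.mpr
    ⟨hreach, mem_reachable.mpr ((mem_reachable.mp hreach).tail ⟨h, hA, rfl, rfl⟩)⟩

theorem three_mul_card_reachable_le {A : Set H} {h₀ : H} (hh₀ : h₀ ∈ A)
    (hA : ∀ v ∈ M.reachable A (M.origin h₀), v ≠ M.origin h₀ → 3 ≤ #{h | M.origin h = v ∧ h ∈ A}) :
    3 * #(M.reachable A (M.origin h₀)) ≤ #(M.reachableArcs A (M.origin h₀)) + 2 := by
  set Y := M.reachable A (M.origin h₀)
  set T := M.reachableArcs A (M.origin h₀)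
  have hmem : ∀ {h}, h ∈ T ↔ h ∈ A ∧ M.origin h ∈ Y := mem_reachableArcs
  have hv₀ : M.origin h₀ ∈ Y := mem_reachable.mpr Relation.ReflTransGen.refl
  have hstart : 1 ≤ #{h ∈ T | M.origin h = M.origin h₀} :=
    Finset.card_pos.mpr ⟨h₀, Finset.mem_filter.mpr ⟨hmem.mpr ⟨hh₀, hv₀⟩, rfl⟩⟩
  have hrest : #(Y.erase (M.origin h₀)) * 3 ≤
      ∑ v ∈ Y.erase (M.origin h₀), #{h ∈ T | M.origin h = v} := by
    refine Finset.card_nsmul_le_sum _ _ 3 fun v hv => ?_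
    obtain ⟨hne, hvY⟩ := Finset.mem_erase.mp hv
    refine (hA v hvY hne).trans (Finset.card_le_card fun h hh => ?_)
    obtain ⟨rfl, hhA⟩ := (Finset.mem_filter.mp hh).2
    exact Finset.mem_filter.mpr ⟨hmem.mpr ⟨hhA, hvY⟩, rfl⟩
  rw [Finset.card_eq_sum_card_fiberwise (f := M.origin) (t := Y) (fun h hh => (hmem.mp hh).2),
    ← Finset.add_sum_erase Y _ hv₀]
  rw [Finset.card_erase_of_mem hv₀] at hrest
  omega

namespace IsMinimalClockwiseFaceSet

theorem face_mem_of_mem_reachable (hR : M.IsMinimalClockwiseFaceSet S R) {b l : H}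
    (hb : b ∈ M.cut R) (hl : M.origin l ∈ M.reachable (M.innerArcs S R) (M.origin b))
    (hne : M.origin l ≠ M.origin b) : M.face l ∈ R :=
  hR.face_mem_of_reflTransGen_step hb (mem_reachable.mp hl) hne

theorem not_isOuterVertex_of_mem_reachable (hS : M.Balanced S)
    (hR : M.IsMinimalClockwiseFaceSet S R) {b : H} (hb : b ∈ M.cut R) {v : M.Vertex}
    (hv : v ∈ M.reachable (M.innerArcs S R) (M.origin b)) : ¬ M.IsOuterVertex v := by
  by_cases hne : v = M.origin b
  · exact hne ▸ hR.not_isOuterVertex hS (mem_cut.mp hb).1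
  · obtain ⟨l, rfl⟩ := M.origin_surjective v
    exact hR.not_isOuterVertex hS (hR.face_mem_of_mem_reachable hb hv hne)

theorem card_innerArcs_of_mem_reachable (hS : M.Balanced S)
    (hR : M.IsMinimalClockwiseFaceSet S R) {b : H} (hb : b ∈ M.cut R) {v : M.Vertex}
    (hv : v ∈ M.reachable (M.innerArcs S R) (M.origin b)) (hne : v ≠ M.origin b) :
    3 ≤ #{h | M.origin h = v ∧ h ∈ M.innerArcs S R} := by
  rw [← hS.vertex v (hR.not_isOuterVertex_of_mem_reachable hS hb hv)]
  refine Finset.card_le_card fun h hh => ?_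
  obtain ⟨-, rfl, hhS⟩ := Finset.mem_filter.mp hh
  refine Finset.mem_filter.mpr ⟨Finset.mem_univ h, rfl, hhS,
    hR.face_mem_of_mem_reachable hb hv hne, ?_⟩
  rw [← M.face_rot]
  rw [← M.origin_rot h] at hv hne
  exact hR.face_mem_of_mem_reachable hb hv hne

/-- Otherwise the half-edges reachable from `h₀` inside `R` contain enough bi-oriented edges to
carry a circulation, which contradicts the minimality of `R`. -/
theorem notMem_of_origin_eq (hD : M.IsHexagonDissection) (hI : M.IsIrreducible)
    (hS : M.Balanced S) (hR : M.IsMinimalClockwiseFaceSet S R) {h₀ b : H}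
    (hface : M.face h₀ ∈ R) (hopp : M.face (M.opp h₀) ∈ R) (hb : b ∈ M.cut R)
    (hb₀ : M.origin b = M.origin h₀) : h₀ ∉ S := by
  intro hh₀
  have hv₀ : (M.reachable (M.innerArcs S R) (M.origin h₀)).Nonempty :=
    ⟨_, mem_reachable.mpr Relation.ReflTransGen.refl⟩
  have hcard := three_mul_card_reachable_le (A := M.innerArcs S R) ⟨hh₀, hface, hopp⟩
    fun v hv hne => hR.card_innerArcs_of_mem_reachable hS hb (hb₀ ▸ hv) (hb₀ ▸ hne)
  have hbi := two_mul_card_le_card_biOriented hD hI hv₀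
    (fun v hv => hR.not_isOuterVertex_of_mem_reachable hS hb (hb₀ ▸ hv))
    (reachableArcs_subset_halfEdgesInside _ _) hcard
  set T := M.reachableArcs (M.innerArcs S R) (M.origin h₀)
  obtain ⟨z, hz, hsupp, k, hk⟩ := exists_circulation_of_card_le (K := ℚ)
    (B := {h | h ∈ T ∧ M.opp h ∈ T}) (fun h hh => ⟨hh.2, (M.opp_opp h).symm ▸ hh.1⟩) hv₀
    (fun h hh => (mem_reachableArcs.mp hh.1).2)
    (hbi.trans (Finset.card_le_card fun h hh => by simpa using hh))
  refine hk (hR.eq_opp_of_boundary_eq_zero hz (fun h hne => ?_) k)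
  obtain ⟨hhS, hhR, -⟩ := (mem_reachableArcs.mp (hsupp h hne).1).1
  exact ⟨hhS, hhR⟩

end IsMinimalClockwiseFaceSet

theorem IsClockwiseFaceSet.exists_isClockwiseEdgeSet (hD : M.IsHexagonDissection)
    (hI : M.IsIrreducible) (hS : M.Balanced S) (hR : M.IsClockwiseFaceSet S R) :
    ∃ B, M.IsClockwiseEdgeSet S B := by
  obtain ⟨P, hP⟩ := hR.exists_isMinimalClockwiseFaceSet
  refine ⟨{h | M.face h ∈ P ∧ M.face (M.opp h) ∈ P}, ⟨?_, fun h => ?_, fun h hh => ?_,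
    fun h hh hrot => ?_, fun h hh hrot => ?_⟩⟩
  · obtain ⟨f, hf⟩ := hP.nonempty
    obtain ⟨h, ⟨rfl, -, hhS⟩, -⟩ := hS.face f (ne_of_mem_of_not_mem hf hP.outer_notMem)
    exact ⟨h, hf, by_contra fun hopp => hhS (hP.cut_subset h (mem_cut.mpr ⟨hf, hopp⟩))⟩
  · simp only [Set.mem_ofPred_eq, M.opp_opp, and_comm]
  · exact hP.not_isOuterVertex hS hh.1
  · have hcut : M.rot.symm h ∉ P.preimage M.face := fun hface => hrot
      ⟨hface, by rw [M.face_opp_rot_symm]; exact hh.1⟩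
    obtain ⟨b, hb, hbh⟩ := exists_mem_cut_of_origin_eq (M.origin_rot_symm h).symm hh.1 hcut
    exact hP.notMem_of_origin_eq hD hI hS hh.1 hh.2 hb hbh
  · have hface := hrot.2
    rw [M.face_opp_rot_symm] at hface
    exact hP.cut_subset h (mem_cut.mpr ⟨hface, fun hopp => hh ⟨hface, hopp⟩⟩)

end InnerPaths

section InwardEdges

variable {H : Type*} [Fintype H] {M : PlanarMap H} {S : Set H}

theorem Balanced.not_isOuterVertex_of_notMem (hD : M.IsHexagonDissection) (hI : M.IsIrreducible)
    (hS : M.Balanced S) {h : H} (hin : M.IsInner h) (hopp : M.opp h ∉ S) :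
    ¬ M.IsOuterVertex (M.origin h) := by
  intro hout
  have hne : M.rot h ≠ M.opp h := fun heq =>
    hD.origin_opp_ne h (heq ▸ M.origin_rot h)
  exact hS.not_outer _ (hS.mem_of_face_eq hD hopp (not_isOuterVertex_opp hD hI hin hout)
    (M.face_rot h) hne) (by rwa [M.origin_rot])

theorem Balanced.mem_or_opp_mem (hD : M.IsHexagonDissection) (hI : M.IsIrreducible)
    (hS : M.Balanced S) (hB : ∀ B, ¬ M.IsClockwiseEdgeSet S B) {h : H} (hin : M.IsInner h) :
    h ∈ S ∨ M.opp h ∈ S := by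
  by_contra! hboth
  obtain ⟨hh, hopp⟩ := hboth
  have hnotMem : ∀ k, k = h ∨ k = M.opp h → k ∉ S := by
    rintro k (rfl | rfl) <;> assumption
  have hout : ∀ k, k = h ∨ k = M.opp h → ¬ M.IsOuterVertex (M.origin k) := by
    rintro k (rfl | rfl)
    · exact hS.not_isOuterVertex_of_notMem hD hI hin hopp
    · exact hS.not_isOuterVertex_of_notMem hD hI hin.opp (by rwa [M.opp_opp])
  have hmem_opp : ∀ k, M.opp k = h ∨ M.opp k = M.opp h ↔ k = h ∨ k = M.opp h := fun k => by
    rw [M.opp_eq_iff, M.opp.injective.eq_iff, or_comm]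
  refine hB {k | k = h ∨ k = M.opp h} ⟨⟨h, Or.inl rfl⟩, hmem_opp, hout,
    fun k hk _ => hnotMem k hk, fun k hk hrot => ?_⟩
  have hopp_rot := (hmem_opp _).mpr hrot
  refine hS.mem_of_face_eq hD (hnotMem _ hopp_rot) (hout _ hopp_rot) (M.face_opp_rot_symm k).symm ?_
  intro heq
  rw [← heq] at hopp_rot
  exact hk hopp_rot

end InwardEdges

namespace InnerOrientation

variable {H : Type*} {M : PlanarMap H}

/-- The outward half-edges of an orientation, by which the orientation is determined. -/
def outwardSet (X : M.InnerOrientation) : Set H := {h | ∃ hin, X ⟨h, hin⟩ = Direction.outward}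

theorem mem_outwardSet {X : M.InnerOrientation} {h : H} (hin : M.IsInner h) :
    h ∈ outwardSet X ↔ X ⟨h, hin⟩ = Direction.outward :=
  ⟨fun ⟨_, hX⟩ => hX, fun hX => ⟨hin, hX⟩⟩

theorem outwardSet_injective : Function.Injective (outwardSet : M.InnerOrientation → Set H) := by
  intro X Y hXY
  funext h
  have hiff : X h = Direction.outward ↔ Y h = Direction.outward := by
    rw [← mem_outwardSet h.2, ← mem_outwardSet h.2, hXY]
  cases hX : X h <;> cases hY : Y h <;> simp_all

theorem exists_outwardSet_eq {S : Set H} (hS : ∀ h ∈ S, M.IsInner h) :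
    ∃ X : M.InnerOrientation, outwardSet X = S := by
  refine ⟨fun h => if h.1 ∈ S then Direction.outward else Direction.inward, Set.ext fun h => ?_⟩
  refine ⟨fun ⟨_, hX⟩ => ?_, fun hh => ⟨hS h hh, if_pos hh⟩⟩
  by_contra hh
  simp [hh] at hX

theorem biOriented_or_simplyOriented_iff {X : M.InnerOrientation} {h : M.InnerHalfEdge} :
    BiOriented X h ∨ SimplyOriented X h ↔ X h = Direction.outward := by
  unfold BiOriented SimplyOriented
  cases X (M.innerOpp h) <;> simp

variable [Fintype H]

theorem outdegree_eq_card (X : M.InnerOrientation) (v : M.Vertex) :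
    outdegree X v = #{h | M.origin h = v ∧ h ∈ outwardSet X} := by
  rw [outdegree, ← Fintype.card_subtype, ← Nat.card_eq_fintype_card]
  exact Nat.card_congr
    { toFun := fun h => ⟨h.1.1, h.2.1, h.1.2, h.2.2⟩
      invFun := fun h => ⟨⟨h.1, h.2.2.1⟩, h.2.1, h.2.2.2⟩
      left_inv := fun _ => rfl
      right_inv := fun _ => rfl }

theorem noClockwiseCircuit_iff (X : M.InnerOrientation) :
    NoClockwiseCircuit X ↔ ∀ R, ¬ M.IsClockwiseFaceSet (outwardSet X) R := by
  constructor
  · intro hX R hR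
    obtain ⟨n, _, c, hc, hright, hcS⟩ := hR.exists_isSimpleCycle
    refine hX n c ⟨hc, hright, fun i => ?_⟩
    obtain ⟨hin, hXi⟩ := hcS i
    exact ⟨hin, biOriented_or_simplyOriented_iff.mpr hXi⟩
  · intro hX n _ c hc
    obtain ⟨R, hR⟩ := hc.simple.exists_isClockwiseFaceSet hc.interior_right fun i => by
      obtain ⟨hin, hXi⟩ := hc.oriented i
      exact (mem_outwardSet hin).mpr (biOriented_or_simplyOriented_iff.mp hXi)
    exact hX R hR

namespace IsTriOrientation

variable {X : M.InnerOrientation}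

omit [Fintype H] in
theorem not_isOuterVertex (hX : IsTriOrientation X) {h : H} (hh : h ∈ outwardSet X) :
    ¬ M.IsOuterVertex (M.origin h) := by
  have := M.finite
  let _ : Fintype H := Fintype.ofFinite H
  intro hout
  have hzero := hX.outer_vertex _ hout
  rw [outdegree_eq_card, Finset.card_eq_zero, Finset.filter_eq_empty_iff] at hzero
  exact hzero (Finset.mem_univ h) ⟨rfl, hh⟩

/-- Otherwise the boundary of `f` is itself a clockwise circuit. -/
theorem exists_inward (hD : M.IsHexagonDissection) (hX : IsTriOrientation X)
    (hR : ∀ R, ¬ M.IsClockwiseFaceSet (outwardSet X) R) {f : M.Face} (hf : f ≠ M.outer) :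
    ∃ h, M.face h = f ∧ M.IsInner h ∧ h ∉ outwardSet X := by
  by_contra! hall
  have hout : ∀ h, M.face h = f → ¬ M.IsOuterVertex (M.origin h) := by
    rintro h rfl hh
    obtain ⟨k, hk, hin, hkout⟩ := exists_isInner_of_isOuterVertex hD hf hh
    exact hX.not_isOuterVertex (hall k hk hin) hkout
  refine hR {f} ⟨Set.singleton_nonempty f, hf.symm, fun h hh => ?_⟩
  have hface : M.face h = f := (mem_cut.mp hh).1
  exact hall h hface (isInner_of_not_isOuterVertex (hout h hface))

theorem card_outward (hX : IsTriOrientation X) :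
    #{h | M.IsInner h ∧ h ∈ outwardSet X} =
      ∑ v : M.Vertex, if M.IsOuterVertex v then 0 else 3 := by
  rw [Finset.card_eq_sum_card_fiberwise (f := M.origin) fun _ _ => Finset.mem_univ _]
  refine Finset.sum_congr rfl fun v _ => ?_
  have hdegree : outdegree X v = if M.IsOuterVertex v then 0 else 3 := by
    split_ifs with hv
    · exact hX.outer_vertex v hv
    · exact hX.inner_vertex v hv
  rw [← hdegree, outdegree_eq_card, Finset.filter_filter]
  exact congrArg Finset.card (Finset.filter_congr fun h _ =>
    ⟨fun hh => ⟨hh.2, hh.1.2⟩, fun hh => ⟨⟨hh.2.1, hh.2⟩, hh.1⟩⟩)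

theorem card_inward (hD : M.IsHexagonDissection) (hX : IsTriOrientation X) :
    #{h | M.IsInner h ∧ h ∉ outwardSet X} + 1 = Fintype.card M.Face := by
  have hsplit := Finset.card_filter_add_card_filter_not
    (s := ({h | M.IsInner h} : Finset H)) (· ∈ outwardSet X)
  rw [Finset.filter_filter, Finset.filter_filter, hX.card_outward] at hsplit
  have hinner := hD.card_isInner_add_one
  omega

/-- There is at least one inward half-edge in each inner face, and as many of them as inner
faces. -/
theorem balanced (hD : M.IsHexagonDissection) (hX : IsTriOrientation X)
    (hR : ∀ R, ¬ M.IsClockwiseFaceSet (outwardSet X) R) : M.Balanced (outwardSet X) := by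
  refine ⟨fun h hh => hX.not_isOuterVertex hh, fun v hv => ?_, fun f hf => ?_⟩
  · rw [← outdegree_eq_card]
    exact hX.inner_vertex v hv
  have := M.nonempty
  choose! inward hface hinward using fun f => hX.exists_inward hD hR (f := f)
  have hsurj : Finset.image inward (Finset.univ.erase M.outer) =
      ({h | M.IsInner h ∧ h ∉ outwardSet X} : Finset H) := by
    refine Finset.eq_of_subset_of_card_le (fun h hh => ?_) ?_
    · obtain ⟨g, hg, rfl⟩ := Finset.mem_image.mp hh
      exact Finset.mem_filter_univ _ |>.mpr (hinward g (Finset.ne_of_mem_erase hg))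
    · rw [Finset.card_image_of_injOn fun g hg g' hg' heq => ?_,
        Finset.card_erase_of_mem (Finset.mem_univ _), Finset.card_univ, ← hX.card_inward hD,
        Nat.add_sub_cancel]
      rw [← hface g (Finset.ne_of_mem_erase hg), heq, hface g' (Finset.ne_of_mem_erase hg')]
  refine ⟨inward f, ⟨hface f hf, hinward f hf⟩, fun h ⟨hhf, hh⟩ => ?_⟩
  obtain ⟨g, hg, rfl⟩ := Finset.mem_image.mp (hsurj.ge ((Finset.mem_filter_univ _).mpr hh))
  rw [← hhf, hface g (Finset.ne_of_mem_erase hg)]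

end IsTriOrientation

theorem isTriOrientation_of_balanced {X : M.InnerOrientation} (hS : M.Balanced (outwardSet X))
    (hX : ∀ h, M.IsInner h → h ∈ outwardSet X ∨ M.opp h ∈ outwardSet X) :
    IsTriOrientation X := by
  refine ⟨fun v hv => ?_, fun v hv => ?_, fun h ⟨hh, hopp⟩ => ?_⟩
  · rw [outdegree_eq_card, Finset.card_eq_zero, Finset.filter_eq_empty_iff]
    rintro h - ⟨rfl, hh⟩
    exact hS.not_outer h hh hv
  · rw [outdegree_eq_card]
    exact hS.vertex v hv
  · rcases hX h.1 h.2 with ⟨_, hout⟩ | ⟨_, hout⟩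
    · exact Direction.noConfusion (hh.symm.trans hout)
    · exact Direction.noConfusion (hopp.symm.trans hout)

end InnerOrientation

end PlanarMap

theorem mainTheorem2 {H : Type*} (D : PlanarMap H)
    (hD : D.IsHexagonDissection) (hirr : D.IsIrreducible) :
    ∃! X : D.InnerOrientation,
      PlanarMap.InnerOrientation.IsTriOrientation X ∧
        PlanarMap.InnerOrientation.NoClockwiseCircuit X := by
  have := D.finite
  let _ : Fintype H := Fintype.ofFinite H
  simp only [PlanarMap.InnerOrientation.noClockwiseCircuit_iff]
  obtain ⟨S, hS, hB⟩ := PlanarMap.exists_balanced_without_isClockwiseEdgeSet hD hirr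
  obtain ⟨X, rfl⟩ := PlanarMap.InnerOrientation.exists_outwardSet_eq
    fun h hh => PlanarMap.isInner_of_not_isOuterVertex (hS.not_outer h hh)
  refine ⟨X, ⟨PlanarMap.InnerOrientation.isTriOrientation_of_balanced hS
    fun h hh => hS.mem_or_opp_mem hD hirr hB hh, fun R hR => ?_⟩, fun Y ⟨hY, hYR⟩ => ?_⟩
  · obtain ⟨B, hBX⟩ := hR.exists_isClockwiseEdgeSet hD hirr hS
    exact hB B hBX
  · have hYS := hY.balanced hD hYR
    by_contra hne
    rcases hYS.exists_isClockwiseEdgeSet hS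
      (PlanarMap.InnerOrientation.outwardSet_injective.ne hne) with ⟨B, hBY⟩ | ⟨B, hBX⟩
    · exact hYR _ (hBY.isClockwiseFaceSet hD hYS)
    · exact hB B hBX
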